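/- Let $\mathbb T=\mathbb R/\mathbb Z$ and $\mathbb T^2=\mathbb R^2/\mathbb Z^2$. For a Riemannian metric $g$ on $\mathbb T^2$ and $(m,n)\in\mathbb Z^2\cong H_1(\mathbb T^2,\mathbb Z)$, let $\mathcal L^{m,n}(\mathbb T^2,g)\subset(0,\infty)$ be the set of $g$-lengths of all (nonconstant, not necessarily primitive) closed geodesics in the homology class $(m,n)$, and put $$\mathcal L^{\mathrm{osc}}(\mathbb T^2,g)=\bigcup_{mn=0}\mathcal L^{m,n}(\mathbb T^2,g),\qquad \mathcal L_{\min}(\mathbb T^2,g)=\bigcup_{mn\neq0}\{\min\mathcal L^{m,n}(\mathbb T^2,g)\}.$$ For $0\le T<\infty$ (resp. $T=\infty$), $g$ satisfies the noncoincidence condition (NCC) up to $T$ if $\mathcal L_{\min}(\mathbb T^2,g)\cap\mathcal L^{\mathrm{osc}}(\mathbb T^2,g)\cap I=\varnothing$ with $I=[0,T]$ (resp. $I=[0,\infty)$). Let $r$ be an integer $\ge 2$, or $r=\infty$, or $r=\omega$ (real-analytic). Endow $C^r(\mathbb T)$ with its usual topology: uniform convergence of all derivatives of order $\le r$ if $r\ne\omega$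 (of all orders if $r=\infty$), and, if $r=\omega$, the locally convex inductive limit topology of the Banach spaces of functions having a bounded holomorphic extension to $\{|\operatorname{Im}z|<\rho\}$, $\rho>0$, with the supremum norm. Let $\mathcal P^r$ be the set of pairs $(f_1,f_2)\in C^r(\mathbb T)\times C^r(\mathbb T)$ such that $f_1(x_1)+f_2(x_2)>-1$ for all $x_1,x_2$, with the topology induced from the product, and for $(f_1,f_2)\in\mathcal P^r$ consider the Liouville metric $$g_{f_1,f_2}=\bigl(1+f_1(x_1)+f_2(x_2)\bigr)\,(\mathrm dx_1^2+\mathrm dx_2^2)$$ on $\mathbb T^2$. **Proposition.** (i) The set of $(f_1,f_2)\in\mathcal P^r$ for which $g_{f_1,f_2}$ satisfies NCC up to $T=\infty$ is generic in $\mathcal P^r$, i.e. it contains a countable intersection of open dense subsets of $\mathcal P^r$. (ii) For every finite $T\ge0$, the set of $(f_1,f_2)\in\mathcal P^r$ for which $g_{f_1,f_2}$ satisfies NCC up to $T$ is open and dense in $\mathcal P^r$. -/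

import Mathlib

open scoped ContDiff UniformConvergence Topology

noncomputable section

/-! ### Riemannian metrics on the torus `ℝ²/ℤ²`, closed geodesics, length spectra -/

/-- A `C²` Riemannian metric on the torus `ℝ²/ℤ²`, given by its coefficients `g_{ij}` on the
universal cover `ℝ²`. -/
structure TorusMetric where
  coeff : (Fin 2 → ℝ) → Matrix (Fin 2) (Fin 2) ℝ
  contDiff_coeff : ∀ i j, ContDiff ℝ 2 fun x => coeff x i j
  posDef_coeff : ∀ x, (coeff x).PosDef
  periodic_coeff : ∀ (x : Fin 2 → ℝ) (k : Fin 2 → ℤ), coeff (x + fun i => (k i : ℝ)) = coeff x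

namespace TorusMetric

/-- The squared length `g_x(v, v)`. -/
def normSq (g : TorusMetric) (x v : Fin 2 → ℝ) : ℝ :=
  ∑ i, ∑ j, g.coeff x i j * v i * v j

/-- The partial derivative `∂_k g_{ij}` at `x`. -/
def partialCoeff (g : TorusMetric) (k i j : Fin 2) (x : Fin 2 → ℝ) : ℝ :=
  fderiv ℝ (fun y => g.coeff y i j) x (Pi.single k 1)

/-- `γ` is (the lift to `ℝ²` of) a unit-speed geodesic defined for all times. The last condition
is the geodesic equation in Euler–Lagrange form,
`d/dt (∑ⱼ g_{kj}(γ) γ'ⱼ) = ½ ∑_{i,j} ∂_k g_{ij}(γ) γ'ᵢ γ'ⱼ`. -/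
structure IsUnitSpeedGeodesic (g : TorusMetric) (γ : ℝ → Fin 2 → ℝ) : Prop where
  contDiff : ContDiff ℝ 2 γ
  unit_speed : ∀ t, g.normSq (γ t) (deriv γ t) = 1
  geodesic_eq : ∀ t k,
    deriv (fun s => ∑ j, g.coeff (γ s) k j * deriv γ s j) t =
      (1 / 2) * ∑ i, ∑ j, g.partialCoeff k i j (γ t) * deriv γ t i * deriv γ t j

/-- The Riemannian length of `γ` restricted to `[0, P]`. -/
def arcLength (g : TorusMetric) (γ : ℝ → Fin 2 → ℝ) (P : ℝ) : ℝ :=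
  ∫ t in (0 : ℝ)..P, Real.sqrt (g.normSq (γ t) (deriv γ t))

/-- The `(m,n)`-length spectrum: lengths of all (not necessarily primitive) closed geodesics in
the homology class `(m,n) ∈ ℤ² ≅ H₁(ℝ²/ℤ², ℤ)`. A closed geodesic with period `P` lies in the class
`(m,n)` when its lifts satisfy `γ(t + P) = γ(t) + (m,n)`. -/
def lengthSpectrum (g : TorusMetric) (m n : ℤ) : Set ℝ :=
  {ℓ | ∃ (γ : ℝ → Fin 2 → ℝ) (P : ℝ), 0 < P ∧ g.IsUnitSpeedGeodesic γ ∧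
    (∀ t, γ (t + P) = γ t + ![(m : ℝ), (n : ℝ)]) ∧ ℓ = g.arcLength γ P}

/-- The oscillatory length spectrum: the union of the `(m,n)`-length spectra over `mn = 0`. -/
def oscLengthSpectrum (g : TorusMetric) : Set ℝ :=
  {ℓ | ∃ m n : ℤ, m * n = 0 ∧ ℓ ∈ g.lengthSpectrum m n}

/-- The minimal length spectrum: the minima of the `(m,n)`-length spectra over `mn ≠ 0`. -/
def minLengthSpectrum (g : TorusMetric) : Set ℝ :=
  {ℓ | ∃ m n : ℤ, m * n ≠ 0 ∧ IsLeast (g.lengthSpectrum m n) ℓ}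

/-- The noncoincidence condition on `I`. -/
def NCC (g : TorusMetric) (I : Set ℝ) : Prop :=
  g.minLengthSpectrum ∩ g.oscLengthSpectrum ∩ I = ∅

end TorusMetric

/-! ### Spaces of functions on the circle `ℝ/ℤ` -/

/-- The `1`-periodic functions `ℝ → ℝ` of class `C^r`, where `r` is a natural number, `∞`, or `ω`
(real-analytic). -/
def circleFunSubmodule (r : WithTop ℕ∞) : Submodule ℝ (ℝ → ℝ) where
  carrier := {f | ContDiff ℝ r f ∧ Function.Periodic f 1}
  add_mem' := fun ha hb => ⟨ha.1.add hb.1, ha.2.add hb.2⟩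
  zero_mem' := ⟨contDiff_const, fun _ => rfl⟩
  smul_mem' := fun c _ hf => ⟨hf.1.const_smul c, fun x => congrArg (c • ·) (hf.2 x)⟩

/-- The space `C^r(ℝ/ℤ)`. It is not reducible to a subtype of `ℝ → ℝ`, so that it does not
inherit the topology of pointwise convergence. -/
def CircleFun (r : WithTop ℕ∞) : Type := circleFunSubmodule r

namespace CircleFun

variable {r : WithTop ℕ∞}

instance : AddCommGroup (CircleFun r) := inferInstanceAs (AddCommGroup (circleFunSubmodule r))

instance : Module ℝ (CircleFun r) := inferInstanceAs (Module ℝ (circleFunSubmodule r))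

instance : CoeFun (CircleFun r) (fun _ => ℝ → ℝ) := ⟨fun f => f.1⟩

/-- The `C^r` topology: uniform convergence of all derivatives of order `k ≤ r` (of all
orders if `r = ∞`). -/
@[reducible]
def crTopology (r : WithTop ℕ∞) : TopologicalSpace (CircleFun r) :=
  ⨅ (k : ℕ) (_ : (k : WithTop ℕ∞) ≤ r),
    TopologicalSpace.induced (fun f : CircleFun r => UniformFun.ofFun (iteratedDeriv k f))
      (inferInstance : TopologicalSpace (ℝ →ᵤ ℝ))

/-- `f` lies in the closed ball of radius `C` of the Banach space `A_ρ` of functions with a bounded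
holomorphic extension to the strip `|Im z| < ρ`, with the supremum norm. -/
def InStripBall (ρ C : ℝ) (f : CircleFun ω) : Prop :=
  ∃ F : ℂ → ℂ, DifferentiableOn ℂ F {z | |z.im| < ρ} ∧ (∀ x : ℝ, F x = (f x : ℂ)) ∧
    ∀ z : ℂ, |z.im| < ρ → ‖F z‖ ≤ C

/-- The usual topology of `C^ω(ℝ/ℤ) = ⋃_{ρ > 0} A_ρ`, the locally convex inductive limit: the finest
locally convex vector space topology for which every inclusion `A_ρ → C^ω(ℝ/ℤ)` is continuous
(equivalently, the inclusions being linear, continuous at `0`). In Mathlib's order on topologies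
the finest one is the infimum. -/
@[reducible]
def analyticTopology : TopologicalSpace (CircleFun ω) :=
  sInf {t | @IsTopologicalAddGroup (CircleFun ω) t _ ∧ @ContinuousSMul ℝ (CircleFun ω) _ _ t ∧
    @LocallyConvexSpace ℝ (CircleFun ω) _ _ _ _ t ∧
    ∀ ρ : ℝ, 0 < ρ → ∀ U ∈ @nhds (CircleFun ω) t 0,
      ∃ δ : ℝ, 0 < δ ∧ ∀ f, InStripBall ρ δ f → f ∈ U}

instance : TopologicalSpace (CircleFun r) :=
  match r with
  | ⊤ => analyticTopology
  | (k : ℕ∞) => crTopology k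

end CircleFun

/-! ### Liouville metrics -/

/-- The Liouville metric `(1 + f₁(x₁) + f₂(x₂)) (dx₁² + dx₂²)`. -/
def liouvilleMetric (f₁ f₂ : ℝ → ℝ) (h₁ : ContDiff ℝ 2 f₁) (h₂ : ContDiff ℝ 2 f₂)
    (p₁ : Function.Periodic f₁ 1) (p₂ : Function.Periodic f₂ 1)
    (hpos : ∀ x₁ x₂, -1 < f₁ x₁ + f₂ x₂) : TorusMetric where
  coeff x := Matrix.diagonal fun _ => 1 + f₁ (x 0) + f₂ (x 1)
  contDiff_coeff i j := by
    have h : ContDiff ℝ 2 fun x : Fin 2 → ℝ => 1 + f₁ (x 0) + f₂ (x 1) :=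
      (contDiff_const.add (h₁.comp (contDiff_apply ℝ ℝ 0))).add
        (h₂.comp (contDiff_apply ℝ ℝ 1))
    by_cases hij : i = j
    · subst hij
      simpa using h
    · simpa [Matrix.diagonal_apply_ne _ hij] using contDiff_const
  posDef_coeff x := Matrix.PosDef.diagonal fun _ => by linarith [hpos (x 0) (x 1)]
  periodic_coeff x k := by
    have e₁ : f₁ (x 0 + (k 0 : ℝ)) = f₁ (x 0) := by simpa using p₁.int_mul (k 0) (x 0)
    have e₂ : f₂ (x 1 + (k 1 : ℝ)) = f₂ (x 1) := by simpa using p₂.int_mul (k 1) (x 1)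
    simp [e₁, e₂]

/-- The pairs `(f₁, f₂)` of `C^r` functions on the circle with `f₁(x₁) + f₂(x₂) > -1`, with the
topology induced by the product topology. -/
abbrev LiouvillePair (r : WithTop ℕ∞) : Type :=
  {p : CircleFun r × CircleFun r // ∀ x₁ x₂ : ℝ, -1 < p.1 x₁ + p.2 x₂}

/-- The Liouville metric of a pair `(f₁, f₂)` of class `C^r`, `r ≥ 2`. -/
def LiouvillePair.metric {r : WithTop ℕ∞} (hr : 2 ≤ r) (p : LiouvillePair r) : TorusMetric :=
  liouvilleMetric p.1.1 p.1.2 (p.1.1.2.1.of_le hr) (p.1.2.2.1.of_le hr)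
    p.1.1.2.2 p.1.2.2.2 p.2

end

/-! With `u = 1 + f₁` and `w = f₂`, the geodesics of `(u + w) (dx² + dy²)` reparametrize to pairs of
solutions of the Newton equations `x'' = u' / 2`, `y'' = w' / 2` with `x'² + y'² = u + w`; the
quantity `c = u(x) - x'² = y'² - w(y)` is conserved, and the length is the action `∫ x'² + y'²`.

In a class `(m, n)` with `mn ≠ 0` both coordinates rotate, equality of the two periods determines
`c` as the maximum point of a concave function, and the length is its maximum. So the class has
at most one length. In a class `(0, n)` the coordinate `x` librates (or rests), and `c = u(x₀)`
at a turning point `x₀`.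

Coincidence of two classes is a closed condition on `(f₁, f₂)` by compactness of the geodesics of
bounded length, and only finitely many classes have lengths below `T` near a given pair. It
remains to destroy one coincidence by a small perturbation. Replace `w` by `w + s (w - μ)`, `μ`
being a weighted mean of `w`. To first order in `s`, the length in the class `(m, n)` does not
increase while those in the class `(0, n')` grow at a definite rate, but depend only to second
order on the turning point `x₀`. If the coincidence persisted for all small `s`,
turning points at distinct parameters `s < s'` would satisfy `|x₀(s') - x₀(s)|² ≥ C (s' - s)` for
some `C > 0`; for equidistant parameters this contradicts the pigeonhole principle in a period. -/

noncomputable section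

open Set Filter

/-! ### Bounds for derivatives -/

theorem exists_abs_le_of_continuous_of_periodic {f : ℝ → ℝ} {c : ℝ} (hf : Continuous f)
    (hp : Function.Periodic f c) (hc : c ≠ 0) : ∃ K, ∀ x, |f x| ≤ K := by
  obtain ⟨K, hK⟩ := (hp.isBounded_of_continuous hc hf).exists_norm_le
  exact ⟨K, fun x => hK _ (mem_range_self x)⟩

theorem exists_isLeast_range_of_continuous_of_periodic {f : ℝ → ℝ} {c : ℝ} (hf : Continuous f)
    (hp : Function.Periodic f c) (hc : c ≠ 0) : ∃ x, ∀ y, f x ≤ f y := by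
  obtain ⟨_, ⟨x, rfl⟩, hx⟩ :=
    (hp.compact_of_continuous hc hf).exists_isLeast (range_nonempty f)
  exact ⟨x, fun y => hx (mem_range_self y)⟩

theorem periodic_deriv {f : ℝ → ℝ} {c : ℝ} (hp : Function.Periodic f c) :
    Function.Periodic (deriv f) c := fun x => by
  rw [← deriv_comp_add_const, funext hp]

section MeanValue

variable {f f' : ℝ → ℝ} {C : ℝ}

theorem abs_sub_le_of_abs_hasDerivAt_le (hf : ∀ t, HasDerivAt f (f' t) t) (hC : ∀ t, |f' t| ≤ C)
    (s t : ℝ) : |f t - f s| ≤ C * |t - s| :=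
  convex_univ.norm_image_sub_le_of_norm_hasDerivWithin_le (fun z _ => (hf z).hasDerivWithinAt)
    (fun z _ => hC z) (mem_univ s) (mem_univ t)

theorem abs_taylor_le_of_lipschitz (hf : ∀ t, HasDerivAt f (f' t) t)
    (hC : ∀ s t, |f' t - f' s| ≤ C * |t - s|) (s t : ℝ) :
    |f t - f s - f' s * (t - s)| ≤ C * (t - s) ^ 2 := by
  have hC0 : 0 ≤ C := by simpa using (abs_nonneg _).trans (hC 0 1)
  have hd (z : ℝ) : HasDerivAt (fun z => f z - f' s * z) (f' z - f' s) z := by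
    simpa using (hf z).fun_sub ((hasDerivAt_id z).const_mul (f' s))
  have hbound : ∀ z ∈ uIcc s t, ‖f' z - f' s‖ ≤ C * |t - s| := fun z hz =>
    (hC s z).trans (mul_le_mul_of_nonneg_left (abs_sub_left_of_mem_uIcc hz) hC0)
  calc |f t - f s - f' s * (t - s)| = ‖f t - f' s * t - (f s - f' s * s)‖ := by
        rw [Real.norm_eq_abs]; ring_nf
    _ ≤ C * |t - s| * ‖t - s‖ := (convex_uIcc s t).norm_image_sub_le_of_norm_hasDerivWithin_le
        (fun z _ => (hd z).hasDerivWithinAt) hbound left_mem_uIcc right_mem_uIcc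
    _ = C * (t - s) ^ 2 := by rw [Real.norm_eq_abs, mul_assoc, ← sq, sq_abs]

end MeanValue

/-- `u` is of class `C²`, and `u`, `u'` and `u''` are bounded by `K`: the regularity of a potential
that the estimates on orbits depend on. -/
structure C2Bound (u : ℝ → ℝ) (K : ℝ) : Prop where
  contDiff : ContDiff ℝ 2 u
  abs_le : ∀ x, |u x| ≤ K
  abs_deriv_le : ∀ x, |deriv u x| ≤ K
  abs_deriv_deriv_le : ∀ x, |deriv (deriv u) x| ≤ K

theorem contDiff_one_deriv {u : ℝ → ℝ} (hu : ContDiff ℝ 2 u) : ContDiff ℝ 1 (deriv u) :=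
  (contDiff_succ_iff_deriv.1 (one_add_one_eq_two (R := WithTop ℕ∞) ▸ hu)).2.2

theorem exists_c2Bound {u : ℝ → ℝ} (hu : ContDiff ℝ 2 u) (hp : Function.Periodic u 1) :
    ∃ K, 0 < K ∧ C2Bound u K := by
  have hu' := contDiff_one_deriv hu
  have hp' := periodic_deriv hp
  obtain ⟨K₀, h₀⟩ := exists_abs_le_of_continuous_of_periodic hu.continuous hp one_ne_zero
  obtain ⟨K₁, h₁⟩ := exists_abs_le_of_continuous_of_periodic hu'.continuous hp' one_ne_zero
  obtain ⟨K₂, h₂⟩ := exists_abs_le_of_continuous_of_periodic (hu'.continuous_deriv le_rfl)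
    (periodic_deriv hp') one_ne_zero
  exact ⟨max 1 (max K₀ (max K₁ K₂)), by positivity, hu,
    fun x => (h₀ x).trans (by simp), fun x => (h₁ x).trans (by simp),
    fun x => (h₂ x).trans (by simp)⟩

namespace C2Bound

variable {u : ℝ → ℝ} {K : ℝ}

theorem nonneg (h : C2Bound u K) : 0 ≤ K := (abs_nonneg _).trans (h.abs_le 0)

theorem continuous (h : C2Bound u K) : Continuous u := h.contDiff.continuous

theorem continuous_deriv (h : C2Bound u K) : Continuous (deriv u) :=
  (contDiff_one_deriv h.contDiff).continuous

theorem hasDerivAt (h : C2Bound u K) (x : ℝ) : HasDerivAt u (deriv u x) x :=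
  (h.contDiff.differentiable two_ne_zero x).hasDerivAt

theorem abs_sub_le (h : C2Bound u K) (x y : ℝ) : |u y - u x| ≤ K * |y - x| :=
  abs_sub_le_of_abs_hasDerivAt_le h.hasDerivAt h.abs_deriv_le x y

theorem abs_deriv_sub_le (h : C2Bound u K) (x y : ℝ) : |deriv u y - deriv u x| ≤ K * |y - x| :=
  abs_sub_le_of_abs_hasDerivAt_le
    (fun z => ((contDiff_one_deriv h.contDiff).differentiable one_ne_zero z).hasDerivAt)
    h.abs_deriv_deriv_le x y

theorem abs_taylor_le (h : C2Bound u K) (x y : ℝ) :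
    |u y - u x - deriv u x * (y - x)| ≤ K * (y - x) ^ 2 :=
  abs_taylor_le_of_lipschitz h.hasDerivAt h.abs_deriv_sub_le x y

end C2Bound

/-! ### Newton equations on the line -/

theorem surjective_of_continuous_of_map_add_eq_add {f : ℝ → ℝ} (hf : Continuous f) {Q a : ℝ}
    (ha : a ≠ 0) (h : ∀ t, f (t + Q) = f t + a) : Function.Surjective f := by
  have hk (k : ℤ) : f (k * Q) = f 0 + k * a := by
    simpa using AddConstMapClass.map_add_zsmul (⟨f, h⟩ : AddConstMap ℝ ℝ Q a) 0 k
  intro ξ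
  obtain ⟨r, rfl⟩ : ∃ r, ξ = f 0 + r * a := ⟨(ξ - f 0) / a, by field_simp; ring⟩
  have hfloor := Int.floor_le r
  have hceil := Int.le_ceil r
  rcases ha.lt_or_gt with ha | ha
  · exact mem_range_of_exists_le_of_exists_ge hf
      ⟨⌈r⌉ * Q, by rw [hk]; nlinarith⟩ ⟨⌊r⌋ * Q, by rw [hk]; nlinarith⟩
  · exact mem_range_of_exists_le_of_exists_ge hf
      ⟨⌊r⌋ * Q, by rw [hk]; nlinarith⟩ ⟨⌈r⌉ * Q, by rw [hk]; nlinarith⟩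

/-- `x` solves the Newton equation `x'' = u'(x) / 2` (the potential is `-u / 2`), with velocity `v`.
These are the one-dimensional systems into which the geodesic flow of a Liouville metric
separates. -/
structure NewtonSolution (u x v : ℝ → ℝ) : Prop where
  hasDerivAt_pos : ∀ t, HasDerivAt x (v t) t
  hasDerivAt_vel : ∀ t, HasDerivAt v (deriv u (x t) / 2) t

namespace NewtonSolution

variable {u x v x₀ v₀ x₁ v₁ : ℝ → ℝ} {K : ℝ}

theorem continuous_pos (h : NewtonSolution u x v) : Continuous x :=
  continuous_iff_continuousAt.2 fun t => (h.hasDerivAt_pos t).continuousAt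

theorem continuous_vel (h : NewtonSolution u x v) : Continuous v :=
  continuous_iff_continuousAt.2 fun t => (h.hasDerivAt_vel t).continuousAt

theorem sq_vel_sub_eq (h : NewtonSolution u x v) (hu : Differentiable ℝ u) (s t : ℝ) :
    v s ^ 2 - u (x s) = v t ^ 2 - u (x t) := by
  have hd (t : ℝ) : HasDerivAt (fun t => v t ^ 2 - u (x t)) 0 t :=
    (((h.hasDerivAt_vel t).fun_pow 2).fun_sub
      ((hu (x t)).hasDerivAt.comp t (h.hasDerivAt_pos t))).congr_deriv (by push_cast; ring)
  exact is_const_of_deriv_eq_zero (fun t => (hd t).differentiableAt) (fun t => (hd t).deriv) s t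

theorem sq_vel_eq_of_vel_eq_zero (h : NewtonSolution u x v) (hu : Differentiable ℝ u) {s : ℝ}
    (hs : v s = 0) (t : ℝ) : v t ^ 2 = u (x t) - u (x s) := by
  have := h.sq_vel_sub_eq hu t s
  rw [hs] at this
  linarith

theorem comp_add_const (h : NewtonSolution u x v) (a : ℝ) :
    NewtonSolution u (fun t => x (t + a)) (fun t => v (t + a)) :=
  ⟨fun t => (h.hasDerivAt_pos _).comp_add_const t a,
    fun t => (h.hasDerivAt_vel _).comp_add_const t a⟩

theorem comp_const_sub (h : NewtonSolution u x v) (a : ℝ) :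
    NewtonSolution u (fun t => x (a - t)) (fun t => -v (a - t)) :=
  ⟨fun t => (h.hasDerivAt_pos _).comp_const_sub a t, fun t => by
    simpa using ((h.hasDerivAt_vel _).comp_const_sub a t).fun_neg⟩

theorem add_int (h : NewtonSolution u x v) (hp : Function.Periodic u 1) (k : ℤ) :
    NewtonSolution u (fun t => x t + k) v :=
  ⟨fun t => (h.hasDerivAt_pos t).add_const _, fun t => by
    have : deriv u (x t + k) = deriv u (x t) := by simpa using (periodic_deriv hp).int_mul k (x t)
    exact this ▸ h.hasDerivAt_vel t⟩

theorem vel_periodic (h : NewtonSolution u x v) {Q : ℝ} (hQ : Function.Periodic x Q) :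
    Function.Periodic v Q := fun t => by
  have := (h.hasDerivAt_pos (t + Q)).comp_add_const t Q
  rw [funext hQ] at this
  exact this.unique (h.hasDerivAt_pos t)

theorem lipschitzWith_field (hu : C2Bound u K) :
    LipschitzWith (max 1 K.toNNReal) fun q : ℝ × ℝ => (q.2, deriv u q.1 / 2) := by
  have hforce : LipschitzWith K.toNNReal fun y => deriv u y / 2 :=
    LipschitzWith.of_dist_le_mul fun y z => by
      have := hu.abs_deriv_sub_le z y
      rw [Real.coe_toNNReal _ hu.nonneg, Real.dist_eq, Real.dist_eq, ← sub_div, abs_div, abs_two]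
      linarith [abs_nonneg (deriv u y - deriv u z)]
  simpa using LipschitzWith.prod_snd.prodMk (hforce.comp LipschitzWith.prod_fst)

theorem hasDerivAt_prod (h : NewtonSolution u x v) (t : ℝ) :
    HasDerivAt (fun t => (x t, v t)) (v t, deriv u (x t) / 2) t :=
  (h.hasDerivAt_pos t).prodMk (h.hasDerivAt_vel t)

theorem eq_of_init_eq (hu : C2Bound u K) (h₀ : NewtonSolution u x₀ v₀)
    (h₁ : NewtonSolution u x₁ v₁) {t₀ : ℝ} (hx : x₀ t₀ = x₁ t₀) (hv : v₀ t₀ = v₁ t₀) : x₀ = x₁ := by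
  have := ODE_solution_unique_univ (s := fun _ => univ) (t₀ := t₀)
    (fun _ => (lipschitzWith_field hu).lipschitzOnWith)
    (fun t => ⟨h₀.hasDerivAt_prod t, mem_univ _⟩) (fun t => ⟨h₁.hasDerivAt_prod t, mem_univ _⟩)
    (by simp [hx, hv])
  exact funext fun t => congrArg Prod.fst (congrFun this t)

theorem dist_le (hu : C2Bound u K) (h₀ : NewtonSolution u x₀ v₀) (h₁ : NewtonSolution u x₁ v₁)
    {t : ℝ} (ht : 0 ≤ t) :
    dist (x₁ t, v₁ t) (x₀ t, v₀ t) ≤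
      dist (x₁ 0, v₁ 0) (x₀ 0, v₀ 0) * Real.exp (max 1 K * t) := by
  have := dist_le_of_trajectories_ODE (a := 0) (b := t) (fun _ => lipschitzWith_field hu)
    (fun t _ => (h₁.hasDerivAt_prod t).continuousAt.continuousWithinAt)
    (fun t _ => (h₁.hasDerivAt_prod t).hasDerivWithinAt)
    (fun t _ => (h₀.hasDerivAt_prod t).continuousAt.continuousWithinAt)
    (fun t _ => (h₀.hasDerivAt_prod t).hasDerivWithinAt) le_rfl t ⟨ht, le_rfl⟩
  simpa [Real.coe_toNNReal _ hu.nonneg] using this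

theorem abs_vel_le (h : NewtonSolution u x v) (hu : C2Bound u K) {s : ℝ} (hs : v s = 0) (t : ℝ) :
    |v t| ≤ K * |t - s| := by
  have := abs_sub_le_of_abs_hasDerivAt_le h.hasDerivAt_vel (C := K) (fun z => by
    rw [abs_div, abs_two]
    linarith [hu.abs_deriv_le (x z), abs_nonneg (deriv u (x z))]) s t
  rwa [hs, sub_zero] at this

/- By uniqueness, a solution at rest at time `t₀` is symmetric about `t₀`. -/
theorem drift_eq_zero (h : NewtonSolution u x v) (hu : C2Bound u K) {Q m : ℝ}
    (hm : ∀ t, x (t + Q) = x t + m) {t₀ : ℝ} (h0 : v t₀ = 0) : m = 0 := by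
  have hsymm := congrFun (eq_of_init_eq hu h (h.comp_const_sub (2 * t₀)) (t₀ := t₀)
    (by ring_nf) (by rw [show 2 * t₀ - t₀ = t₀ by ring, h0, neg_zero])) (t₀ + Q)
  have hleft := hm (t₀ - Q)
  have hright := hm t₀
  rw [show 2 * t₀ - (t₀ + Q) = t₀ - Q by ring] at hsymm
  rw [sub_add_cancel] at hleft
  linarith

theorem level_lt_of_drift (h : NewtonSolution u x v) (hu : C2Bound u K) {Q c m : ℝ}
    (hm : ∀ t, x (t + Q) = x t + m) (hm0 : m ≠ 0) (hc : ∀ t, v t ^ 2 = u (x t) - c) (ξ : ℝ) :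
    c < u ξ := by
  obtain ⟨t, rfl⟩ := surjective_of_continuous_of_map_add_eq_add h.continuous_pos hm0 hm ξ
  have hv : v t ≠ 0 := fun h0 => hm0 (h.drift_eq_zero hu hm h0)
  linarith [hc t, sq_pos_of_ne_zero hv]

end NewtonSolution

/-! ### Rotations and librations -/

/-- `∫₀¹ √h`. For `h = u - c` this is the action `∫ v²` of one turn of a rotating solution of the
Newton equation with potential `u` on the level `v² = u - c`. -/
def sqrtMean (h : ℝ → ℝ) : ℝ := ∫ x in (0 : ℝ)..1, √(h x)

/-- `∫₀¹ 1 / √h`. For `h = u - c` this is the duration of one turn of a rotating solution of the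
Newton equation with potential `u` on the level `v² = u - c`. -/
def invSqrtMean (h : ℝ → ℝ) : ℝ := ∫ x in (0 : ℝ)..1, (√(h x))⁻¹

theorem continuous_inv_sqrt {h : ℝ → ℝ} (hc : Continuous h) (hpos : ∀ x, 0 < h x) :
    Continuous fun x => (√(h x))⁻¹ :=
  hc.sqrt.inv₀ fun x => (Real.sqrt_pos.2 (hpos x)).ne'

theorem invSqrtMean_pos {h : ℝ → ℝ} (hc : Continuous h) (hpos : ∀ x, 0 < h x) :
    0 < invSqrtMean h :=
  intervalIntegral.intervalIntegral_pos_of_pos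
    ((continuous_inv_sqrt hc hpos).intervalIntegrable _ _)
    (fun ξ => inv_pos.2 (Real.sqrt_pos.2 (hpos ξ))) one_pos

theorem sqrtMean_nonneg (h : ℝ → ℝ) : 0 ≤ sqrtMean h :=
  intervalIntegral.integral_nonneg zero_le_one fun _ _ => Real.sqrt_nonneg _

theorem integral_add_int_of_periodic {f : ℝ → ℝ} (hf : Continuous f)
    (hp : Function.Periodic f 1) (a : ℝ) (m : ℤ) :
    ∫ x in a..(a + m), f x = m * ∫ x in (0 : ℝ)..1, f x := by
  have hm := hp.intervalIntegral_add_zsmul_eq m a fun t s => hf.intervalIntegrable t s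
  simp only [zsmul_eq_mul, mul_one] at hm
  rw [hm, hp.intervalIntegral_add_eq a 0, zero_add]

namespace NewtonSolution

variable {u x v : ℝ → ℝ} {Q c : ℝ} {m : ℤ}

theorem integral_comp_mul_vel (h : NewtonSolution u x v) {g : ℝ → ℝ} (hg : Continuous g)
    (hp : Function.Periodic g 1) (hm : x Q = x 0 + m) :
    ∫ t in (0 : ℝ)..Q, g (x t) * v t = m * ∫ ξ in (0 : ℝ)..1, g ξ := by
  rw [← integral_add_int_of_periodic hg hp (x 0) m, ← hm]
  exact intervalIntegral.integral_comp_mul_deriv (fun t _ => h.hasDerivAt_pos t)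
    h.continuous_vel.continuousOn hg

theorem exists_sign_vel_eq_mul_sqrt (h : NewtonSolution u x v) (hu : Continuous u)
    (hc : ∀ t, v t ^ 2 = u (x t) - c) (hlt : ∀ ξ, c < u ξ) :
    ∃ σ : ℝ, |σ| = 1 ∧ ∀ t, v t = σ * √(u (x t) - c) := by
  have hsq : EqOn (v ^ 2) ((fun t => √(u (x t) - c)) ^ 2) univ := fun t _ => by
    simp only [Pi.pow_apply]
    rw [hc, Real.sq_sqrt (sub_pos.2 (hlt _)).le]
  rcases isPreconnected_univ.eq_or_eq_neg_of_sq_eq h.continuous_vel.continuousOn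
    ((hu.comp h.continuous_pos).sub continuous_const).sqrt.continuousOn hsq
    (fun {t} _ => (Real.sqrt_pos.2 (sub_pos.2 (hlt (x t)))).ne') with hv | hv
  · exact ⟨1, abs_one, fun t => by simpa using hv (mem_univ t)⟩
  · exact ⟨-1, by simp, fun t => by simpa using hv (mem_univ t)⟩

theorem rotation_period (h : NewtonSolution u x v) (hu : Continuous u)
    (hp : Function.Periodic u 1) (hQ : 0 < Q) (hm : x Q = x 0 + m)
    (hc : ∀ t, v t ^ 2 = u (x t) - c) (hlt : ∀ ξ, c < u ξ) :
    Q = |(m : ℝ)| * invSqrtMean fun ξ => u ξ - c := by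
  obtain ⟨σ, hσ, hv⟩ := h.exists_sign_vel_eq_mul_sqrt hu hc hlt
  have hpos (ξ : ℝ) : 0 < u ξ - c := sub_pos.2 (hlt ξ)
  have hcont : Continuous fun ξ => u ξ - c := hu.sub continuous_const
  have hσQ : σ * Q = m * invSqrtMean fun ξ => u ξ - c := by
    rw [invSqrtMean, ← h.integral_comp_mul_vel (continuous_inv_sqrt hcont hpos)
      (fun ξ => by simp only [hp ξ]) hm]
    have hconst (t : ℝ) : (√(u (x t) - c))⁻¹ * v t = σ := by
      rw [hv, mul_left_comm, inv_mul_cancel₀ (Real.sqrt_pos.2 (hpos _)).ne', mul_one]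
    simp [hconst, mul_comm]
  have := congrArg abs hσQ
  rwa [abs_mul, abs_mul, hσ, one_mul, abs_of_pos hQ,
    abs_of_pos (invSqrtMean_pos hcont hpos)] at this

theorem rotation_action (h : NewtonSolution u x v) (hu : Continuous u)
    (hp : Function.Periodic u 1) (hQ : 0 ≤ Q) (hm : x Q = x 0 + m)
    (hc : ∀ t, v t ^ 2 = u (x t) - c) (hlt : ∀ ξ, c < u ξ) :
    ∫ t in (0 : ℝ)..Q, v t ^ 2 = |(m : ℝ)| * sqrtMean fun ξ => u ξ - c := by
  obtain ⟨σ, hσ, hv⟩ := h.exists_sign_vel_eq_mul_sqrt hu hc hlt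
  have hσS : σ * ∫ t in (0 : ℝ)..Q, v t ^ 2 = m * sqrtMean fun ξ => u ξ - c := by
    rw [sqrtMean, ← h.integral_comp_mul_vel (g := fun ξ => √(u ξ - c))
      (hu.sub continuous_const).sqrt (fun ξ => by simp only [hp ξ]) hm,
      ← intervalIntegral.integral_const_mul]
    congr with t
    have hσ2 : σ ^ 2 = 1 := by rw [← sq_abs, hσ, one_pow]
    rw [hv t]
    linear_combination σ * √(u (x t) - c) ^ 2 * hσ2
  have := congrArg abs hσS
  rwa [abs_mul, abs_mul, hσ, one_mul, abs_of_nonneg (sqrtMean_nonneg _), abs_of_nonneg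
    (intervalIntegral.integral_nonneg hQ fun t _ => sq_nonneg (v t))] at this

end NewtonSolution

/-- The solution `(x, v)` of the Newton equation with potential `u` is at rest at the times `0` and
`Q`: it oscillates between its turning points, on the level `v² = u - u (x 0)`. -/
structure IsLibration (u x v : ℝ → ℝ) (Q : ℝ) : Prop extends NewtonSolution u x v where
  pos : 0 < Q
  vel_zero : v 0 = 0
  vel_end : v Q = 0

/- A periodic solution comes to rest, by Rolle's theorem. -/
theorem NewtonSolution.exists_isLibration {u x v : ℝ → ℝ} {Q : ℝ} (h : NewtonSolution u x v)
    (hp : Function.Periodic u 1) (hQ : 0 < Q) (hx : Function.Periodic x Q) :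
    ∃ x' v' t₀, IsLibration u x' v' Q ∧ x' 0 ∈ Icc (0 : ℝ) 1 ∧ v t₀ = 0 ∧ u (x' 0) = u (x t₀) ∧
      ∫ t in (0 : ℝ)..Q, v' t ^ 2 = ∫ t in (0 : ℝ)..Q, v t ^ 2 := by
  obtain ⟨t₀, -, ht₀⟩ := exists_hasDerivAt_eq_zero hQ h.continuous_pos.continuousOn
    (by simpa using (hx 0).symm) (fun t _ => h.hasDerivAt_pos t)
  have hv := h.vel_periodic hx
  refine ⟨fun t => x (t + t₀) + (-⌊x t₀⌋ : ℤ), fun t => v (t + t₀), t₀,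
    ⟨(h.comp_add_const t₀).add_int hp _, hQ, by simpa using ht₀, ?_⟩, ?_, ht₀, ?_, ?_⟩
  · rw [add_comm Q, hv, ht₀]
  · simpa [← sub_eq_add_neg] using (Int.fract_lt_one (x t₀)).le
  · simpa using hp.int_mul (-⌊x t₀⌋) (x t₀)
  · rw [intervalIntegral.integral_comp_add_right (fun t => v t ^ 2), zero_add, add_comm Q]
    have := (hv.comp (· ^ 2)).intervalIntegral_add_eq t₀ 0
    simpa using this

/-- The actions of the orbits of the separated system with potentials `u` and `w` whose first
coordinate librates from rest to rest on the level `u (x 0)`, while the second one makes `N` turns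
in the same time. The starting point is normalized to lie in `[0, 1]`. -/
def librationActions (u w : ℝ → ℝ) (N : ℝ) : Set ℝ :=
  {ℓ | ∃ x v Q, IsLibration u x v Q ∧ x 0 ∈ Icc (0 : ℝ) 1 ∧
    Q = N * invSqrtMean (fun ξ => w ξ + u (x 0)) ∧
    ℓ = (∫ t in (0 : ℝ)..Q, v t ^ 2) + N * sqrtMean (fun ξ => w ξ + u (x 0))}

/-! ### Closed orbits of separated systems -/

/-- The actions `∫ (x'² + y'²)` of the closed orbits in the class `(m, n)` of the separated system
`x'' = u'(x) / 2`, `y'' = w'(y) / 2` on the energy level `x'² + y'² = u(x) + w(y)`. -/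
def separatedSpectrum (u w : ℝ → ℝ) (m n : ℤ) : Set ℝ :=
  {ℓ | ∃ (x v y z : ℝ → ℝ) (Q : ℝ), 0 < Q ∧ NewtonSolution u x v ∧ NewtonSolution w y z ∧
    (∀ t, v t ^ 2 + z t ^ 2 = u (x t) + w (y t)) ∧ (∀ t, x (t + Q) = x t + m) ∧
    (∀ t, y (t + Q) = y t + n) ∧ ℓ = ∫ t in (0 : ℝ)..Q, (v t ^ 2 + z t ^ 2)}

section SeparatedSpectrum

variable {u w : ℝ → ℝ} {m n : ℤ} {ℓ : ℝ}

theorem separatedSpectrum_swap (h : ℓ ∈ separatedSpectrum u w m n) :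
    ℓ ∈ separatedSpectrum w u n m := by
  obtain ⟨x, v, y, z, Q, hQ, hx, hy, hE, hm, hn, rfl⟩ := h
  exact ⟨y, z, x, v, Q, hQ, hy, hx, fun t => by linarith [hE t], hn, hm, by simp only [add_comm]⟩

/- `c` is the energy level of the first factor; both factors rotate. -/
theorem exists_level_of_mem_separatedSpectrum (hu : ContDiff ℝ 2 u) (hw : ContDiff ℝ 2 w)
    (pu : Function.Periodic u 1) (pw : Function.Periodic w 1) (hm : m ≠ 0) (hn : n ≠ 0)
    (h : ℓ ∈ separatedSpectrum u w m n) :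
    ∃ c, (∀ ξ, c < u ξ) ∧ (∀ ξ, 0 < w ξ + c) ∧
      |(m : ℝ)| * invSqrtMean (fun ξ => u ξ - c) = |(n : ℝ)| * invSqrtMean (fun ξ => w ξ + c) ∧
      ℓ = |(m : ℝ)| * sqrtMean (fun ξ => u ξ - c) + |(n : ℝ)| * sqrtMean (fun ξ => w ξ + c) := by
  obtain ⟨x, v, y, z, Q, hQ, hx, hy, hE, hxQ, hyQ, rfl⟩ := h
  obtain ⟨K, -, bu⟩ := exists_c2Bound hu pu
  obtain ⟨K', -, bw⟩ := exists_c2Bound hw pw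
  obtain ⟨c, hc⟩ : ∃ c, c = u (x 0) - v 0 ^ 2 := ⟨_, rfl⟩
  have hv (t : ℝ) : v t ^ 2 = u (x t) - c := by
    linarith [hx.sq_vel_sub_eq (hu.differentiable two_ne_zero) t 0]
  have hz (t : ℝ) : z t ^ 2 = w (y t) - -c := by linarith [hE t, hv t]
  have hcu := hx.level_lt_of_drift bu hxQ (Int.cast_ne_zero.2 hm) hv
  have hcw := hy.level_lt_of_drift bw hyQ (Int.cast_ne_zero.2 hn) hz
  have hx₀ : x Q = x 0 + m := by simpa using hxQ 0
  have hy₀ : y Q = y 0 + n := by simpa using hyQ 0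
  have hBy := hy.rotation_period bw.continuous pw hQ hy₀ hz hcw
  have hAy := hy.rotation_action bw.continuous pw hQ.le hy₀ hz hcw
  simp only [sub_neg_eq_add] at hBy hAy
  refine ⟨c, hcu, fun ξ => by linarith [hcw ξ],
    by rw [← hx.rotation_period bu.continuous pu hQ hx₀ hv hcu, ← hBy], ?_⟩
  rw [← hx.rotation_action bu.continuous pu hQ.le hx₀ hv hcu, ← hAy]
  exact intervalIntegral.integral_add ((hx.continuous_vel.pow 2).intervalIntegrable _ _)
    ((hy.continuous_vel.pow 2).intervalIntegrable _ _)

theorem mem_librationActions_of_mem_separatedSpectrum (hu : ContDiff ℝ 2 u) (hw : Continuous w)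
    (pu : Function.Periodic u 1) (pw : Function.Periodic w 1) (hpos : ∀ ξ η, 0 < u ξ + w η)
    (h : ℓ ∈ separatedSpectrum u w 0 n) : ℓ ∈ librationActions u w |(n : ℝ)| := by
  obtain ⟨x, v, y, z, Q, hQ, hx, hy, hE, hxQ, hyQ, rfl⟩ := h
  obtain ⟨x', v', t₀, hlib, hmem, ht₀, hu₀, haction⟩ :=
    hx.exists_isLibration pu hQ fun t => by simpa using hxQ t
  have hv := hx.sq_vel_eq_of_vel_eq_zero (hu.differentiable two_ne_zero) ht₀
  have hz (t : ℝ) : z t ^ 2 = w (y t) - -u (x' 0) := by linarith [hE t, hv t]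
  have hlt (ξ : ℝ) : -u (x' 0) < w ξ := by linarith [hpos (x' 0) ξ]
  have hy₀ : y Q = y 0 + n := by simpa using hyQ 0
  have hB := hy.rotation_period hw pw hQ hy₀ hz hlt
  have hA := hy.rotation_action hw pw hQ.le hy₀ hz hlt
  simp only [sub_neg_eq_add] at hB hA
  refine ⟨x', v', Q, hlib, hmem, hB, ?_⟩
  rw [haction, ← hA]
  exact intervalIntegral.integral_add ((hx.continuous_vel.pow 2).intervalIntegrable _ _)
    ((hy.continuous_vel.pow 2).intervalIntegrable _ _)

end SeparatedSpectrum

/-! ### Concavity of the action -/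

theorem sqrt_sub_sqrt_le {a b : ℝ} (ha : 0 < a) (hb : 0 ≤ b) :
    √b - √a ≤ (b - a) * (√a)⁻¹ / 2 := by
  have : 0 < √a := Real.sqrt_pos.2 ha
  rw [← div_eq_mul_inv, div_div, le_div_iff₀ (by positivity)]
  nlinarith [sq_nonneg (√b - √a), Real.sq_sqrt ha.le, Real.sq_sqrt hb]

section

variable {h h₀ h₁ : ℝ → ℝ}

theorem sqrtMean_sub_le (c₀ : Continuous h₀) (c₁ : Continuous h₁) (p₀ : ∀ x, 0 < h₀ x)
    (p₁ : ∀ x, 0 ≤ h₁ x) :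
    sqrtMean h₁ - sqrtMean h₀ ≤ (∫ x in (0 : ℝ)..1, (h₁ x - h₀ x) * (√(h₀ x))⁻¹) / 2 := by
  rw [sqrtMean, sqrtMean, ← intervalIntegral.integral_sub (c₁.sqrt.intervalIntegrable _ _)
    (c₀.sqrt.intervalIntegrable _ _), ← intervalIntegral.integral_div]
  exact intervalIntegral.integral_mono zero_le_one
    ((c₁.sqrt.sub c₀.sqrt).intervalIntegrable _ _)
    ((((c₁.sub c₀).mul (continuous_inv_sqrt c₀ p₀)).div_const 2).intervalIntegrable _ _)
    fun x => sqrt_sub_sqrt_le (p₀ x) (p₁ x)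

theorem sqrtMean_add_sub_le (hc : Continuous h) {c c' : ℝ} (p₀ : ∀ x, 0 < h x + c)
    (p₁ : ∀ x, 0 ≤ h x + c') :
    sqrtMean (fun x => h x + c') - sqrtMean (fun x => h x + c) ≤
      (c' - c) * invSqrtMean (fun x => h x + c) / 2 := by
  rw [invSqrtMean, ← intervalIntegral.integral_const_mul]
  simpa only [add_sub_add_left_eq_sub] using
    sqrtMean_sub_le (h₀ := fun x => h x + c) (h₁ := fun x => h x + c') (hc.add continuous_const)
      (hc.add continuous_const) p₀ p₁

theorem invSqrtMean_le (c₀ : Continuous h₀) (c₁ : Continuous h₁) (p₀ : ∀ x, 0 < h₀ x)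
    (hle : ∀ x, h₀ x ≤ h₁ x) : invSqrtMean h₁ ≤ invSqrtMean h₀ :=
  intervalIntegral.integral_mono zero_le_one
    ((continuous_inv_sqrt c₁ fun x => (p₀ x).trans_le (hle x)).intervalIntegrable _ _)
    ((continuous_inv_sqrt c₀ p₀).intervalIntegrable _ _)
    fun x => inv_anti₀ (Real.sqrt_pos.2 (p₀ x)) (Real.sqrt_le_sqrt (hle x))

theorem invSqrtMean_lt (c₀ : Continuous h₀) (c₁ : Continuous h₁) (p₀ : ∀ x, 0 < h₀ x)
    (hlt : ∀ x, h₀ x < h₁ x) : invSqrtMean h₁ < invSqrtMean h₀ :=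
  intervalIntegral.integral_lt_integral_of_continuousOn_of_le_of_exists_lt one_pos
    (continuous_inv_sqrt c₁ fun x => (p₀ x).trans (hlt x)).continuousOn
    (continuous_inv_sqrt c₀ p₀).continuousOn
    (fun x _ => inv_anti₀ (Real.sqrt_pos.2 (p₀ x)) (Real.sqrt_le_sqrt (hlt x).le))
    ⟨0, left_mem_Icc.2 zero_le_one, inv_strictAnti₀ (Real.sqrt_pos.2 (p₀ 0))
      (Real.sqrt_lt_sqrt (p₀ 0).le (hlt 0))⟩

end

section

variable {u w : ℝ → ℝ}

/- The critical level `c` maximizes a concave function of the level. -/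
theorem le_of_critical_level (hu : Continuous u) (hw : Continuous w) {M N c c' : ℝ} (hM : 0 ≤ M)
    (hN : 0 ≤ N) (hcu : ∀ ξ, c < u ξ) (hcw : ∀ ξ, 0 < w ξ + c)
    (hcrit : M * invSqrtMean (fun ξ => u ξ - c) = N * invSqrtMean (fun ξ => w ξ + c))
    (hcu' : ∀ ξ, c' ≤ u ξ) (hcw' : ∀ ξ, 0 ≤ w ξ + c') :
    M * sqrtMean (fun ξ => u ξ - c') + N * sqrtMean (fun ξ => w ξ + c') ≤
      M * sqrtMean (fun ξ => u ξ - c) + N * sqrtMean (fun ξ => w ξ + c) := by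
  have hle_u := sqrtMean_add_sub_le hu (c := -c) (c' := -c') (fun x => by linarith [hcu x])
    (fun x => by linarith [hcu' x])
  have hle_w := sqrtMean_add_sub_le hw hcw hcw'
  simp only [← sub_eq_add_neg] at hle_u
  linear_combination M * hle_u + N * hle_w + (c - c') / 2 * hcrit

theorem separatedSpectrum_subsingleton (hu : ContDiff ℝ 2 u) (hw : ContDiff ℝ 2 w)
    (pu : Function.Periodic u 1) (pw : Function.Periodic w 1) {m n : ℤ} (hm : m ≠ 0)
    (hn : n ≠ 0) : (separatedSpectrum u w m n).Subsingleton := by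
  suffices hle : ∀ ℓ ∈ separatedSpectrum u w m n, ∀ ℓ' ∈ separatedSpectrum u w m n, ℓ ≤ ℓ' from
    fun ℓ hℓ ℓ' hℓ' => le_antisymm (hle _ hℓ _ hℓ') (hle _ hℓ' _ hℓ)
  intro ℓ hℓ ℓ' hℓ'
  obtain ⟨c, hcu, hcw, -, rfl⟩ := exists_level_of_mem_separatedSpectrum hu hw pu pw hm hn hℓ
  obtain ⟨c', hcu', hcw', hcrit, rfl⟩ :=
    exists_level_of_mem_separatedSpectrum hu hw pu pw hm hn hℓ'
  exact le_of_critical_level hu.continuous hw.continuous (abs_nonneg _) (abs_nonneg _) hcu' hcw'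
    hcrit (fun ξ => (hcu ξ).le) fun ξ => (hcw ξ).le

end

/-! ### Dilations of a potential about a weighted mean -/

/-- The family `w + s (w - μ)`. -/
def dilate (w : ℝ → ℝ) (μ s : ℝ) : ℝ → ℝ := fun ξ => w ξ + s * (w ξ - μ)

/-- The level of `w` that corresponds to the level `c` of `dilate w μ s`: see `dilate_add`. -/
def dilateLevel (μ s c : ℝ) : ℝ := (c - s * μ) / (1 + s)

/-- `∫₀¹ (w - μ) / √(w + e)`, which is twice the derivative at `s = 0` of the action of
`dilate w μ s` on the level `e`. -/
def dilateSlope (w : ℝ → ℝ) (μ e : ℝ) : ℝ := ∫ ξ in (0 : ℝ)..1, (w ξ - μ) * (√(w ξ + e))⁻¹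

/-- The mean of `w` for the weight `1 / √(w + e₀)`. Dilating about it does not change the action
of the level `e₀` to first order. -/
def weightedMean (w : ℝ → ℝ) (e₀ : ℝ) : ℝ :=
  (∫ ξ in (0 : ℝ)..1, w ξ * (√(w ξ + e₀))⁻¹) / invSqrtMean fun ξ => w ξ + e₀

section WeightedMean

variable {w : ℝ → ℝ} {μ e e' e₀ : ℝ}

theorem integral_add_mul_inv_sqrt (hw : Continuous w) (he₀ : ∀ ξ, 0 < w ξ + e₀) (e : ℝ) :
    ∫ ξ in (0 : ℝ)..1, (w ξ + e) * (√(w ξ + e₀))⁻¹ =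
      (weightedMean w e₀ + e) * invSqrtMean fun ξ => w ξ + e₀ := by
  have hwe : Continuous fun ξ => w ξ + e₀ := hw.add continuous_const
  have hcont := continuous_inv_sqrt hwe he₀
  simp only [add_mul]
  rw [intervalIntegral.integral_add (f := fun ξ => w ξ * (√(w ξ + e₀))⁻¹)
      (g := fun ξ => e * (√(w ξ + e₀))⁻¹) ((hw.mul hcont).intervalIntegrable _ _)
      ((continuous_const.mul hcont).intervalIntegrable _ _), intervalIntegral.integral_const_mul,
    weightedMean, div_mul_cancel₀ _ (invSqrtMean_pos hwe he₀).ne', invSqrtMean]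

theorem weightedMean_add_pos (hw : Continuous w) (he₀ : ∀ ξ, 0 < w ξ + e₀)
    (he : ∀ ξ, 0 < w ξ + e) : 0 < weightedMean w e₀ + e := by
  have hwe : Continuous fun ξ => w ξ + e₀ := hw.add continuous_const
  have hint : 0 < ∫ ξ in (0 : ℝ)..1, (w ξ + e) * (√(w ξ + e₀))⁻¹ :=
    intervalIntegral.intervalIntegral_pos_of_pos
      (((hw.add continuous_const).mul (continuous_inv_sqrt hwe he₀)).intervalIntegrable _ _)
      (fun ξ => mul_pos (he ξ) (inv_pos.2 (Real.sqrt_pos.2 (he₀ ξ)))) one_pos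
  rw [integral_add_mul_inv_sqrt hw he₀] at hint
  exact (pos_iff_pos_of_mul_pos hint).2 (invSqrtMean_pos hwe he₀)

theorem dilateSlope_weightedMean (hw : Continuous w) (he₀ : ∀ ξ, 0 < w ξ + e₀) :
    dilateSlope w (weightedMean w e₀) e₀ = 0 := by
  simpa [dilateSlope, sub_eq_add_neg] using
    integral_add_mul_inv_sqrt hw he₀ (-weightedMean w e₀)

theorem sub_mul_sqrt_div_lt {a b : ℝ} (hab : a ≠ b) (ha : 0 < a + e) (hb : 0 < b + e)
    (hee : e < e') : (a - b) * √((b + e) / (a + e)) < (a - b) * √((b + e') / (a + e')) := by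
  have ha' : 0 < a + e' := by linarith
  have hb' : 0 < b + e' := by linarith
  rcases hab.lt_or_gt with h | h
  · refine mul_lt_mul_of_neg_left (Real.sqrt_lt_sqrt (by positivity) ?_) (sub_neg.2 h)
    rw [div_lt_div_iff₀ ha' ha]
    nlinarith
  · refine mul_lt_mul_of_pos_left (Real.sqrt_lt_sqrt (by positivity) ?_) (sub_pos.2 h)
    rw [div_lt_div_iff₀ ha ha']
    nlinarith

theorem sqrt_mul_dilateSlope_eq (hμ : 0 ≤ μ + e) :
    √(μ + e) * dilateSlope w μ e = ∫ ξ in (0 : ℝ)..1, (w ξ - μ) * √((μ + e) / (w ξ + e)) := by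
  rw [dilateSlope, ← intervalIntegral.integral_const_mul]
  refine intervalIntegral.integral_congr fun ξ _ => ?_
  rw [Real.sqrt_div hμ]
  ring

theorem exists_mem_Icc_apply_ne (pw : Function.Periodic w 1) (hnc : ∃ ξ η, w ξ ≠ w η) (μ : ℝ) :
    ∃ ξ ∈ Icc (0 : ℝ) 1, w ξ ≠ μ := by
  by_contra! hconst
  have hall (ξ : ℝ) : w ξ = μ := by
    obtain ⟨y, hy, h⟩ := pw.exists_mem_Ico₀ one_pos ξ
    exact h.trans (hconst y (Ico_subset_Icc_self hy))
  obtain ⟨ξ, η, h⟩ := hnc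
  exact h ((hall ξ).trans (hall η).symm)

/- After multiplication by `√(μ + e)` the integrand is `(w - μ) √((μ + e) / (w + e))`, which is
pointwise increasing in `e`. -/
theorem sqrt_mul_dilateSlope_lt (hw : Continuous w) (pw : Function.Periodic w 1)
    (hnc : ∃ ξ η, w ξ ≠ w η) (hμ : 0 < μ + e) (he : ∀ ξ, 0 < w ξ + e) (hee : e < e') :
    √(μ + e) * dilateSlope w μ e < √(μ + e') * dilateSlope w μ e' := by
  obtain ⟨ξ₀, hξ₀, hne⟩ := exists_mem_Icc_apply_ne pw hnc μ
  have hcont {f : ℝ} (hf : ∀ ξ, 0 < w ξ + f) :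
      Continuous fun ξ => (w ξ - μ) * √((μ + f) / (w ξ + f)) :=
    (hw.sub continuous_const).mul
      (continuous_const.div (hw.add continuous_const) fun ξ => (hf ξ).ne').sqrt
  rw [sqrt_mul_dilateSlope_eq hμ.le, sqrt_mul_dilateSlope_eq (by linarith)]
  refine intervalIntegral.integral_lt_integral_of_continuousOn_of_le_of_exists_lt one_pos
    (hcont he).continuousOn (hcont fun ξ => by linarith [he ξ]).continuousOn (fun ξ _ => ?_)
    ⟨ξ₀, hξ₀, sub_mul_sqrt_div_lt hne (he ξ₀) hμ hee⟩
  rcases eq_or_ne (w ξ) μ with h | h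
  · simp [h]
  · exact (sub_mul_sqrt_div_lt h (he ξ) hμ hee).le

theorem dilateSlope_weightedMean_nonpos (hw : Continuous w) (pw : Function.Periodic w 1)
    (hnc : ∃ ξ η, w ξ ≠ w η) (he : ∀ ξ, 0 < w ξ + e) (hee : e ≤ e₀) :
    dilateSlope w (weightedMean w e₀) e ≤ 0 := by
  have he₀ (ξ : ℝ) : 0 < w ξ + e₀ := by linarith [he ξ]
  rcases hee.eq_or_lt with rfl | hlt
  · exact (dilateSlope_weightedMean hw he₀).le
  have hμ := weightedMean_add_pos hw he₀ he
  have hslope := sqrt_mul_dilateSlope_lt hw pw hnc hμ he hlt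
  rw [dilateSlope_weightedMean hw he₀, mul_zero] at hslope
  exact (neg_of_mul_neg_right hslope (Real.sqrt_nonneg _)).le

theorem exists_pos_le_dilateSlope_weightedMean (hw : Continuous w) (pw : Function.Periodic w 1)
    (hnc : ∃ ξ η, w ξ ≠ w η) (he₀ : ∀ ξ, 0 < w ξ + e₀) {e₁ : ℝ} (he₁ : e₀ < e₁) (M : ℝ) :
    ∃ κ > 0, ∀ e ∈ Icc e₁ M, κ ≤ dilateSlope w (weightedMean w e₀) e := by
  obtain ⟨μ, hμ⟩ : ∃ μ, μ = weightedMean w e₀ := ⟨_, rfl⟩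
  have hadd {e : ℝ} (he : e₀ ≤ e) : 0 < μ + e :=
    hμ ▸ weightedMean_add_pos hw he₀ fun ξ => by linarith [he₀ ξ]
  have hslope {e e' : ℝ} (he : e₀ ≤ e) (hee : e < e') :
      √(μ + e) * dilateSlope w μ e < √(μ + e') * dilateSlope w μ e' :=
    sqrt_mul_dilateSlope_lt hw pw hnc (hadd he) (fun ξ => by linarith [he₀ ξ]) hee
  have hpos : 0 < √(μ + e₁) * dilateSlope w μ e₁ := by
    simpa [hμ, dilateSlope_weightedMean hw he₀] using hslope le_rfl he₁
  have hM : 0 < √(μ + max e₁ M) := Real.sqrt_pos.2 (hadd (he₁.le.trans (le_max_left _ _)))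
  refine ⟨√(μ + e₁) * dilateSlope w μ e₁ / √(μ + max e₁ M), by positivity, fun e he => ?_⟩
  rw [← hμ, div_le_iff₀ hM, mul_comm (dilateSlope w μ e)]
  have hle : √(μ + e₁) * dilateSlope w μ e₁ ≤ √(μ + e) * dilateSlope w μ e := by
    rcases he.1.eq_or_lt with rfl | hlt
    · exact le_rfl
    · exact (hslope he₁.le hlt).le
  refine hle.trans (mul_le_mul_of_nonneg_right ?_ ?_)
  · exact Real.sqrt_le_sqrt (add_le_add_right (he.2.trans (le_max_right _ _)) μ)
  · exact (pos_of_mul_pos_right (hpos.trans_le hle) (Real.sqrt_nonneg _)).le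

end WeightedMean

section Dilate

variable {w : ℝ → ℝ} {μ s s' c c' : ℝ}

theorem dilate_zero (w : ℝ → ℝ) (μ : ℝ) : dilate w μ 0 = w := by
  funext ξ
  simp [dilate]

theorem continuous_dilate (hw : Continuous w) : Continuous (dilate w μ s) :=
  hw.add (continuous_const.mul (hw.sub continuous_const))

theorem contDiff_dilate {n : WithTop ℕ∞} (hw : ContDiff ℝ n w) : ContDiff ℝ n (dilate w μ s) :=
  hw.add (contDiff_const.mul (hw.sub contDiff_const))

theorem periodic_dilate {p : ℝ} (pw : Function.Periodic w p) :
    Function.Periodic (dilate w μ s) p := fun ξ => by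
  simp only [dilate, pw ξ]

theorem add_dilateLevel (hs : 0 ≤ s) (a : ℝ) :
    a + c + s * (a - μ) = (1 + s) * (a + dilateLevel μ s c) := by
  have : 1 + s ≠ 0 := by positivity
  rw [dilateLevel]
  field_simp
  ring

theorem dilate_add (hs : 0 ≤ s) (ξ : ℝ) :
    dilate w μ s ξ + c = (1 + s) * (w ξ + dilateLevel μ s c) := by
  rw [← add_dilateLevel hs, dilate, add_right_comm]

theorem dilate_add_pos_iff (hs : 0 ≤ s) (ξ : ℝ) :
    0 < dilate w μ s ξ + c ↔ 0 < w ξ + dilateLevel μ s c := by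
  rw [dilate_add hs, mul_pos_iff_of_pos_left (by positivity)]

theorem dilateLevel_le_dilateLevel (hs : 0 ≤ s) (hc : c ≤ c') :
    dilateLevel μ s c ≤ dilateLevel μ s c' :=
  div_le_div_of_nonneg_right (sub_le_sub_right hc _) (by positivity)

theorem tendsto_dilateLevel (μ c : ℝ) : Tendsto (fun s => dilateLevel μ s c) (𝓝 0) (𝓝 c) := by
  have : ContinuousAt (fun s => dilateLevel μ s c) 0 :=
    ContinuousAt.div (by fun_prop) (by fun_prop) (by norm_num)
  simpa [ContinuousAt, dilateLevel] using this

theorem invSqrtMean_dilate_add (hs : 0 ≤ s) :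
    invSqrtMean (fun ξ => dilate w μ s ξ + c) =
      (√(1 + s))⁻¹ * invSqrtMean fun ξ => w ξ + dilateLevel μ s c := by
  rw [invSqrtMean, invSqrtMean, ← intervalIntegral.integral_const_mul]
  simp only [dilate_add hs, Real.sqrt_mul (by positivity : 0 ≤ 1 + s), mul_inv]

theorem sqrtMean_dilate_sub_le (hw : Continuous w) (hs : 0 ≤ s)
    (h : ∀ ξ, 0 < dilate w μ s ξ + c) (h' : ∀ ξ, 0 ≤ dilate w μ s' ξ + c) :
    sqrtMean (fun ξ => dilate w μ s' ξ + c) - sqrtMean (fun ξ => dilate w μ s ξ + c) ≤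
      (s' - s) / 2 * ((√(1 + s))⁻¹ * dilateSlope w μ (dilateLevel μ s c)) := by
  refine (sqrtMean_sub_le (h₀ := fun ξ => dilate w μ s ξ + c)
    (h₁ := fun ξ => dilate w μ s' ξ + c) ((continuous_dilate hw).add continuous_const)
    ((continuous_dilate hw).add continuous_const) h h').trans_eq ?_
  rw [dilateSlope, ← intervalIntegral.integral_const_mul, ← intervalIntegral.integral_const_mul,
    ← intervalIntegral.integral_div]
  have hdiff (ξ : ℝ) :
      dilate w μ s' ξ + c - (dilate w μ s ξ + c) = (s' - s) * (w ξ - μ) := by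
    simp only [dilate]
    ring
  have hsqrt (ξ : ℝ) :
      √(dilate w μ s ξ + c) = √(1 + s) * √(w ξ + dilateLevel μ s c) := by
    rw [dilate_add hs, Real.sqrt_mul (by positivity)]
  refine intervalIntegral.integral_congr fun ξ _ => ?_
  simp only [hdiff, hsqrt, mul_inv]
  ring

theorem invSqrtMean_dilate_le (hw : Continuous w) (hs : 0 ≤ s) (hc : ∀ ξ, 0 < w ξ + c)
    (hcc : c ≤ dilateLevel μ s c') :
    invSqrtMean (fun ξ => dilate w μ s ξ + c') ≤ invSqrtMean fun ξ => w ξ + c := by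
  have hle : invSqrtMean (fun ξ => w ξ + dilateLevel μ s c') ≤ invSqrtMean fun ξ => w ξ + c :=
    invSqrtMean_le (hw.add continuous_const) (hw.add continuous_const) hc
      fun ξ => add_le_add_right hcc (w ξ)
  have hpos := invSqrtMean_pos (h := fun ξ => w ξ + dilateLevel μ s c')
    (hw.add continuous_const) fun ξ => by linarith [hc ξ]
  rw [invSqrtMean_dilate_add hs]
  exact (mul_le_of_le_one_left hpos.le
    (inv_le_one_of_one_le₀ (Real.one_le_sqrt.2 (by linarith)))).trans hle

/- Raising the level makes the first factor turn more slowly and the second one faster. -/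
theorem critical_level_le {u : ℝ → ℝ} (hu : Continuous u) (hw : Continuous w) {M N c₀ c₁ : ℝ}
    (hM : 0 < M) (hN : 0 ≤ N) (hs : 0 ≤ s) (hcw₀ : ∀ ξ, 0 < w ξ + c₀)
    (hcrit₀ : M * invSqrtMean (fun ξ => u ξ - c₀) = N * invSqrtMean (fun ξ => w ξ + c₀))
    (hc₁ : c₀ < c₁) (hs₁ : c₀ ≤ dilateLevel μ s c₁) (hcu : ∀ ξ, c < u ξ)
    (hcrit : M * invSqrtMean (fun ξ => u ξ - c) = N * invSqrtMean (fun ξ => dilate w μ s ξ + c)) :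
    c ≤ c₁ := by
  by_contra! hlt
  have hBw : invSqrtMean (fun ξ => dilate w μ s ξ + c) ≤ invSqrtMean fun ξ => w ξ + c₀ :=
    invSqrtMean_dilate_le hw hs hcw₀ (hs₁.trans (dilateLevel_le_dilateLevel hs hlt.le))
  have hBu : invSqrtMean (fun ξ => u ξ - c₀) < invSqrtMean fun ξ => u ξ - c :=
    invSqrtMean_lt (hu.sub continuous_const) (hu.sub continuous_const)
      (fun ξ => sub_pos.2 (hcu ξ)) fun ξ => by linarith
  linarith [mul_lt_mul_of_pos_left hBu hM, mul_le_mul_of_nonneg_left hBw hN]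

end Dilate

/-! ### The action of librations -/

/-- The Lagrangian action `∫₀ᵀ (v² + u(x)) / 2`, whose critical points are the solutions of
`x'' = u'(x) / 2`. -/
def lagrangianAction (u x v : ℝ → ℝ) (T : ℝ) : ℝ := ∫ t in (0 : ℝ)..T, (v t ^ 2 + u (x t)) / 2

theorem abs_lagrangian_sub_le {u : ℝ → ℝ} {K x y v z d : ℝ} (hu : C2Bound u K)
    (hxy : |y - x| ≤ d) (hvz : |z - v| ≤ d) :
    |(z ^ 2 + u y) / 2 - (v ^ 2 + u x) / 2 - (deriv u x / 2 * (y - x) + v * (z - v))| ≤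
      (1 + K) * d ^ 2 := by
  have hx2 : K * (y - x) ^ 2 ≤ K * d ^ 2 :=
    mul_le_mul_of_nonneg_left (sq_le_sq.2 (hxy.trans (le_abs_self d))) hu.nonneg
  have hv2 : (z - v) ^ 2 ≤ d ^ 2 := sq_le_sq.2 (hvz.trans (le_abs_self d))
  have htaylor := abs_le.1 (hu.abs_taylor_le x y)
  rw [abs_le]
  constructor <;> linarith [sq_nonneg (z - v), sq_nonneg d, htaylor.1, htaylor.2]

theorem NewtonSolution.abs_sub_le_of_at_rest {u x₀ v₀ x₁ v₁ : ℝ → ℝ} {K t R : ℝ}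
    (h₀ : NewtonSolution u x₀ v₀) (h₁ : NewtonSolution u x₁ v₁) (hu : C2Bound u K)
    (hv₀ : v₀ 0 = 0) (hv₁ : v₁ 0 = 0) (ht : t ∈ Icc 0 R) :
    |x₁ t - x₀ t| ≤ |x₁ 0 - x₀ 0| * Real.exp (max 1 K * R) ∧
      |v₁ t - v₀ t| ≤ |x₁ 0 - x₀ 0| * Real.exp (max 1 K * R) := by
  have hdist := dist_le hu h₀ h₁ ht.1
  rw [Prod.dist_eq, Prod.dist_eq, hv₀, hv₁, dist_self, max_eq_left dist_nonneg] at hdist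
  have hexp : Real.exp (max 1 K * t) ≤ Real.exp (max 1 K * R) := by
    gcongr
    exact ht.2
  exact max_le_iff.1 (hdist.trans (mul_le_mul_of_nonneg_left hexp dist_nonneg))

namespace IsLibration

variable {u x v x₀ v₀ x₁ v₁ : ℝ → ℝ} {Q Q₀ Q₁ K R : ℝ}

theorem lagrangianAction_eq (h : IsLibration u x v Q) (hu : Differentiable ℝ u) :
    lagrangianAction u x v Q = (∫ t in (0 : ℝ)..Q, v t ^ 2) + u (x 0) * Q / 2 := by
  have henergy (t : ℝ) : (v t ^ 2 + u (x t)) / 2 = v t ^ 2 + u (x 0) / 2 := by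
    linarith [h.sq_vel_eq_of_vel_eq_zero hu h.vel_zero t]
  simp only [lagrangianAction, henergy]
  rw [intervalIntegral.integral_add (f := fun t => v t ^ 2) (g := fun _ => u (x 0) / 2)
    ((h.continuous_vel.pow 2).intervalIntegrable _ _)
    intervalIntegrable_const, intervalIntegral.integral_const, smul_eq_mul]
  ring

/- The boundary terms of the integration by parts vanish at the turning points. -/
theorem integral_variation_eq_zero (h₀ : IsLibration u x₀ v₀ Q) (hu : Continuous (deriv u))
    (h₁ : NewtonSolution u x₁ v₁) :
    ∫ t in (0 : ℝ)..Q, (deriv u (x₀ t) / 2 * (x₁ t - x₀ t) + v₀ t * (v₁ t - v₀ t)) = 0 := by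
  have := h₀.continuous_pos
  have := h₀.continuous_vel
  have := h₁.continuous_pos
  have := h₁.continuous_vel
  rw [intervalIntegral.integral_eq_sub_of_hasDerivAt (f := fun t => v₀ t * (x₁ t - x₀ t))
    (fun t _ => (h₀.hasDerivAt_vel t).mul ((h₁.hasDerivAt_pos t).sub (h₀.hasDerivAt_pos t)))
    (Continuous.intervalIntegrable (by fun_prop) _ _), h₀.vel_end, h₀.vel_zero]
  simp

theorem abs_lagrangianAction_sub_le (hu : C2Bound u K) (h₀ : IsLibration u x₀ v₀ Q₀)
    (h₁ : IsLibration u x₁ v₁ Q₁) (hR : Q₀ ≤ R) :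
    |lagrangianAction u x₁ v₁ Q₀ - lagrangianAction u x₀ v₀ Q₀| ≤
      (1 + K) * (|x₁ 0 - x₀ 0| * Real.exp (max 1 K * R)) ^ 2 * R := by
  have := h₀.continuous_pos
  have := h₀.continuous_vel
  have := h₁.continuous_pos
  have := h₁.continuous_vel
  have := hu.continuous
  have hu' := hu.continuous_deriv
  have hbound : ∀ t ∈ uIoc 0 Q₀, ‖(v₁ t ^ 2 + u (x₁ t)) / 2 - (v₀ t ^ 2 + u (x₀ t)) / 2 -
      (deriv u (x₀ t) / 2 * (x₁ t - x₀ t) + v₀ t * (v₁ t - v₀ t))‖ ≤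
      (1 + K) * (|x₁ 0 - x₀ 0| * Real.exp (max 1 K * R)) ^ 2 := fun t ht => by
    rw [uIoc_of_le h₀.pos.le] at ht
    have hle := h₀.abs_sub_le_of_at_rest h₁.toNewtonSolution hu h₀.vel_zero h₁.vel_zero
      ⟨ht.1.le, ht.2.trans hR⟩
    exact abs_lagrangian_sub_le hu hle.1 hle.2
  have hint := intervalIntegral.norm_integral_le_of_norm_le_const hbound
  rw [intervalIntegral.integral_sub (Continuous.intervalIntegrable (by fun_prop) _ _)
      (Continuous.intervalIntegrable (by fun_prop) _ _),
    h₀.integral_variation_eq_zero hu' h₁.toNewtonSolution, sub_zero,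
    intervalIntegral.integral_sub (Continuous.intervalIntegrable (by fun_prop) _ _)
      (Continuous.intervalIntegrable (by fun_prop) _ _), sub_zero, abs_of_pos h₀.pos] at hint
  have := hu.nonneg
  exact hint.trans (by gcongr)

theorem abs_lagrangianAction_tail_le (hu : C2Bound u K) (h : IsLibration u x v Q) (T b : ℝ) :
    |lagrangianAction u x v Q - lagrangianAction u x v T - b / 2 * (Q - T)| ≤
      ((K * |Q - T|) ^ 2 + |u (x 0) - b| / 2) * |Q - T| := by
  have := h.continuous_pos
  have := h.continuous_vel
  have := hu.continuous
  have hint (s t : ℝ) :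
      IntervalIntegrable (fun t => (v t ^ 2 + u (x t)) / 2) MeasureTheory.volume s t :=
    Continuous.intervalIntegrable (by fun_prop) _ _
  have hbound : ∀ t ∈ uIoc T Q, ‖(v t ^ 2 + u (x t)) / 2 - b / 2‖ ≤
      (K * |Q - T|) ^ 2 + |u (x 0) - b| / 2 := fun t ht => by
    have hvel : |v t| ≤ K * |Q - T| := by
      refine (h.abs_vel_le hu h.vel_end t).trans (mul_le_mul_of_nonneg_left ?_ hu.nonneg)
      rw [abs_sub_comm t]
      exact abs_sub_right_of_mem_uIcc (uIoc_subset_uIcc ht)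
    have hvel2 : v t ^ 2 ≤ (K * |Q - T|) ^ 2 := sq_le_sq.2 (hvel.trans (le_abs_self _))
    have henergy := h.sq_vel_eq_of_vel_eq_zero (hu.contDiff.differentiable two_ne_zero) h.vel_zero t
    rw [Real.norm_eq_abs, abs_le]
    constructor <;>
      linarith [sq_nonneg (v t), neg_abs_le (u (x 0) - b), le_abs_self (u (x 0) - b)]
  have hle := intervalIntegral.norm_integral_le_of_norm_le_const hbound
  rwa [intervalIntegral.integral_sub (hint _ _) intervalIntegrable_const,
    intervalIntegral.integral_const, smul_eq_mul, mul_comm (Q - T), Real.norm_eq_abs,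
    ← intervalIntegral.integral_interval_sub_left (hint 0 Q) (hint 0 T)] at hle

theorem exists_abs_lagrangianAction_sub_le (hu : C2Bound u K) (hR : 0 ≤ R) :
    ∃ C, 0 ≤ C ∧ ∀ {x₀ v₀ x₁ v₁ : ℝ → ℝ} {Q₀ Q₁ : ℝ}, IsLibration u x₀ v₀ Q₀ →
      IsLibration u x₁ v₁ Q₁ → Q₀ ≤ R → Q₁ ≤ R →
      |lagrangianAction u x₁ v₁ Q₁ - lagrangianAction u x₀ v₀ Q₀ - u (x₀ 0) / 2 * (Q₁ - Q₀)| ≤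
        C * ((x₁ 0 - x₀ 0) ^ 2 + (Q₁ - Q₀) ^ 2) := by
  have hK := hu.nonneg
  obtain ⟨E, hE⟩ : ∃ E, E = Real.exp (max 1 K * R) := ⟨_, rfl⟩
  refine ⟨R * (1 + K) * E ^ 2 + K ^ 2 * R + K, by positivity, ?_⟩
  intro x₀ v₀ x₁ v₁ Q₀ Q₁ h₀ h₁ hQ₀ hQ₁
  have hbulk := abs_lagrangianAction_sub_le hu h₀ h₁ hQ₀
  have htail := abs_lagrangianAction_tail_le hu h₁ Q₀ (u (x₀ 0))
  obtain ⟨a, ha⟩ : ∃ a, a = |x₁ 0 - x₀ 0| := ⟨_, rfl⟩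
  obtain ⟨q, hq⟩ : ∃ q, q = |Q₁ - Q₀| := ⟨_, rfl⟩
  have ha0 : 0 ≤ a := ha ▸ abs_nonneg _
  have hq0 : 0 ≤ q := hq ▸ abs_nonneg _
  have hqR : q ≤ R := hq ▸ abs_le.2 ⟨by linarith [h₁.pos], by linarith [h₀.pos]⟩
  have hu₀ : |u (x₁ 0) - u (x₀ 0)| ≤ K * a := ha ▸ hu.abs_sub_le (x₀ 0) (x₁ 0)
  rw [← ha, ← hE, abs_le] at hbulk
  rw [← hq, abs_le] at htail
  rw [← sq_abs (x₁ 0 - x₀ 0), ← sq_abs (Q₁ - Q₀), ← ha, ← hq]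
  calc |lagrangianAction u x₁ v₁ Q₁ - lagrangianAction u x₀ v₀ Q₀ - u (x₀ 0) / 2 * (Q₁ - Q₀)|
      ≤ (1 + K) * (a * E) ^ 2 * R + ((K * q) ^ 2 + |u (x₁ 0) - u (x₀ 0)| / 2) * q := by
        rw [abs_le]
        constructor <;> linarith [hbulk.1, hbulk.2, htail.1, htail.2]
    _ ≤ (1 + K) * (a * E) ^ 2 * R + (K ^ 2 * (q * R) + K * a / 2) * q := by
        rw [show (K * q) ^ 2 = K ^ 2 * (q * q) by ring]
        gcongr
    _ ≤ (R * (1 + K) * E ^ 2 + K ^ 2 * R + K) * (a ^ 2 + q ^ 2) := by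
        have hE2 : 0 ≤ R * (1 + K) * E ^ 2 * q ^ 2 := by positivity
        have hR2 : 0 ≤ K ^ 2 * R * a ^ 2 := by positivity
        have hK2 : 0 ≤ K * (a - q) ^ 2 := by positivity
        have haq : 0 ≤ K * (a * q) := by positivity
        linarith [mul_nonneg hK (sq_nonneg a), mul_nonneg hK (sq_nonneg q)]

end IsLibration

/-! ### A pigeonhole argument -/

theorem exists_lt_mul_abs_sub_le_one {N : ℕ} {a : ℕ → ℝ} (ha : ∀ j < N + 2, a j ∈ Icc (0 : ℝ) 1) :
    ∃ i j, i < j ∧ j < N + 2 ∧ N * |a j - a i| ≤ 1 := by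
  obtain ⟨i, hi, j, hj, hij, hfloor⟩ := Finset.exists_ne_map_eq_of_card_lt_of_maps_to
    (s := Finset.range (N + 2)) (t := Finset.range (N + 1)) (by simp)
    (f := fun j => ⌊N * a j⌋₊) fun j hj => by
      rw [Finset.coe_range, mem_Iio, Nat.lt_succ_iff]
      exact Nat.floor_le_of_le
        (mul_le_of_le_one_right N.cast_nonneg (ha j (Finset.mem_range.1 hj)).2)
  rw [Finset.mem_range] at hi hj
  wlog hlt : i < j generalizing i j
  · exact this j hj i hi hij.symm hfloor.symm (lt_of_le_of_ne (not_lt.1 hlt) hij.symm)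
  have hfl (k : ℕ) (hk : k < N + 2) := Nat.floor_le (mul_nonneg N.cast_nonneg (ha k hk).1)
  have hi' := Nat.lt_floor_add_one ((N : ℝ) * a i)
  have hj' := Nat.lt_floor_add_one ((N : ℝ) * a j)
  refine ⟨i, j, hlt, hj, ?_⟩
  rw [← abs_of_nonneg (N.cast_nonneg (α := ℝ)), ← abs_mul, mul_sub, abs_le]
  constructor <;> linarith [hfl i hi, hfl j hj, congrArg (Nat.cast (R := ℝ)) hfloor]

/- Among `N + 2` equidistant parameters, two have values within `1 / N` of each other, while their
distance is at least `ε / (N + 1)`. -/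
theorem exists_lt_mul_sq_sub_lt {ε : ℝ} (hε : 0 < ε) (C : ℝ) {a : ℝ → ℝ}
    (ha : ∀ s ∈ Icc 0 ε, a s ∈ Icc (0 : ℝ) 1) :
    ∃ s ∈ Icc 0 ε, ∃ s' ∈ Icc 0 ε, s < s' ∧ C * (a s' - a s) ^ 2 < s' - s := by
  obtain ⟨N, hN⟩ := exists_nat_gt (max 1 (2 * |C| / ε))
  have hN1 : (1 : ℝ) < N := (le_max_left _ _).trans_lt hN
  have hNC : 2 * |C| < N * ε := (div_lt_iff₀ hε).1 ((le_max_right _ _).trans_lt hN)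
  have hgrid (j : ℕ) (hj : j < N + 2) : j * (ε / (N + 1)) ∈ Icc 0 ε := by
    have hj' : (j : ℝ) ≤ N + 1 := by exact_mod_cast Nat.lt_succ_iff.1 hj
    refine ⟨by positivity, ?_⟩
    calc (j : ℝ) * (ε / (N + 1)) ≤ (N + 1) * (ε / (N + 1)) := by gcongr
      _ = ε := by field_simp
  obtain ⟨i, j, hij, hj, hclose⟩ := exists_lt_mul_abs_sub_le_one
    (a := fun j => a (j * (ε / (N + 1)))) fun j hj => ha _ (hgrid j hj)
  refine ⟨_, hgrid i (hij.trans hj), _, hgrid j hj, by gcongr, ?_⟩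
  have hstep : ε / (N + 1) ≤ j * (ε / (N + 1)) - i * (ε / (N + 1)) := by
    have : (i : ℝ) + 1 ≤ j := by exact_mod_cast hij
    rw [← sub_mul]
    exact le_mul_of_one_le_left (by positivity) (by linarith)
  refine lt_of_lt_of_le ?_ hstep
  calc C * (a (j * (ε / (N + 1))) - a (i * (ε / (N + 1)))) ^ 2
      ≤ |C| * (1 / N) ^ 2 := by
        rw [← sq_abs (_ - _)]
        gcongr
        · exact le_abs_self C
        · rwa [le_div_iff₀' (by positivity)]
    _ < ε / (N + 1) := by
        rw [div_pow, one_pow, mul_one_div, div_lt_div_iff₀ (by positivity) (by positivity)]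
        calc |C| * (N + 1) ≤ |C| * (2 * N) := by gcongr; linarith
          _ = 2 * |C| * N := by ring
          _ < N * ε * N := by gcongr
          _ = ε * N ^ 2 := by ring

/-! ### Librations in a growing family -/

theorem abs_inv_sqrt_sub_le {a b δ : ℝ} (hδ : 0 < δ) (ha : δ ≤ a) (hb : δ ≤ b) :
    |(√a)⁻¹ - (√b)⁻¹| ≤ (√δ)⁻¹ ^ 3 * |a - b| := by
  have hd : 0 < √δ := Real.sqrt_pos.2 hδ
  have hsa : √δ ≤ √a := Real.sqrt_le_sqrt ha
  have hsb : √δ ≤ √b := Real.sqrt_le_sqrt hb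
  have hpa : 0 < √a := hd.trans_le hsa
  have hpb : 0 < √b := hd.trans_le hsb
  have hsub : (√a)⁻¹ - (√b)⁻¹ = -((a - b) * ((√a)⁻¹ * (√b)⁻¹ * (√a + √b)⁻¹)) := by
    have hab : a - b = √a ^ 2 - √b ^ 2 := by
      rw [Real.sq_sqrt (hδ.le.trans ha), Real.sq_sqrt (hδ.le.trans hb)]
    rw [hab]
    field_simp
    ring
  have hadd : √δ ≤ √a + √b := by linarith
  rw [hsub, abs_neg, abs_mul, mul_comm, abs_of_pos (a := _ * _) (by positivity), pow_three']
  gcongr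

theorem abs_invSqrtMean_sub_le {h₀ h₁ : ℝ → ℝ} {δ d : ℝ} (c₀ : Continuous h₀) (c₁ : Continuous h₁)
    (hδ : 0 < δ) (p₀ : ∀ x, δ ≤ h₀ x) (p₁ : ∀ x, δ ≤ h₁ x) (hd : ∀ x, |h₁ x - h₀ x| ≤ d) :
    |invSqrtMean h₁ - invSqrtMean h₀| ≤ (√δ)⁻¹ ^ 3 * d := by
  have i₀ := continuous_inv_sqrt c₀ fun x => hδ.trans_le (p₀ x)
  have i₁ := continuous_inv_sqrt c₁ fun x => hδ.trans_le (p₁ x)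
  rw [invSqrtMean, invSqrtMean, ← intervalIntegral.integral_sub (i₁.intervalIntegrable _ _)
    (i₀.intervalIntegrable _ _), ← Real.norm_eq_abs]
  refine (intervalIntegral.norm_integral_le_of_norm_le_const (C := (√δ)⁻¹ ^ 3 * d)
    fun x _ => ?_).trans (by simp)
  exact (abs_inv_sqrt_sub_le hδ (p₁ x) (p₀ x)).trans
    (mul_le_mul_of_nonneg_left (hd x) (by positivity))

theorem invSqrtMean_le_inv_sqrt {h : ℝ → ℝ} {δ : ℝ} (hc : Continuous h) (hδ : 0 < δ)
    (hle : ∀ x, δ ≤ h x) : invSqrtMean h ≤ (√δ)⁻¹ := by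
  simpa [invSqrtMean] using intervalIntegral.integral_mono (g := fun _ => (√δ)⁻¹) zero_le_one
    ((continuous_inv_sqrt hc fun x => hδ.trans_le (hle x)).intervalIntegrable
      (μ := MeasureTheory.volume) 0 1)
    intervalIntegrable_const
    (fun x => inv_anti₀ (Real.sqrt_pos.2 hδ) (Real.sqrt_le_sqrt (hle x)))

/-- A family of potentials `W s`, `0 ≤ s ≤ ε`, along which the mean of `√(W s + u a)` grows at rate
at least `κ` for every `a`; `δ` is a lower bound for the `W s + u a`, and `D` is a Lipschitz
constant. -/
structure GrowingFamily (u : ℝ → ℝ) (W : ℝ → ℝ → ℝ) (ε δ D κ : ℝ) : Prop where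
  continuous : ∀ s ∈ Icc 0 ε, Continuous (W s)
  delta_pos : 0 < δ
  delta_le : ∀ s ∈ Icc 0 ε, ∀ a ξ, δ ≤ W s ξ + u a
  abs_sub_le : ∀ s ∈ Icc 0 ε, ∀ s' ∈ Icc 0 ε, s ≤ s' → ∀ ξ, |W s' ξ - W s ξ| ≤ D * (s' - s)
  mul_sub_le : ∀ s ∈ Icc 0 ε, ∀ s' ∈ Icc 0 ε, s ≤ s' → ∀ a, κ * (s' - s) ≤
    sqrtMean (fun ξ => W s' ξ + u a) - sqrtMean (fun ξ => W s ξ + u a)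

namespace GrowingFamily

variable {u : ℝ → ℝ} {W : ℝ → ℝ → ℝ} {ε δ D κ K N s s' : ℝ}

theorem mono (F : GrowingFamily u W ε δ D κ) {ε' : ℝ} (h : ε' ≤ ε) :
    GrowingFamily u W ε' δ D κ :=
  have hsub : Icc 0 ε' ⊆ Icc 0 ε := Icc_subset_Icc_right h
  ⟨fun s hs => F.continuous s (hsub hs), F.delta_pos, fun s hs => F.delta_le s (hsub hs),
    fun s hs s' hs' => F.abs_sub_le s (hsub hs) s' (hsub hs'),
    fun s hs s' hs' => F.mul_sub_le s (hsub hs) s' (hsub hs')⟩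

theorem continuous_add (F : GrowingFamily u W ε δ D κ) (hs : s ∈ Icc 0 ε) (a : ℝ) :
    Continuous fun ξ => W s ξ + u a :=
  (F.continuous s hs).add continuous_const

theorem invSqrtMean_le (F : GrowingFamily u W ε δ D κ) (hs : s ∈ Icc 0 ε) (a : ℝ) :
    invSqrtMean (fun ξ => W s ξ + u a) ≤ (√δ)⁻¹ :=
  invSqrtMean_le_inv_sqrt (F.continuous_add hs a) F.delta_pos (F.delta_le s hs a)

theorem abs_invSqrtMean_sub_le (F : GrowingFamily u W ε δ D κ) (hu : C2Bound u K)
    (hs : s ∈ Icc 0 ε) (hs' : s' ∈ Icc 0 ε) (hss : s ≤ s') (a a' : ℝ) :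
    |invSqrtMean (fun ξ => W s' ξ + u a') - invSqrtMean (fun ξ => W s ξ + u a)| ≤
      (√δ)⁻¹ ^ 3 * (D * (s' - s) + K * |a' - a|) := by
  refine _root_.abs_invSqrtMean_sub_le (F.continuous_add hs a) (F.continuous_add hs' a') F.delta_pos
    (F.delta_le s hs a) (F.delta_le s' hs' a') fun ξ => ?_
  rw [add_sub_add_comm]
  exact (abs_add_le _ _).trans (add_le_add (F.abs_sub_le s hs s' hs' hss ξ) (hu.abs_sub_le a a'))

theorem mul_sub_add_le (F : GrowingFamily u W ε δ D κ) (hs : s ∈ Icc 0 ε) (hs' : s' ∈ Icc 0 ε)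
    (hss : s ≤ s') (a a' : ℝ) :
    κ * (s' - s) + (u a' - u a) / 2 * invSqrtMean (fun ξ => W s ξ + u a') ≤
      sqrtMean (fun ξ => W s' ξ + u a') - sqrtMean (fun ξ => W s ξ + u a) := by
  linarith [F.mul_sub_le s hs s' hs' hss a', sqrtMean_add_sub_le (F.continuous s hs)
    (fun ξ => F.delta_pos.trans_le (F.delta_le s hs a' ξ))
    (fun ξ => (F.delta_pos.trans_le (F.delta_le s hs a ξ)).le)]

theorem sq_period_sub_le (F : GrowingFamily u W ε δ D κ) (hu : C2Bound u K)
    (hs : s ∈ Icc 0 ε) (hs' : s' ∈ Icc 0 ε) (hss : s ≤ s') (a a' : ℝ) :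
    (N * invSqrtMean (fun ξ => W s' ξ + u a') - N * invSqrtMean (fun ξ => W s ξ + u a)) ^ 2 ≤
      2 * (N * (√δ)⁻¹ ^ 3) ^ 2 * (K ^ 2 + D ^ 2) * ((a' - a) ^ 2 + (s' - s) ^ 2) := by
  have hle := sq_le_sq.2 ((F.abs_invSqrtMean_sub_le hu hs hs' hss a a').trans (le_abs_self _))
  have hcs : (D * (s' - s) + K * |a' - a|) ^ 2 ≤
      2 * ((K ^ 2 + D ^ 2) * ((a' - a) ^ 2 + (s' - s) ^ 2)) := by
    rw [← sq_abs (a' - a)]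
    linarith [sq_nonneg (D * (s' - s) - K * |a' - a|), sq_nonneg (K * (s' - s)),
      sq_nonneg (D * |a' - a|)]
  rw [← mul_sub, mul_pow]
  calc N ^ 2 * (invSqrtMean (fun ξ => W s' ξ + u a') - invSqrtMean (fun ξ => W s ξ + u a)) ^ 2
      ≤ N ^ 2 * ((√δ)⁻¹ ^ 3 * (D * (s' - s) + K * |a' - a|)) ^ 2 := by gcongr
    _ = (N * (√δ)⁻¹ ^ 3) ^ 2 * (D * (s' - s) + K * |a' - a|) ^ 2 := by ring
    _ ≤ (N * (√δ)⁻¹ ^ 3) ^ 2 * (2 * ((K ^ 2 + D ^ 2) * ((a' - a) ^ 2 + (s' - s) ^ 2))) := by gcongr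
    _ = _ := by ring

theorem mul_sub_le_of_isLibration (F : GrowingFamily u W ε δ D κ) (hu : C2Bound u K) (hN : 0 ≤ N)
    (hs : s ∈ Icc 0 ε) (hs' : s' ∈ Icc 0 ε) (hss : s ≤ s') {x v x' v' : ℝ → ℝ} {Q Q' : ℝ}
    (h : IsLibration u x v Q) (h' : IsLibration u x' v' Q')
    (hQ' : Q' = N * invSqrtMean (fun ξ => W s' ξ + u (x' 0))) :
    N * κ * (s' - s) ≤
      ((∫ t in (0 : ℝ)..Q', v' t ^ 2) + N * sqrtMean (fun ξ => W s' ξ + u (x' 0))) -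
        ((∫ t in (0 : ℝ)..Q, v t ^ 2) + N * sqrtMean (fun ξ => W s ξ + u (x 0))) -
        (lagrangianAction u x' v' Q' - lagrangianAction u x v Q - u (x 0) / 2 * (Q' - Q)) +
        N * (√δ)⁻¹ ^ 3 * D * K / 2 * (|x' 0 - x 0| * (s' - s)) := by
  have hdiff := hu.contDiff.differentiable two_ne_zero
  rw [h.lagrangianAction_eq hdiff, h'.lagrangianAction_eq hdiff]
  have hmean := F.abs_invSqrtMean_sub_le hu hs hs' hss (x' 0) (x' 0)
  rw [sub_self, abs_zero, mul_zero, add_zero] at hmean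
  have hcross : |(u (x' 0) - u (x 0)) * (invSqrtMean (fun ξ => W s' ξ + u (x' 0)) -
      invSqrtMean (fun ξ => W s ξ + u (x' 0)))| ≤
      K * |x' 0 - x 0| * ((√δ)⁻¹ ^ 3 * (D * (s' - s))) := by
    rw [abs_mul]
    have := hu.nonneg
    gcongr
    exact hu.abs_sub_le (x 0) (x' 0)
  have hcross' := mul_le_mul_of_nonneg_left (abs_le.1 hcross).2 hN
  have hgrow := mul_le_mul_of_nonneg_left (F.mul_sub_add_le hs hs' hss (x 0) (x' 0)) hN
  rw [hQ']
  linarith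

/- The dependence on the starting points is quadratic because librations are critical points of the
action. -/
theorem exists_mul_sub_le (F : GrowingFamily u W ε δ D κ) (hu : C2Bound u K) (hD : 0 ≤ D)
    (hN : 0 ≤ N) :
    ∃ C, 0 ≤ C ∧ ∀ {s s' Q Q' : ℝ} {x v x' v' : ℝ → ℝ}, s ∈ Icc 0 ε → s' ∈ Icc 0 ε → s ≤ s' →
      IsLibration u x v Q → IsLibration u x' v' Q' →
      Q = N * invSqrtMean (fun ξ => W s ξ + u (x 0)) →
      Q' = N * invSqrtMean (fun ξ => W s' ξ + u (x' 0)) →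
      N * κ * (s' - s) ≤
        ((∫ t in (0 : ℝ)..Q', v' t ^ 2) + N * sqrtMean (fun ξ => W s' ξ + u (x' 0))) -
          ((∫ t in (0 : ℝ)..Q, v t ^ 2) + N * sqrtMean (fun ξ => W s ξ + u (x 0))) +
          C * ((x' 0 - x 0) ^ 2 + (s' - s) ^ 2) := by
  have hK := hu.nonneg
  obtain ⟨C, hC, hvar⟩ := IsLibration.exists_abs_lagrangianAction_sub_le hu
    (R := N * (√δ)⁻¹) (by positivity)
  refine ⟨C + C * (2 * (N * (√δ)⁻¹ ^ 3) ^ 2 * (K ^ 2 + D ^ 2)) + N * (√δ)⁻¹ ^ 3 * D * K,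
    by positivity, ?_⟩
  intro s s' Q Q' x v x' v' hs hs' hss h h' hQ hQ'
  have hQR : Q ≤ N * (√δ)⁻¹ := hQ ▸ mul_le_mul_of_nonneg_left (F.invSqrtMean_le hs _) hN
  have hQR' : Q' ≤ N * (√δ)⁻¹ := hQ' ▸ mul_le_mul_of_nonneg_left (F.invSqrtMean_le hs' _) hN
  have haction := (abs_le.1 (hvar h h' hQR hQR')).1
  have hperiod := mul_le_mul_of_nonneg_left
    (F.sq_period_sub_le (N := N) hu hs hs' hss (x 0) (x' 0)) hC
  rw [← hQ, ← hQ'] at hperiod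
  have hgrow := F.mul_sub_le_of_isLibration hu hN hs hs' hss h h' hQ'
  have hmixed := mul_le_mul_of_nonneg_left (two_mul_le_add_sq |x' 0 - x 0| (s' - s))
    (by positivity : 0 ≤ N * (√δ)⁻¹ ^ 3 * D * K / 4)
  have hrest : 0 ≤ N * (√δ)⁻¹ ^ 3 * D * K * ((x' 0 - x 0) ^ 2 + (s' - s) ^ 2) := by positivity
  have hsq : 0 ≤ C * (s' - s) ^ 2 := by positivity
  rw [sq_abs] at hmixed
  linarith

theorem exists_not_mem_librationActions (F : GrowingFamily u W ε δ D κ) (hu : C2Bound u K)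
    (hD : 0 ≤ D) (hN : 0 < N) (hκ : 0 < κ) (hε : 0 < ε) {ℓ : ℝ → ℝ}
    (hℓ : AntitoneOn ℓ (Icc 0 ε)) : ∃ s ∈ Icc 0 ε, ℓ s ∉ librationActions u (W s) N := by
  obtain ⟨C, hC, hquad⟩ := F.exists_mul_sub_le hu hD hN.le
  set ε' := min ε (N * κ / 2 / (C + 1))
  have hε' : 0 < ε' := by positivity
  have hsub : Icc 0 ε' ⊆ Icc 0 ε := Icc_subset_Icc_right (min_le_left _ _)
  by_contra! hmem
  simp only [librationActions, mem_ofPred_eq] at hmem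
  choose! x v Q hlib hx hQ hact using hmem
  obtain ⟨s, hs, s', hs', hss, hlt⟩ := exists_lt_mul_sq_sub_lt hε' (C / (N * κ / 2))
    (a := fun s => x s 0) fun s hs => hx s (hsub hs)
  have hle := hquad (hsub hs) (hsub hs') hss.le (hlib s (hsub hs)) (hlib s' (hsub hs'))
    (hQ s (hsub hs)) (hQ s' (hsub hs'))
  rw [← hact s (hsub hs), ← hact s' (hsub hs')] at hle
  have hsmall : (s' - s) * (C + 1) ≤ N * κ / 2 := by
    rw [← le_div_iff₀ (by positivity)]
    linarith [hs.1, hs'.2.trans (min_le_right _ _)]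
  have hsq : C * (s' - s) ^ 2 ≤ N * κ / 2 * (s' - s) := by
    nlinarith
  rw [div_mul_eq_mul_div, div_lt_iff₀ (by positivity)] at hlt
  linarith [hℓ (hsub hs) (hsub hs') hss.le]

end GrowingFamily

/-! ### Breaking coincidences by dilating a potential -/

theorem pos_of_mem_librationActions {u w : ℝ → ℝ} {N ℓ : ℝ} (hN : 0 ≤ N)
    (h : ℓ ∈ librationActions u w N) : 0 < N := by
  obtain ⟨x, v, Q, hlib, -, hQ, -⟩ := h
  exact hN.lt_of_ne' fun h0 => hlib.pos.ne' (by rw [hQ, h0, zero_mul])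

theorem exists_pos_forall_mem_Icc {p : ℝ → Prop} (h : ∀ᶠ s in 𝓝 0, p s) :
    ∃ ε > 0, ∀ s ∈ Icc 0 ε, p s :=
  mem_nhdsGE_iff_exists_Icc_subset.1 (mem_nhdsWithin_of_mem_nhds h)

section Dilate

variable {u w : ℝ → ℝ} {μ s s' c c₀ c₁ e₀ : ℝ} {m n : ℤ}

theorem dilateLevel_le_abs_add_abs (hs : 0 ≤ s) : dilateLevel μ s c ≤ |c| + |μ| := by
  rw [dilateLevel, div_le_iff₀ (by positivity)]
  have hμ : -(s * μ) ≤ s * |μ| := by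
    rw [← mul_neg]
    exact mul_le_mul_of_nonneg_left (neg_le_abs μ) hs
  linarith [le_abs_self c, abs_nonneg μ, mul_nonneg hs (abs_nonneg c)]

theorem dilate_add_pos_of_le (hs : 0 ≤ s) (hss : s ≤ s') (hμ : 0 < μ + c) {ξ : ℝ}
    (h : 0 < dilate w μ s' ξ + c) : 0 < dilate w μ s ξ + c := by
  simp only [dilate] at h ⊢
  rcases le_total (w ξ) μ with hle | hle
  · linarith [mul_le_mul_of_nonpos_right hss (sub_nonpos.2 hle)]
  · linarith [mul_nonneg hs (sub_nonneg.2 hle)]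

theorem add_pos_of_dilate_add_pos (hw : Continuous w) (he₀ : ∀ ξ, 0 < w ξ + e₀) (hs : 0 ≤ s)
    (h : ∀ ξ, 0 < dilate w (weightedMean w e₀) s ξ + c) : 0 < weightedMean w e₀ + c := by
  have hpos := weightedMean_add_pos hw he₀ fun ξ => (dilate_add_pos_iff hs ξ).1 (h ξ)
  have hadd := add_dilateLevel (μ := weightedMean w e₀) (c := c) hs (weightedMean w e₀)
  rw [sub_self, mul_zero, add_zero] at hadd
  rw [hadd]
  positivity

/- The action of a rotation is the maximum over all levels, so it suffices to compare the actions on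
the critical level of the parameter `s'`. -/
theorem le_of_mem_separatedSpectrum_dilate (hu : ContDiff ℝ 2 u) (hw : ContDiff ℝ 2 w)
    (pu : Function.Periodic u 1) (pw : Function.Periodic w 1) (hnc : ∃ ξ η, w ξ ≠ w η)
    (hm : m ≠ 0) (hn : n ≠ 0) (hcw₀ : ∀ ξ, 0 < w ξ + c₀)
    (hcrit₀ : |(m : ℝ)| * invSqrtMean (fun ξ => u ξ - c₀) =
      |(n : ℝ)| * invSqrtMean (fun ξ => w ξ + c₀))
    (hc₁ : c₀ < c₁) (he₀ : c₀ ≤ e₀) (hs : 0 ≤ s) (hss : s ≤ s')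
    (hs₁ : dilateLevel (weightedMean w e₀) s c₁ ≤ e₀)
    (hs₁' : c₀ ≤ dilateLevel (weightedMean w e₀) s' c₁) {ℓ ℓ' : ℝ}
    (hℓ : ℓ ∈ separatedSpectrum u (dilate w (weightedMean w e₀) s) m n)
    (hℓ' : ℓ' ∈ separatedSpectrum u (dilate w (weightedMean w e₀) s') m n) : ℓ' ≤ ℓ := by
  obtain ⟨c, hcu, hcw, hcrit, rfl⟩ := exists_level_of_mem_separatedSpectrum hu
    (contDiff_dilate hw) pu (periodic_dilate pw) hm hn hℓ
  obtain ⟨c', hcu', hcw', hcrit', rfl⟩ := exists_level_of_mem_separatedSpectrum hu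
    (contDiff_dilate hw) pu (periodic_dilate pw) hm hn hℓ'
  have hwc := hw.continuous
  have hlevel : c' ≤ c₁ := critical_level_le hu.continuous hwc
    (abs_pos.2 (Int.cast_ne_zero.2 hm)) (abs_nonneg _) (hs.trans hss) hcw₀ hcrit₀ hc₁ hs₁' hcu'
    hcrit'
  have hμ := add_pos_of_dilate_add_pos hwc (fun ξ => by linarith [hcw₀ ξ]) (hs.trans hss) hcw'
  have hadm (ξ : ℝ) := dilate_add_pos_of_le hs hss hμ (hcw' ξ)
  have hmax := le_of_critical_level hu.continuous (continuous_dilate hwc) (abs_nonneg _)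
    (abs_nonneg _) hcu hcw hcrit (fun ξ => (hcu' ξ).le) fun ξ => (hadm ξ).le
  have hslope := dilateSlope_weightedMean_nonpos hwc pw hnc
    (fun ξ => (dilate_add_pos_iff hs ξ).1 (hadm ξ))
    ((dilateLevel_le_dilateLevel hs hlevel).trans hs₁)
  have hdecr := (sqrtMean_dilate_sub_le hwc hs hadm fun ξ => (hcw' ξ).le).trans
    (mul_nonpos_of_nonneg_of_nonpos (by linarith)
      (mul_nonpos_of_nonneg_of_nonpos (by positivity) hslope))
  linarith [mul_nonpos_of_nonneg_of_nonpos (abs_nonneg (n : ℝ)) hdecr]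

theorem exists_forall_le_of_mem_separatedSpectrum_dilate (hu : ContDiff ℝ 2 u)
    (hw : ContDiff ℝ 2 w) (pu : Function.Periodic u 1) (pw : Function.Periodic w 1)
    (hnc : ∃ ξ η, w ξ ≠ w η) (hm : m ≠ 0) (hn : n ≠ 0) (hcw₀ : ∀ ξ, 0 < w ξ + c₀)
    (hcrit₀ : |(m : ℝ)| * invSqrtMean (fun ξ => u ξ - c₀) =
      |(n : ℝ)| * invSqrtMean (fun ξ => w ξ + c₀)) (he₀ : c₀ < e₀) :
    ∃ ε > 0, ∀ s s', 0 ≤ s → s ≤ s' → s' ≤ ε →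
      ∀ ℓ ∈ separatedSpectrum u (dilate w (weightedMean w e₀) s) m n,
      ∀ ℓ' ∈ separatedSpectrum u (dilate w (weightedMean w e₀) s') m n, ℓ' ≤ ℓ := by
  obtain ⟨c₁, hc₁, hce⟩ := exists_between he₀
  have hlim := tendsto_dilateLevel (weightedMean w e₀) c₁
  obtain ⟨ε, hε, hsmall⟩ := exists_pos_forall_mem_Icc
    ((hlim.eventually_const_lt hc₁).and (hlim.eventually_lt_const hce))
  exact ⟨ε, hε, fun s s' hs hss hsε ℓ hℓ ℓ' hℓ' =>
    le_of_mem_separatedSpectrum_dilate hu hw pu pw hnc hm hn hcw₀ hcrit₀ hc₁ he₀.le hs hss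
      (hsmall s ⟨hs, hss.trans hsε⟩).2.le (hsmall s' ⟨hs.trans hss, hsε⟩).1.le hℓ hℓ'⟩

theorem growingFamily_dilate {ε δ D e₁ M κ : ℝ} (hw : Continuous w) (hδ : 0 < δ)
    (hδw : ∀ ξ, δ ≤ w ξ + e₁) (hD : ∀ ξ, |w ξ - μ| ≤ D) (hκ : 0 ≤ κ)
    (hslope : ∀ e ∈ Icc e₁ M, κ ≤ dilateSlope w μ e)
    (hlevel : ∀ s ∈ Icc 0 ε, s ≤ 1 ∧ ∀ a, dilateLevel μ s (u a) ∈ Icc e₁ M) :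
    GrowingFamily u (dilate w μ) ε δ D (κ / 4) := by
  have hle : ∀ s ∈ Icc 0 ε, ∀ a ξ, δ ≤ dilate w μ s ξ + u a := fun s hs a ξ => by
    rw [dilate_add hs.1]
    have hξ : δ ≤ w ξ + dilateLevel μ s (u a) := by
      linarith [hδw ξ, ((hlevel s hs).2 a).1]
    linarith [mul_nonneg hs.1 (hδ.le.trans hξ)]
  refine ⟨fun s _ => continuous_dilate hw, hδ, hle, fun s _ s' _ hss ξ => ?_,
    fun s hs s' hs' hss a => ?_⟩
  · have hdiff : dilate w μ s' ξ - dilate w μ s ξ = (w ξ - μ) * (s' - s) := by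
      simp only [dilate]
      ring
    rw [hdiff, abs_mul, abs_of_nonneg (sub_nonneg.2 hss)]
    exact mul_le_mul_of_nonneg_right (hD ξ) (sub_nonneg.2 hss)
  · have hgrow := sqrtMean_dilate_sub_le (s' := s) (c := u a) hw hs'.1
      (fun ξ => hδ.trans_le (hle s' hs' a ξ)) fun ξ => hδ.le.trans (hle s hs a ξ)
    have hsqrt : (1 : ℝ) / 2 ≤ (√(1 + s'))⁻¹ := by
      rw [one_div]
      refine inv_anti₀ (Real.sqrt_pos.2 (by linarith [hs'.1])) ?_
      rw [Real.sqrt_le_left zero_le_two]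
      linarith [(hlevel s' hs').1]
    have hrate : 1 / 2 * κ ≤ (√(1 + s'))⁻¹ * dilateSlope w μ (dilateLevel μ s' (u a)) :=
      mul_le_mul hsqrt (hslope _ ((hlevel s' hs').2 a)) hκ (by positivity)
    linarith [mul_le_mul_of_nonneg_left hrate (sub_nonneg.2 hss)]

theorem exists_growingFamily_dilate {K b : ℝ} (hu : C2Bound u K) (hw : Continuous w)
    (pw : Function.Periodic w 1) (hnc : ∃ ξ η, w ξ ≠ w η) (he₀ : ∀ ξ, 0 < w ξ + e₀) (heb : e₀ < b)
    (hb : ∀ ξ, b ≤ u ξ) :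
    ∃ ε δ D κ, 0 < ε ∧ 0 ≤ D ∧ 0 < κ ∧
      GrowingFamily u (dilate w (weightedMean w e₀)) ε δ D κ := by
  obtain ⟨e₁, he₁, heb₁⟩ := exists_between heb
  obtain ⟨ξ₀, hξ₀⟩ := exists_isLeast_range_of_continuous_of_periodic hw pw one_ne_zero
  obtain ⟨D, hD⟩ := exists_abs_le_of_continuous_of_periodic
    (f := fun ξ => w ξ - weightedMean w e₀) (hw.sub continuous_const)
    (fun ξ => by simp only [pw ξ]) one_ne_zero
  obtain ⟨κ, hκ, hslope⟩ := exists_pos_le_dilateSlope_weightedMean hw pw hnc he₀ he₁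
    (K + |weightedMean w e₀|)
  obtain ⟨ε, hε, hsmall⟩ := exists_pos_forall_mem_Icc
    (((tendsto_dilateLevel (weightedMean w e₀) b).eventually_const_lt heb₁).and
      (eventually_le_nhds one_pos))
  refine ⟨ε, w ξ₀ + e₁, D, κ / 4, hε, (abs_nonneg _).trans (hD 0), by positivity,
    growingFamily_dilate hw (by linarith [he₀ ξ₀]) (fun ξ => by linarith [hξ₀ ξ]) hD hκ.le hslope
      fun s hs => ⟨(hsmall s hs).2, fun a => ⟨?_, ?_⟩⟩⟩
  · exact (hsmall s hs).1.le.trans (dilateLevel_le_dilateLevel hs.1 (hb a))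
  · exact (dilateLevel_le_abs_add_abs hs.1).trans (add_le_add_left (hu.abs_le a) _)

/- Were there a coincidence for every small `s`, a nonincreasing function of `s` would take its
values in the growing actions of librations. -/
theorem exists_dilate_disjoint (hu : ContDiff ℝ 2 u) (hw : ContDiff ℝ 2 w)
    (pu : Function.Periodic u 1) (pw : Function.Periodic w 1) (hpos : ∀ ξ η, 0 < u ξ + w η)
    (hnc : ∃ ξ η, w ξ ≠ w η) (hm : m ≠ 0) (hn : n ≠ 0) (n' : ℤ) :
    ∃ μ, ∀ ε > 0, ∃ s ∈ Ico 0 ε, Disjoint (separatedSpectrum u (dilate w μ s) m n)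
      (separatedSpectrum u (dilate w μ s) 0 n') := by
  by_cases hdis : Disjoint (separatedSpectrum u w m n) (separatedSpectrum u w 0 n')
  · exact ⟨0, fun ε hε => ⟨0, ⟨le_rfl, hε⟩, by rwa [dilate_zero]⟩⟩
  obtain ⟨ℓ₀, hℓ₀, hℓ₀'⟩ := not_disjoint_iff.1 hdis
  have hn' : 0 < |(n' : ℝ)| := pos_of_mem_librationActions (abs_nonneg _)
    (mem_librationActions_of_mem_separatedSpectrum hu hw.continuous pu pw hpos hℓ₀')
  obtain ⟨c₀, hcu₀, hcw₀, hcrit₀, -⟩ :=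
    exists_level_of_mem_separatedSpectrum hu hw pu pw hm hn hℓ₀
  obtain ⟨ξ₀, hξ₀⟩ := exists_isLeast_range_of_continuous_of_periodic hu.continuous pu one_ne_zero
  obtain ⟨K, -, hK⟩ := exists_c2Bound hu pu
  obtain ⟨e₀, hce, heu⟩ := exists_between (hcu₀ ξ₀)
  obtain ⟨ε₁, hε₁, hle⟩ := exists_forall_le_of_mem_separatedSpectrum_dilate hu hw pu pw hnc hm hn
    hcw₀ hcrit₀ hce
  obtain ⟨ε₂, δ, D, κ, hε₂, hD, hκ, F⟩ := exists_growingFamily_dilate hK hw.continuous pw hnc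
    (fun ξ => by linarith [hcw₀ ξ]) heu hξ₀
  refine ⟨weightedMean w e₀, fun ε hε => ?_⟩
  by_contra! hcon
  obtain ⟨r, hr, hr'⟩ : ∃ r > 0, r < ε ∧ r ≤ ε₁ ∧ r ≤ ε₂ :=
    ⟨min (ε / 2) (min ε₁ ε₂), by positivity, (min_le_left _ _).trans_lt (half_lt_self hε),
      (min_le_right _ _).trans (min_le_left _ _), (min_le_right _ _).trans (min_le_right _ _)⟩
  have hcoin : ∀ s ∈ Icc 0 r, ∃ ℓ, ℓ ∈ separatedSpectrum u (dilate w (weightedMean w e₀) s) m n ∧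
      ℓ ∈ separatedSpectrum u (dilate w (weightedMean w e₀) s) 0 n' := fun s hs =>
    not_disjoint_iff.1 (hcon s ⟨hs.1, hs.2.trans_lt hr'.1⟩)
  choose! ℓ hrot hlib using hcoin
  obtain ⟨s, hs, hnot⟩ := (F.mono hr'.2.2).exists_not_mem_librationActions hK hD hn' hκ hr
    (ℓ := ℓ) fun s hs s' hs' hss => hle s s' hs.1 hss (hs'.2.trans hr'.2.1) _ (hrot s hs) _
      (hrot s' hs')
  refine hnot (mem_librationActions_of_mem_separatedSpectrum hu (continuous_dilate hw.continuous)
    pu (periodic_dilate pw) (fun ξ η => ?_) (hlib s hs))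
  rw [add_comm]
  exact F.delta_pos.trans_le ((F.mono hr'.2.2).delta_le s hs ξ η)

end Dilate

/-! ### Geodesics of Liouville metrics in Hamiltonian form -/

/-- The Hamiltonian equations of the unit speed geodesics of `(u(x) + w(y)) (dx² + dy²)`, with
momenta `p` and `q`. -/
structure HamiltonOrbit (u w x p y q : ℝ → ℝ) : Prop where
  hasDerivAt_x : ∀ t, HasDerivAt x (p t / (u (x t) + w (y t))) t
  hasDerivAt_p : ∀ t, HasDerivAt p (deriv u (x t) / 2 / (u (x t) + w (y t))) t
  hasDerivAt_y : ∀ t, HasDerivAt y (q t / (u (x t) + w (y t))) t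
  hasDerivAt_q : ∀ t, HasDerivAt q (deriv w (y t) / 2 / (u (x t) + w (y t))) t
  energy : ∀ t, p t ^ 2 + q t ^ 2 = u (x t) + w (y t)

theorem contDiff_succ_of_hasDerivAt {f f' : ℝ → ℝ} {n : ℕ} (h : ∀ t, HasDerivAt f (f' t) t)
    (hf' : ContDiff ℝ n f') : ContDiff ℝ (n + 1) f :=
  contDiff_succ_iff_deriv.2 ⟨fun t => (h t).differentiableAt, by simp,
    (funext fun t => (h t).deriv : deriv f = f') ▸ hf'⟩

namespace HamiltonOrbit

variable {u w x p y q : ℝ → ℝ}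

theorem swap (h : HamiltonOrbit u w x p y q) : HamiltonOrbit w u y q x p where
  hasDerivAt_x t := by simpa only [add_comm] using h.hasDerivAt_y t
  hasDerivAt_p t := by simpa only [add_comm] using h.hasDerivAt_q t
  hasDerivAt_y t := by simpa only [add_comm] using h.hasDerivAt_x t
  hasDerivAt_q t := by simpa only [add_comm] using h.hasDerivAt_p t
  energy t := by simpa only [add_comm] using h.energy t

theorem continuous_x (h : HamiltonOrbit u w x p y q) : Continuous x :=
  continuous_iff_continuousAt.2 fun t => (h.hasDerivAt_x t).continuousAt

theorem continuous_p (h : HamiltonOrbit u w x p y q) : Continuous p :=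
  continuous_iff_continuousAt.2 fun t => (h.hasDerivAt_p t).continuousAt

theorem continuous_factor (h : HamiltonOrbit u w x p y q) (hu : Continuous u)
    (hw : Continuous w) : Continuous fun t => u (x t) + w (y t) :=
  (hu.comp h.continuous_x).add (hw.comp h.swap.continuous_x)

theorem contDiff_one_x (h : HamiltonOrbit u w x p y q) (hu : Continuous u) (hw : Continuous w)
    (hpos : ∀ ξ η, 0 < u ξ + w η) : ContDiff ℝ 1 x := by
  refine contDiff_succ_of_hasDerivAt (n := 0) h.hasDerivAt_x (contDiff_zero.2 ?_)
  exact h.continuous_p.div (h.continuous_factor hu hw) fun t => (hpos _ _).ne'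

theorem contDiff_two_x (h : HamiltonOrbit u w x p y q) (hu : ContDiff ℝ 2 u)
    (hw : ContDiff ℝ 2 w) (hpos : ∀ ξ η, 0 < u ξ + w η) : ContDiff ℝ 2 x := by
  have hx := h.contDiff_one_x hu.continuous hw.continuous hpos
  have hy := h.swap.contDiff_one_x hw.continuous hu.continuous
    fun η ξ => add_comm (u ξ) _ ▸ hpos ξ η
  have hp : ContDiff ℝ 1 p := by
    refine contDiff_succ_of_hasDerivAt (n := 0) h.hasDerivAt_p (contDiff_zero.2 ?_)
    exact (((contDiff_one_deriv hu).continuous.comp h.continuous_x).div_const 2).div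
      (h.continuous_factor hu.continuous hw.continuous) fun t => (hpos _ _).ne'
  have hV : ContDiff ℝ 1 fun t => u (x t) + w (y t) :=
    ((hu.of_le one_le_two).comp hx).add ((hw.of_le one_le_two).comp hy)
  simpa only [Nat.cast_one, one_add_one_eq_two] using
    contDiff_succ_of_hasDerivAt (n := 1) h.hasDerivAt_x (hp.div hV fun t => (hpos _ _).ne')

theorem sq_div_add_sq_div (h : HamiltonOrbit u w x p y q) (t : ℝ) :
    (p t / (u (x t) + w (y t))) ^ 2 + (q t / (u (x t) + w (y t))) ^ 2 =
      (u (x t) + w (y t))⁻¹ := by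
  rw [div_pow, div_pow, ← add_div, h.energy t, sq, div_self_mul_self']

end HamiltonOrbit

theorem hasFDerivAt_liouvilleFactor {f₁ f₂ : ℝ → ℝ} (h₁ : ContDiff ℝ 2 f₁) (h₂ : ContDiff ℝ 2 f₂)
    (x : Fin 2 → ℝ) :
    HasFDerivAt (fun y : Fin 2 → ℝ => 1 + f₁ (y 0) + f₂ (y 1))
      (deriv f₁ (x 0) • ContinuousLinearMap.proj (R := ℝ) (φ := fun _ : Fin 2 => ℝ) 0 +
        deriv f₂ (x 1) • ContinuousLinearMap.proj (R := ℝ) (φ := fun _ : Fin 2 => ℝ) 1) x :=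
  have hd₁ := (h₁.differentiable two_ne_zero (x 0)).hasDerivAt.comp_hasFDerivAt x
    (hasFDerivAt_apply (𝕜 := ℝ) 0 x)
  have hd₂ := (h₂.differentiable two_ne_zero (x 1)).hasDerivAt.comp_hasFDerivAt x
    (hasFDerivAt_apply (𝕜 := ℝ) 1 x)
  (hd₁.const_add 1).add hd₂

section LiouvilleMetric

variable {f₁ f₂ : ℝ → ℝ} (h₁ : ContDiff ℝ 2 f₁) (h₂ : ContDiff ℝ 2 f₂)
  (p₁ : Function.Periodic f₁ 1) (p₂ : Function.Periodic f₂ 1) (hpos : ∀ x₁ x₂, -1 < f₁ x₁ + f₂ x₂)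

theorem liouvilleMetric_normSq (x v : Fin 2 → ℝ) :
    (liouvilleMetric f₁ f₂ h₁ h₂ p₁ p₂ hpos).normSq x v =
      (1 + f₁ (x 0) + f₂ (x 1)) * (v 0 ^ 2 + v 1 ^ 2) := by
  simp [TorusMetric.normSq, liouvilleMetric, Fin.sum_univ_two, Matrix.diagonal, mul_add, sq,
    mul_assoc]

theorem sum_liouvilleMetric_coeff_mul (x v : Fin 2 → ℝ) (k : Fin 2) :
    ∑ j, (liouvilleMetric f₁ f₂ h₁ h₂ p₁ p₂ hpos).coeff x k j * v j =
      (1 + f₁ (x 0) + f₂ (x 1)) * v k := by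
  fin_cases k <;> simp [liouvilleMetric, Matrix.diagonal]

theorem sum_liouvilleMetric_partialCoeff_mul (x v : Fin 2 → ℝ) (k : Fin 2) :
    ∑ i, ∑ j, (liouvilleMetric f₁ f₂ h₁ h₂ p₁ p₂ hpos).partialCoeff k i j x * v i * v j =
      ![deriv f₁ (x 0), deriv f₂ (x 1)] k * (v 0 ^ 2 + v 1 ^ 2) := by
  have hd := (hasFDerivAt_liouvilleFactor h₁ h₂ x).fderiv
  fin_cases k <;>
    simp [TorusMetric.partialCoeff, liouvilleMetric, Fin.sum_univ_two, Matrix.diagonal, hd, mul_add,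
      sq, mul_assoc]

theorem HamiltonOrbit.isUnitSpeedGeodesic {x p y q : ℝ → ℝ}
    (h : HamiltonOrbit (fun ξ => 1 + f₁ ξ) f₂ x p y q) :
    (liouvilleMetric f₁ f₂ h₁ h₂ p₁ p₂ hpos).IsUnitSpeedGeodesic (fun t => ![x t, y t]) := by
  have hV (ξ η : ℝ) : 0 < 1 + f₁ ξ + f₂ η := by linarith [hpos ξ η]
  have hu : ContDiff ℝ 2 fun ξ => 1 + f₁ ξ := contDiff_const.add h₁
  have hd (t : ℝ) : deriv (fun t => ![x t, y t]) t =
      ![p t / (1 + f₁ (x t) + f₂ (y t)), q t / (1 + f₁ (x t) + f₂ (y t))] := by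
    refine (hasDerivAt_pi.2 fun i => ?_).deriv
    fin_cases i
    exacts [h.hasDerivAt_x t, h.hasDerivAt_y t]
  have hmomentum (k : Fin 2) : (fun s => (1 + f₁ (x s) + f₂ (y s)) *
      ![p s / (1 + f₁ (x s) + f₂ (y s)), q s / (1 + f₁ (x s) + f₂ (y s))] k) =
        ![p, q] k := by
    fin_cases k <;> exact funext fun s => mul_div_cancel₀ _ (hV _ _).ne'
  refine ⟨contDiff_pi.2 fun i => ?_, fun t => ?_, fun t k => ?_⟩
  · fin_cases i
    exacts [h.contDiff_two_x hu h₂ hV,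
      h.swap.contDiff_two_x h₂ hu fun η ξ => add_comm (1 + f₁ ξ) _ ▸ hV ξ η]
  · rw [liouvilleMetric_normSq, hd]
    exact (congrArg _ (h.sq_div_add_sq_div t)).trans (mul_inv_cancel₀ (hV _ _).ne')
  · rw [sum_liouvilleMetric_partialCoeff_mul]
    simp only [sum_liouvilleMetric_coeff_mul, hd, Matrix.cons_val_zero, Matrix.cons_val_one]
    rw [h.sq_div_add_sq_div, hmomentum]
    fin_cases k
    · refine (h.hasDerivAt_p t).deriv.trans ?_
      simp only [deriv_const_add', Fin.zero_eta, Matrix.cons_val_zero]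
      ring
    · refine (h.hasDerivAt_q t).deriv.trans ?_
      simp only [Fin.mk_one, Matrix.cons_val_one, Matrix.cons_val_fin_one]
      ring

theorem hamiltonOrbit_of_isUnitSpeedGeodesic {γ : ℝ → Fin 2 → ℝ}
    (h : (liouvilleMetric f₁ f₂ h₁ h₂ p₁ p₂ hpos).IsUnitSpeedGeodesic γ) :
    HamiltonOrbit (fun ξ => 1 + f₁ ξ) f₂ (fun t => γ t 0)
      (fun t => (1 + f₁ (γ t 0) + f₂ (γ t 1)) * deriv γ t 0) (fun t => γ t 1)
      (fun t => (1 + f₁ (γ t 0) + f₂ (γ t 1)) * deriv γ t 1) := by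
  have hV (t : ℝ) : 0 < 1 + f₁ (γ t 0) + f₂ (γ t 1) := by linarith [hpos (γ t 0) (γ t 1)]
  have hγ (k : Fin 2) (t : ℝ) : HasDerivAt (fun t => γ t k)
      ((1 + f₁ (γ t 0) + f₂ (γ t 1)) * deriv γ t k / (1 + f₁ (γ t 0) + f₂ (γ t 1))) t := by
    rw [mul_div_cancel_left₀ _ (hV t).ne']
    exact hasDerivAt_pi.1 (h.contDiff.differentiable two_ne_zero t).hasDerivAt k
  have hunit (t : ℝ) : (1 + f₁ (γ t 0) + f₂ (γ t 1)) * (deriv γ t 0 ^ 2 + deriv γ t 1 ^ 2) = 1 :=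
    (liouvilleMetric_normSq h₁ h₂ p₁ p₂ hpos _ _).symm.trans (h.unit_speed t)
  have hγ' : ContDiff ℝ 1 (deriv γ) :=
    (contDiff_succ_iff_deriv.1 (one_add_one_eq_two (R := WithTop ℕ∞) ▸ h.contDiff)).2.2
  have hγi := contDiff_pi.1 h.contDiff
  have hfactor : ContDiff ℝ 2 fun t => 1 + f₁ (γ t 0) + f₂ (γ t 1) :=
    (contDiff_const.add (h₁.comp (hγi 0))).add (h₂.comp (hγi 1))
  have hmomentum (k : Fin 2) (t : ℝ) :
      HasDerivAt (fun t => (1 + f₁ (γ t 0) + f₂ (γ t 1)) * deriv γ t k)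
        (![deriv f₁ (γ t 0), deriv f₂ (γ t 1)] k / 2 / (1 + f₁ (γ t 0) + f₂ (γ t 1))) t := by
    have hdiff : DifferentiableAt ℝ (fun t => (1 + f₁ (γ t 0) + f₂ (γ t 1)) * deriv γ t k) t :=
      (hfactor.differentiable two_ne_zero t).mul
        ((contDiff_pi.1 hγ' k).differentiable one_ne_zero t)
    have heq := h.geodesic_eq t k
    rw [sum_liouvilleMetric_partialCoeff_mul, eq_inv_of_mul_eq_one_right (hunit t)] at heq
    simp only [sum_liouvilleMetric_coeff_mul] at heq
    refine hdiff.hasDerivAt.congr_deriv (heq.trans ?_)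
    ring
  refine ⟨hγ 0, fun t => ?_, hγ 1, hmomentum 1, fun t => ?_⟩
  · simpa only [deriv_const_add', Matrix.cons_val_zero] using hmomentum 0 t
  · linear_combination (1 + f₁ (γ t 0) + f₂ (γ t 1)) * hunit t

theorem mem_lengthSpectrum_liouvilleMetric_iff {m n : ℤ} {ℓ : ℝ} :
    ℓ ∈ (liouvilleMetric f₁ f₂ h₁ h₂ p₁ p₂ hpos).lengthSpectrum m n ↔
      0 < ℓ ∧ ∃ x p y q : ℝ → ℝ, HamiltonOrbit (fun ξ => 1 + f₁ ξ) f₂ x p y q ∧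
        (∀ t, x (t + ℓ) = x t + m) ∧ ∀ t, y (t + ℓ) = y t + n := by
  have harc {γ : ℝ → Fin 2 → ℝ}
      (h : (liouvilleMetric f₁ f₂ h₁ h₂ p₁ p₂ hpos).IsUnitSpeedGeodesic γ) (P : ℝ) :
      (liouvilleMetric f₁ f₂ h₁ h₂ p₁ p₂ hpos).arcLength γ P = P := by
    simp [TorusMetric.arcLength, h.unit_speed]
  constructor
  · rintro ⟨γ, P, hP, hγ, hper, rfl⟩
    rw [harc hγ]
    exact ⟨hP, _, _, _, _, hamiltonOrbit_of_isUnitSpeedGeodesic h₁ h₂ p₁ p₂ hpos hγ,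
      fun t => congrFun (hper t) 0, fun t => congrFun (hper t) 1⟩
  · rintro ⟨hℓ, x, p, y, q, h, hx, hy⟩
    have hγ := h.isUnitSpeedGeodesic h₁ h₂ p₁ p₂ hpos
    refine ⟨_, ℓ, hℓ, hγ, fun t => funext fun i => ?_, (harc hγ ℓ).symm⟩
    fin_cases i
    exacts [hx t, hy t]

end LiouvilleMetric

/-! ### Separation of variables -/

/- `θ` is the inverse of `t ↦ ∫₀ᵗ 1 / V`. -/
theorem exists_hasDerivAt_comp_of_pos_of_periodic {V : ℝ → ℝ} {ℓ : ℝ} (hV : Continuous V)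
    (hpos : ∀ t, 0 < V t) (hper : Function.Periodic V ℓ) (hℓ : 0 < ℓ) :
    ∃ (θ : ℝ → ℝ) (Q : ℝ), 0 < Q ∧ θ 0 = 0 ∧ (∀ s, HasDerivAt θ (V (θ s)) s) ∧
      ∀ s, θ (s + Q) = θ s + ℓ := by
  have hVi : Continuous fun t => (V t)⁻¹ := hV.inv₀ fun t => (hpos t).ne'
  let τ : ℝ → ℝ := fun t => ∫ s in (0 : ℝ)..t, (V s)⁻¹
  have hτ (t : ℝ) : HasDerivAt τ (V t)⁻¹ t := hVi.integral_hasStrictDerivAt 0 t |>.hasDerivAt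
  have hτ0 : τ 0 = 0 := intervalIntegral.integral_same
  have hτ_mono : StrictMono τ := strictMono_of_deriv_pos fun t => by
    rw [(hτ t).deriv]
    exact inv_pos.2 (hpos t)
  have hτ_cont : Continuous τ := continuous_iff_continuousAt.2 fun t => (hτ t).continuousAt
  have hτ_add (t : ℝ) : τ (t + ℓ) = τ t + τ ℓ := by
    have hperiod := Function.Periodic.intervalIntegral_add_eq
      (f := fun t => (V t)⁻¹) (fun t => congrArg _ (hper t)) t 0
    rw [zero_add] at hperiod
    simp only [τ, ← hperiod, intervalIntegral.integral_add_adjacent_intervals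
      (hVi.intervalIntegrable _ _) (hVi.intervalIntegrable _ _)]
  have hQ : 0 < τ ℓ := hτ0 ▸ hτ_mono hℓ
  let e : ℝ ≃o ℝ := hτ_mono.orderIsoOfSurjective τ
    (surjective_of_continuous_of_map_add_eq_add hτ_cont hQ.ne' hτ_add)
  have hτe (s : ℝ) : τ (e.symm s) = s := e.apply_symm_apply s
  have heτ (t : ℝ) : e.symm (τ t) = t := e.symm_apply_apply t
  refine ⟨e.symm, τ ℓ, hQ, ?_, fun s => ?_, fun s => ?_⟩
  · rw [← hτ0, heτ, hτ0]
  · simpa only [inv_inv] using (hτ (e.symm s)).of_local_left_inverse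
      e.symm.continuous.continuousAt (inv_ne_zero (hpos _).ne') (Eventually.of_forall hτe)
  · rw [← heτ (e.symm s + ℓ), hτ_add, hτe]

theorem HamiltonOrbit.mem_separatedSpectrum {u w x p y q : ℝ → ℝ} {m n : ℤ} {ℓ : ℝ}
    (h : HamiltonOrbit u w x p y q) (hu : Continuous u) (hw : Continuous w)
    (hpos : ∀ ξ η, 0 < u ξ + w η) (pu : Function.Periodic u 1) (pw : Function.Periodic w 1)
    (hℓ : 0 < ℓ) (hm : ∀ t, x (t + ℓ) = x t + m) (hn : ∀ t, y (t + ℓ) = y t + n) :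
    ℓ ∈ separatedSpectrum u w m n := by
  have hV := h.continuous_factor hu hw
  have hper : Function.Periodic (fun t => u (x t) + w (y t)) ℓ := fun t => by
    have hum : u (x t + m) = u (x t) := by simpa using pu.int_mul m (x t)
    have hwn : w (y t + n) = w (y t) := by simpa using pw.int_mul n (y t)
    simp only [hm, hn, hum, hwn]
  obtain ⟨θ, Q, hQ, hθ0, hθ, hθQ⟩ :=
    exists_hasDerivAt_comp_of_pos_of_periodic hV (fun t => hpos _ _) hper hℓ
  have hcomp {f : ℝ → ℝ} {c : ℝ → ℝ} (hf : ∀ t, HasDerivAt f (c t / (u (x t) + w (y t))) t)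
      (s : ℝ) : HasDerivAt (f ∘ θ) (c (θ s)) s :=
    ((hf (θ s)).comp s (hθ s)).congr_deriv (div_mul_cancel₀ _ (hpos _ _).ne')
  have hθ_cont : Continuous θ := continuous_iff_continuousAt.2 fun s => (hθ s).continuousAt
  refine ⟨x ∘ θ, p ∘ θ, y ∘ θ, q ∘ θ, Q, hQ, ⟨hcomp h.hasDerivAt_x, hcomp h.hasDerivAt_p⟩,
    ⟨hcomp h.hasDerivAt_y, hcomp h.hasDerivAt_q⟩, fun s => h.energy _, fun s => ?_, fun s => ?_, ?_⟩
  · simp only [Function.comp, hθQ, hm]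
  · simp only [Function.comp, hθQ, hn]
  · simp only [Function.comp, h.energy]
    rw [intervalIntegral.integral_eq_sub_of_hasDerivAt (fun s _ => hθ s)
      ((hV.comp hθ_cont).intervalIntegrable 0 Q), hθ0, ← zero_add Q, hθQ, hθ0]
    ring

/-! ### The topology of `C^r(ℝ/ℤ)` -/

theorem iteratedDeriv_ofReal {F : ℂ → ℂ} {f : ℝ → ℝ} (hF : ∀ x : ℝ, AnalyticAt ℂ F x)
    (hf : ∀ x : ℝ, F x = f x) (k : ℕ) (x : ℝ) : iteratedDeriv k F x = iteratedDeriv k f x := by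
  induction k generalizing x with
  | zero => simpa using hf x
  | succ k ih =>
    have hd : HasDerivAt (iteratedDeriv k F) (iteratedDeriv (k + 1) F x) (x : ℂ) := by
      rw [iteratedDeriv_succ, hasDerivAt_deriv_iff, iteratedDeriv_eq_iterate]
      exact ((hF x).iterated_deriv k).differentiableAt
    have hre : HasDerivAt (iteratedDeriv k f) (iteratedDeriv (k + 1) F x).re x := by
      simpa only [ih, Complex.ofReal_re] using hd.real_of_complex
    have him := hd.comp_ofReal.unique (by simpa only [ih] using hre.ofReal_comp)
    rw [him, ← hre.deriv, ← iteratedDeriv_succ]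

/- Cauchy's estimates on discs of radius `ρ / 2`. -/
theorem abs_iteratedDeriv_le_of_strip {ρ C : ℝ} (hρ : 0 < ρ) {f : ℝ → ℝ} {F : ℂ → ℂ}
    (hF : DifferentiableOn ℂ F {z | |z.im| < ρ}) (hf : ∀ x : ℝ, F x = f x)
    (hC : ∀ z : ℂ, |z.im| < ρ → ‖F z‖ ≤ C) (k : ℕ) (x : ℝ) :
    |iteratedDeriv k f x| ≤ k.factorial * C / (ρ / 2) ^ k := by
  have hopen : IsOpen {z : ℂ | |z.im| < ρ} :=
    isOpen_lt (continuous_abs.comp Complex.continuous_im) continuous_const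
  have hball : Metric.closedBall (x : ℂ) (ρ / 2) ⊆ {z : ℂ | |z.im| < ρ} := fun z hz => by
    have him : |z.im| ≤ ρ / 2 := by
      simpa using (Complex.abs_im_le_norm (z - x)).trans (mem_closedBall_iff_norm.1 hz)
    exact him.trans_lt (half_lt_self hρ)
  have hreal (x : ℝ) : AnalyticAt ℂ F x :=
    hF.analyticAt (hopen.mem_nhds (by simpa using hρ))
  have hcauchy := Complex.norm_iteratedDeriv_le_of_forall_mem_sphere_norm_le (c := (x : ℂ)) k
    (half_pos hρ) ((hF.mono hball).diffContOnCl_ball subset_rfl)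
    fun z hz => hC z (hball (Metric.sphere_subset_closedBall hz))
  rwa [iteratedDeriv_ofReal hreal hf, Complex.norm_real, Real.norm_eq_abs] at hcauchy

theorem periodic_iteratedDeriv {f : ℝ → ℝ} {c : ℝ} (hp : Function.Periodic f c) (k : ℕ) :
    Function.Periodic (iteratedDeriv k f) c := by
  induction k with
  | zero => simpa using hp
  | succ k ih =>
    rw [iteratedDeriv_succ]
    exact periodic_deriv ih

namespace CircleFun

variable {r : WithTop ℕ∞}

theorem exists_abs_iteratedDeriv_le (f : CircleFun r) {k : ℕ} (hk : (k : WithTop ℕ∞) ≤ r) :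
    ∃ C, ∀ x, |iteratedDeriv k f x| ≤ C :=
  exists_abs_le_of_continuous_of_periodic (f.2.1.continuous_iteratedDeriv k hk)
    (periodic_iteratedDeriv f.2.2 k) one_ne_zero

theorem iteratedDeriv_add_smul (f h : CircleFun r) {k : ℕ} (hk : (k : WithTop ℕ∞) ≤ r)
    (s x : ℝ) :
    iteratedDeriv k (f + s • h : CircleFun r) x =
      iteratedDeriv k f x + s * iteratedDeriv k h x := by
  have hf : ContDiffAt ℝ k (f : ℝ → ℝ) x := (f.2.1.of_le hk).contDiffAt
  have hh : ContDiffAt ℝ k (s • (h : ℝ → ℝ)) x := ((h.2.1.of_le hk).const_smul s).contDiffAt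
  exact (iteratedDeriv_add hf hh).trans
    (congrArg _ (iteratedDeriv_const_smul_field s (h : ℝ → ℝ)))

/-- The `k`-th derivative of analytic functions on the circle, as a linear map to the normed space
of bounded continuous functions; its continuity compares the inductive limit topology with uniform
convergence of derivatives. -/
def iteratedDerivBCF (k : ℕ) : CircleFun ω →ₗ[ℝ] BoundedContinuousFunction ℝ ℝ where
  toFun f := BoundedContinuousFunction.ofNormedAddCommGroup (iteratedDeriv k f)
    (f.2.1.continuous_iteratedDeriv k le_top) _ (f.exists_abs_iteratedDeriv_le le_top).choose_spec
  map_add' f g := by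
    ext x
    have hadd := iteratedDeriv_add_smul f g (k := k) le_top 1 x
    rwa [one_smul, one_mul] at hadd
  map_smul' c f := by
    ext x
    exact iteratedDeriv_const_smul_field c (f : ℝ → ℝ)

theorem analyticTopology_le_induced (k : ℕ) :
    analyticTopology ≤ TopologicalSpace.induced (iteratedDerivBCF k) inferInstance := by
  refine sInf_le ⟨topologicalAddGroup_induced _, continuousSMul_induced _,
    LocallyConvexSpace.induced _, fun ρ hρ U hU => ?_⟩
  rw [nhds_induced, map_zero] at hU
  obtain ⟨W, hW, hWU⟩ := mem_comap.1 hU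
  obtain ⟨ε, hε, hεW⟩ := Metric.nhds_basis_closedBall.mem_iff.1 hW
  refine ⟨ε * (ρ / 2) ^ k / k.factorial, by positivity, fun f ⟨F, hF, hf, hC⟩ => hWU (hεW ?_)⟩
  rw [mem_closedBall_zero_iff, BoundedContinuousFunction.norm_le hε.le]
  refine fun x => (abs_iteratedDeriv_le_of_strip hρ hF hf hC k x).trans_eq ?_
  field_simp

theorem tendstoUniformly_iteratedDeriv (f : CircleFun r) {k : ℕ} (hk : (k : WithTop ℕ∞) ≤ r) :
    TendstoUniformly (fun g : CircleFun r => iteratedDeriv k g) (iteratedDeriv k f) (𝓝 f) := by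
  induction r using WithTop.recTopCoe with
  | top =>
    have hcont : @Continuous _ _ analyticTopology _ (iteratedDerivBCF k) :=
      continuous_iff_le_induced.2 (analyticTopology_le_induced k)
    exact BoundedContinuousFunction.tendsto_iff_tendstoUniformly.1 (hcont.tendsto f)
  | coe r =>
    have hcont : @Continuous _ _ (crTopology r) _
        (fun f : CircleFun r => UniformFun.ofFun (iteratedDeriv k f)) :=
      continuous_iff_le_induced.2 (iInf₂_le k hk)
    exact UniformFun.tendsto_iff_tendstoUniformly.1 (hcont.tendsto f)

theorem continuous_add_smul (f h : CircleFun r) : Continuous fun s : ℝ => f + s • h := by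
  induction r using WithTop.recTopCoe with
  | top =>
    refine continuous_sInf_rng.2 fun t ht => ?_
    let := t
    have := ht.1
    have := ht.2.1
    exact continuous_const.add (continuous_id.smul continuous_const)
  | coe r =>
    refine continuous_iInf_rng.2 fun k => continuous_iInf_rng.2 fun hk =>
      continuous_induced_rng.2 (continuous_iff_continuousAt.2 fun s₀ => ?_)
    refine UniformFun.tendsto_iff_tendstoUniformly.2 (Metric.tendstoUniformly_iff.2 fun ε hε => ?_)
    obtain ⟨C, hC⟩ := h.exists_abs_iteratedDeriv_le hk
    have hC0 : 0 ≤ C := (abs_nonneg _).trans (hC 0)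
    filter_upwards [Metric.ball_mem_nhds s₀ (show 0 < ε / (C + 1) by positivity)] with s hs x
    rw [Metric.mem_ball, dist_comm, Real.dist_eq, lt_div_iff₀ (by positivity)] at hs
    calc |iteratedDeriv k (f + s₀ • h : CircleFun r) x -
          iteratedDeriv k (f + s • h : CircleFun r) x|
        = |s₀ - s| * |iteratedDeriv k h x| := by
          rw [iteratedDeriv_add_smul f h hk, iteratedDeriv_add_smul f h hk, add_sub_add_left_eq_sub,
            ← sub_mul, abs_mul]
      _ ≤ |s₀ - s| * (C + 1) := by gcongr; linarith [hC x]
      _ < ε := hs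

end CircleFun

/-! ### Limits of geodesics -/

theorem hasDerivAt_of_abs_taylor_le {f : ℝ → ℝ} {a C s : ℝ}
    (h : ∀ t, |f t - f s - a * (t - s)| ≤ C * (t - s) ^ 2) : HasDerivAt f a s := by
  rw [hasDerivAt_iff_isLittleO]
  have hO : (fun t => f t - f s - (t - s) • a) =O[𝓝 s] fun t => (t - s) ^ 2 :=
    Asymptotics.IsBigO.of_bound C (.of_forall fun t => by
      simpa [mul_comm] using h t)
  refine hO.trans_isLittleO ?_
  simpa only [Real.norm_eq_abs, sq_abs] using Asymptotics.isLittleO_pow_sub_sub s one_lt_two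

theorem hasDerivAt_of_tendsto_of_abs_taylor_le {ι : Type*} {l : Filter ι} [l.NeBot]
    {f g : ι → ℝ → ℝ} {f₀ g₀ : ℝ → ℝ} {C : ℝ}
    (hf : ∀ t, Tendsto (fun i => f i t) l (𝓝 (f₀ t)))
    (hg : ∀ t, Tendsto (fun i => g i t) l (𝓝 (g₀ t)))
    (h : ∀ᶠ i in l, ∀ s t, |f i t - f i s - g i s * (t - s)| ≤ C * (t - s) ^ 2) (s : ℝ) :
    HasDerivAt f₀ (g₀ s) s :=
  hasDerivAt_of_abs_taylor_le fun t =>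
    le_of_tendsto ((((hf t).sub (hf s)).sub ((hg s).mul_const (t - s))).abs)
      (h.mono fun _ hi => hi s t)

theorem tendsto_apply_of_eventually_lipschitz {ι : Type*} {l : Filter ι} {f : ι → ℝ → ℝ}
    {f₀ : ℝ → ℝ} {S : ℝ} (hf : ∀ t, Tendsto (fun i => f i t) l (𝓝 (f₀ t)))
    (hS : ∀ᶠ i in l, ∀ s t, |f i t - f i s| ≤ S * |t - s|) {a : ι → ℝ} {a₀ : ℝ}
    (ha : Tendsto a l (𝓝 a₀)) : Tendsto (fun i => f i (a i)) l (𝓝 (f₀ a₀)) := by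
  have hdiff : Tendsto (fun i => f i (a i) - f i a₀) l (𝓝 0) := by
    refine squeeze_zero_norm' (a := fun i => S * |a i - a₀|) (hS.mono fun i hi => hi _ _) ?_
    simpa using (ha.sub_const a₀).abs.const_mul S
  simpa using hdiff.add (hf a₀)

theorem exists_tendsto_of_eventually_abs_le {ι : Type*} (F : Ultrafilter ι) {f : ι → ℝ} {C : ℝ}
    (h : ∀ᶠ i in (F : Filter ι), |f i| ≤ C) : ∃ a, Tendsto f F (𝓝 a) := by
  obtain ⟨a, -, ha⟩ := (isCompact_Icc (a := -C) (b := C)).ultrafilter_le_nhds (F.map f)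
    (le_principal_iff.2 (h.mono fun _ hi => abs_le.1 hi))
  exact ⟨a, ha⟩

theorem abs_div_sub_div_le {a b V W A L M δ d : ℝ} (hδ : 0 < δ) (hA : |a| ≤ A) (hV : δ ≤ V)
    (hW : δ ≤ W) (hab : |a - b| ≤ L * d) (hVW : |V - W| ≤ M * d) :
    |a / V - b / W| ≤ (L / δ + A * M / δ ^ 2) * d := by
  have hV₀ : 0 < V := hδ.trans_le hV
  have hW₀ : 0 < W := hδ.trans_le hW
  have hA₀ : 0 ≤ A := (abs_nonneg _).trans hA
  have hLd : 0 ≤ L * d := (abs_nonneg _).trans hab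
  have hMd : 0 ≤ M * d := (abs_nonneg _).trans hVW
  calc |a / V - b / W| = |(a - b) / W - a * (V - W) / (V * W)| := by
        congr 1
        field_simp
        ring
    _ ≤ |a - b| / W + |a| * |V - W| / (V * W) := by
        refine (abs_sub _ _).trans_eq ?_
        rw [abs_div, abs_div, abs_mul, abs_of_pos hW₀, abs_of_pos (mul_pos hV₀ hW₀)]
    _ ≤ L * d / δ + A * (M * d) / (δ * δ) := by gcongr
    _ = (L / δ + A * M / δ ^ 2) * d := by ring

namespace HamiltonOrbit

variable {u w x p y q : ℝ → ℝ} {K δ : ℝ}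

theorem add_int (h : HamiltonOrbit u w x p y q) (pu : Function.Periodic u 1)
    (pw : Function.Periodic w 1) (a b : ℤ) :
    HamiltonOrbit u w (fun t => x t + a) p (fun t => y t + b) q := by
  have hu (ξ : ℝ) : u (ξ + a) = u ξ := by simpa using pu.int_mul a ξ
  have hw (η : ℝ) : w (η + b) = w η := by simpa using pw.int_mul b η
  have hu' (ξ : ℝ) : deriv u (ξ + a) = deriv u ξ := by
    simpa using (periodic_deriv pu).int_mul a ξ
  have hw' (η : ℝ) : deriv w (η + b) = deriv w η := by
    simpa using (periodic_deriv pw).int_mul b η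
  constructor <;> intro t <;> simp only [hu, hw, hu', hw']
  exacts [(h.hasDerivAt_x t).add_const _, h.hasDerivAt_p t, (h.hasDerivAt_y t).add_const _,
    h.hasDerivAt_q t, h.energy t]

theorem abs_p_le (h : HamiltonOrbit u w x p y q) (hu : C2Bound u K) (hw : C2Bound w K) (t : ℝ) :
    |p t| ≤ 2 * K + 1 := by
  have hux := (abs_le.1 (hu.abs_le (x t))).2
  have hwy := (abs_le.1 (hw.abs_le (y t))).2
  have hK := hu.nonneg
  refine abs_le_of_sq_le_sq ?_ (by positivity)
  nlinarith [h.energy t, sq_nonneg (q t)]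

theorem abs_x_sub_le (h : HamiltonOrbit u w x p y q) (hu : C2Bound u K) (hw : C2Bound w K)
    (hδ : 0 < δ) (hV : ∀ ξ η, δ ≤ u ξ + w η) (s t : ℝ) :
    |x t - x s| ≤ (2 * K + 1) / δ * |t - s| := by
  refine abs_sub_le_of_abs_hasDerivAt_le h.hasDerivAt_x (fun t => ?_) s t
  have hK := hu.nonneg
  rw [abs_div, abs_of_pos (hδ.trans_le (hV _ _))]
  exact div_le_div₀ (by positivity) (h.abs_p_le hu hw t) hδ (hV _ _)

theorem abs_factor_sub_le (h : HamiltonOrbit u w x p y q) (hu : C2Bound u K) (hw : C2Bound w K)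
    (hδ : 0 < δ) (hV : ∀ ξ η, δ ≤ u ξ + w η) (s t : ℝ) :
    |u (x t) + w (y t) - (u (x s) + w (y s))| ≤ 2 * K * ((2 * K + 1) / δ) * |t - s| := by
  have hx := h.abs_x_sub_le hu hw hδ hV s t
  have hy := h.swap.abs_x_sub_le hw hu hδ (fun η ξ => (hV ξ η).trans_eq (add_comm _ _)) s t
  have hK := hu.nonneg
  calc |u (x t) + w (y t) - (u (x s) + w (y s))|
      ≤ |u (x t) - u (x s)| + |w (y t) - w (y s)| := by
        rw [add_sub_add_comm]
        exact abs_add_le _ _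
    _ ≤ K * |x t - x s| + K * |y t - y s| := add_le_add (hu.abs_sub_le _ _) (hw.abs_sub_le _ _)
    _ ≤ K * ((2 * K + 1) / δ * |t - s|) + K * ((2 * K + 1) / δ * |t - s|) := by gcongr
    _ = 2 * K * ((2 * K + 1) / δ) * |t - s| := by ring

theorem abs_p_sub_le (h : HamiltonOrbit u w x p y q) (hu : C2Bound u K) (hδ : 0 < δ)
    (hV : ∀ ξ η, δ ≤ u ξ + w η) (s t : ℝ) : |p t - p s| ≤ K / 2 / δ * |t - s| := by
  refine abs_sub_le_of_abs_hasDerivAt_le h.hasDerivAt_p (fun t => ?_) s t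
  have hK := hu.nonneg
  rw [abs_div, abs_div, abs_two, abs_of_pos (hδ.trans_le (hV _ _))]
  have hu' := hu.abs_deriv_le (x t)
  exact div_le_div₀ (by positivity) (by gcongr) hδ (hV _ _)

theorem exists_taylor_bound_x (K : ℝ) (hδ : 0 < δ) : ∃ C, ∀ {u w x p y q : ℝ → ℝ},
    HamiltonOrbit u w x p y q → C2Bound u K → C2Bound w K → (∀ ξ η, δ ≤ u ξ + w η) →
    ∀ s t, |x t - x s - p s / (u (x s) + w (y s)) * (t - s)| ≤ C * (t - s) ^ 2 :=
  ⟨_, fun h hu hw hV => abs_taylor_le_of_lipschitz h.hasDerivAt_x fun s t =>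
    abs_div_sub_div_le hδ (h.abs_p_le hu hw t) (hV _ _) (hV _ _) (h.abs_p_sub_le hu hδ hV s t)
      (h.abs_factor_sub_le hu hw hδ hV s t)⟩

theorem exists_taylor_bound_p (K : ℝ) (hδ : 0 < δ) : ∃ C, ∀ {u w x p y q : ℝ → ℝ},
    HamiltonOrbit u w x p y q → C2Bound u K → C2Bound w K → (∀ ξ η, δ ≤ u ξ + w η) →
    ∀ s t, |p t - p s - deriv u (x s) / 2 / (u (x s) + w (y s)) * (t - s)| ≤ C * (t - s) ^ 2 := by
  refine ⟨_, fun {u w x p y q} h hu hw hV => abs_taylor_le_of_lipschitz h.hasDerivAt_p fun s t =>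
    abs_div_sub_div_le (A := K / 2) (L := K * ((2 * K + 1) / δ) / 2) hδ ?_ (hV _ _) (hV _ _) ?_
      (h.abs_factor_sub_le hu hw hδ hV s t)⟩
  · rw [abs_div, abs_two]
    exact div_le_div_of_nonneg_right (hu.abs_deriv_le _) two_pos.le
  · have hK := hu.nonneg
    calc |deriv u (x t) / 2 - deriv u (x s) / 2| = |deriv u (x t) - deriv u (x s)| / 2 := by
          rw [← sub_div, abs_div, abs_two]
      _ ≤ K * ((2 * K + 1) / δ * |t - s|) / 2 := by
          have hx := h.abs_x_sub_le hu hw hδ hV s t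
          have hu' := hu.abs_deriv_sub_le (x s) (x t)
          grw [hu', hx]
      _ = K * ((2 * K + 1) / δ) / 2 * |t - s| := by ring

end HamiltonOrbit

/-- `C¹` convergence of `U` to `u` along `l` with an eventual common `C²` bound: the mode of
convergence of potentials under which geodesics converge. -/
structure TendstoC1 {ι : Type*} (l : Filter ι) (U : ι → ℝ → ℝ) (u : ℝ → ℝ) (K : ℝ) : Prop where
  tendstoUniformly : TendstoUniformly U u l
  tendstoUniformly_deriv : TendstoUniformly (fun i => deriv (U i)) (deriv u) l
  eventually_c2Bound : ∀ᶠ i in l, C2Bound (U i) K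

namespace TendstoC1

variable {ι : Type*} {l : Filter ι} [l.NeBot] {U : ι → ℝ → ℝ} {u : ℝ → ℝ} {K : ℝ} {ξ : ι → ℝ}
  {ξ₀ : ℝ}

theorem tendsto_apply (h : TendstoC1 l U u K) (hξ : Tendsto ξ l (𝓝 ξ₀)) :
    Tendsto (fun i => U i (ξ i)) l (𝓝 (u ξ₀)) :=
  have hu : Continuous u :=
    h.tendstoUniformly.continuous (h.eventually_c2Bound.mono fun _ hi => hi.continuous).frequently
  h.tendstoUniformly.tendsto_comp hu.continuousAt hξ

theorem tendsto_deriv_apply (h : TendstoC1 l U u K) (hξ : Tendsto ξ l (𝓝 ξ₀)) :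
    Tendsto (fun i => deriv (U i) (ξ i)) l (𝓝 (deriv u ξ₀)) :=
  have hu' : Continuous (deriv u) := h.tendstoUniformly_deriv.continuous
    (h.eventually_c2Bound.mono fun _ hi => hi.continuous_deriv).frequently
  h.tendstoUniformly_deriv.tendsto_comp hu'.continuousAt hξ

end TendstoC1

section Limits

variable {ι : Type*} {U W X P Y Q : ι → ℝ → ℝ} {u w x p y q : ℝ → ℝ} {K δ : ℝ}

theorem hamiltonOrbit_of_tendsto {l : Filter ι} [l.NeBot]
    (h : ∀ᶠ i in l, HamiltonOrbit (U i) (W i) (X i) (P i) (Y i) (Q i))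
    (hU : TendstoC1 l U u K) (hW : TendstoC1 l W w K) (hδ : 0 < δ)
    (hV : ∀ᶠ i in l, ∀ ξ η, δ ≤ U i ξ + W i η)
    (hX : ∀ t, Tendsto (fun i => X i t) l (𝓝 (x t)))
    (hP : ∀ t, Tendsto (fun i => P i t) l (𝓝 (p t)))
    (hY : ∀ t, Tendsto (fun i => Y i t) l (𝓝 (y t)))
    (hQ : ∀ t, Tendsto (fun i => Q i t) l (𝓝 (q t))) :
    HamiltonOrbit u w x p y q := by
  have hfactor (t : ℝ) : Tendsto (fun i => U i (X i t) + W i (Y i t)) l (𝓝 (u (x t) + w (y t))) :=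
    (hU.tendsto_apply (hX t)).add (hW.tendsto_apply (hY t))
  have hfactor₀ (t : ℝ) : u (x t) + w (y t) ≠ 0 :=
    (hδ.trans_le (ge_of_tendsto (hfactor t) (hV.mono fun i hi => hi _ _))).ne'
  have hdata := h.and (hU.eventually_c2Bound.and (hW.eventually_c2Bound.and hV))
  obtain ⟨C, hC⟩ := HamiltonOrbit.exists_taylor_bound_x K hδ
  obtain ⟨C', hC'⟩ := HamiltonOrbit.exists_taylor_bound_p K hδ
  constructor
  · refine hasDerivAt_of_tendsto_of_abs_taylor_le (C := C)
      (g₀ := fun t => p t / (u (x t) + w (y t))) hX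
      (fun t => (hP t).div (hfactor t) (hfactor₀ t)) ?_
    exact hdata.mono fun i ⟨ho, hu, hw, hV⟩ => hC ho hu hw hV
  · refine hasDerivAt_of_tendsto_of_abs_taylor_le (C := C')
      (g₀ := fun t => deriv u (x t) / 2 / (u (x t) + w (y t))) hP
      (fun t => ((hU.tendsto_deriv_apply (hX t)).div_const 2).div (hfactor t) (hfactor₀ t)) ?_
    exact hdata.mono fun i ⟨ho, hu, hw, hV⟩ => hC' ho hu hw hV
  · refine hasDerivAt_of_tendsto_of_abs_taylor_le (C := C)
      (g₀ := fun t => q t / (u (x t) + w (y t))) hY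
      (fun t => (hQ t).div (hfactor t) (hfactor₀ t)) ?_
    refine hdata.mono fun i ⟨ho, hu, hw, hV⟩ => ?_
    simpa only [add_comm (W i _), Pi.div_apply] using
      hC ho.swap hw hu fun η ξ => (hV ξ η).trans_eq (add_comm _ _)
  · refine hasDerivAt_of_tendsto_of_abs_taylor_le (C := C')
      (g₀ := fun t => deriv w (y t) / 2 / (u (x t) + w (y t))) hQ
      (fun t => ((hW.tendsto_deriv_apply (hY t)).div_const 2).div (hfactor t) (hfactor₀ t)) ?_
    refine hdata.mono fun i ⟨ho, hu, hw, hV⟩ => ?_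
    simpa only [add_comm (W i _), Pi.div_apply] using
      hC' ho.swap hw hu fun η ξ => (hV ξ η).trans_eq (add_comm _ _)
  · exact fun t => tendsto_nhds_unique (((hP t).pow 2).add ((hQ t).pow 2))
      ((hfactor t).congr' (h.mono fun i hi => (hi.energy t).symm))

theorem HamiltonOrbit.exists_tendsto_x_p {F : Ultrafilter ι}
    (h : ∀ᶠ i in F, HamiltonOrbit (U i) (W i) (X i) (P i) (Y i) (Q i))
    (hU : ∀ᶠ i in F, C2Bound (U i) K) (hW : ∀ᶠ i in F, C2Bound (W i) K)
    (hδ : 0 < δ) (hV : ∀ᶠ i in F, ∀ ξ η, δ ≤ U i ξ + W i η) (hX : ∀ᶠ i in F, |X i 0| ≤ 1) :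
    ∃ x p : ℝ → ℝ, (∀ t, Tendsto (fun i => X i t) F (𝓝 (x t))) ∧
      ∀ t, Tendsto (fun i => P i t) F (𝓝 (p t)) := by
  have hx (t : ℝ) : ∃ a, Tendsto (fun i => X i t) F (𝓝 a) := by
    refine exists_tendsto_of_eventually_abs_le F (C := 1 + (2 * K + 1) / δ * |t - 0|) ?_
    filter_upwards [h, hU, hW, hV, hX] with i ho hu hw hV hX
    have hsub := (abs_sub_abs_le_abs_sub _ _).trans (ho.abs_x_sub_le hu hw hδ hV 0 t)
    linarith
  have hp (t : ℝ) : ∃ a, Tendsto (fun i => P i t) F (𝓝 a) := by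
    refine exists_tendsto_of_eventually_abs_le F (C := 2 * K + 1) ?_
    filter_upwards [h, hU, hW] with i ho hu hw using ho.abs_p_le hu hw t
  choose x hx using hx
  choose p hp using hp
  exact ⟨x, p, hx, hp⟩

theorem HamiltonOrbit.map_add_of_tendsto {l : Filter ι} [l.NeBot]
    (h : ∀ᶠ i in l, HamiltonOrbit (U i) (W i) (X i) (P i) (Y i) (Q i))
    (hU : ∀ᶠ i in l, C2Bound (U i) K) (hW : ∀ᶠ i in l, C2Bound (W i) K)
    (hδ : 0 < δ) (hV : ∀ᶠ i in l, ∀ ξ η, δ ≤ U i ξ + W i η)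
    (hX : ∀ t, Tendsto (fun i => X i t) l (𝓝 (x t))) {ℓ : ι → ℝ} {ℓ₀ a : ℝ}
    (hℓ : Tendsto ℓ l (𝓝 ℓ₀)) (hXℓ : ∀ᶠ i in l, ∀ t, X i (t + ℓ i) = X i t + a) (t : ℝ) :
    x (t + ℓ₀) = x t + a := by
  have hlip : ∀ᶠ i in l, ∀ s t, |X i t - X i s| ≤ (2 * K + 1) / δ * |t - s| := by
    filter_upwards [h, hU, hW, hV] with i ho hu hw hV using ho.abs_x_sub_le hu hw hδ hV
  exact tendsto_nhds_unique (tendsto_apply_of_eventually_lipschitz hX hlip (hℓ.const_add t))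
    (((hX t).add_const a).congr' (hXℓ.mono fun i hi => (hi t).symm))

theorem HamiltonOrbit.exists_abs_zero_le_one {m n : ℤ} {ℓ : ℝ} (h : HamiltonOrbit u w x p y q)
    (pu : Function.Periodic u 1) (pw : Function.Periodic w 1) (hx : ∀ t, x (t + ℓ) = x t + m)
    (hy : ∀ t, y (t + ℓ) = y t + n) :
    ∃ x p y q, HamiltonOrbit u w x p y q ∧ (|x 0| ≤ 1 ∧ |y 0| ≤ 1) ∧
      (∀ t, x (t + ℓ) = x t + m) ∧ ∀ t, y (t + ℓ) = y t + n := by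
  have hfract (a : ℝ) : |a + (-⌊a⌋ : ℤ)| ≤ 1 := by
    rw [Int.cast_neg, ← sub_eq_add_neg, Int.self_sub_floor, Int.abs_fract]
    exact (Int.fract_lt_one a).le
  exact ⟨_, _, _, _, h.add_int pu pw (-⌊x 0⌋) (-⌊y 0⌋), ⟨hfract _, hfract _⟩,
    fun t => by rw [hx, add_right_comm], fun t => by rw [hy, add_right_comm]⟩

theorem exists_hamiltonOrbit_of_tendsto {F : Ultrafilter ι} (hU : TendstoC1 F U u K)
    (hW : TendstoC1 F W w K) (hδ : 0 < δ) (hV : ∀ᶠ i in F, ∀ ξ η, δ ≤ U i ξ + W i η)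
    (pU : ∀ i, Function.Periodic (U i) 1) (pW : ∀ i, Function.Periodic (W i) 1) {ℓ : ι → ℝ}
    {ℓ₀ : ℝ} (hℓ : Tendsto ℓ F (𝓝 ℓ₀)) {m n : ℤ}
    (h : ∀ᶠ i in F, ∃ x p y q, HamiltonOrbit (U i) (W i) x p y q ∧
      (∀ t, x (t + ℓ i) = x t + m) ∧ ∀ t, y (t + ℓ i) = y t + n) :
    ∃ x p y q, HamiltonOrbit u w x p y q ∧ (∀ t, x (t + ℓ₀) = x t + m) ∧
      ∀ t, y (t + ℓ₀) = y t + n := by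
  have hnorm : ∀ᶠ i in F, ∃ x p y q, HamiltonOrbit (U i) (W i) x p y q ∧ (|x 0| ≤ 1 ∧ |y 0| ≤ 1) ∧
      (∀ t, x (t + ℓ i) = x t + m) ∧ ∀ t, y (t + ℓ i) = y t + n :=
    h.mono fun i ⟨x, p, y, q, ho, hx, hy⟩ => ho.exists_abs_zero_le_one (pU i) (pW i) hx hy
  obtain ⟨X, hnorm⟩ := hnorm.choice
  obtain ⟨P, hnorm⟩ := hnorm.choice
  obtain ⟨Y, hnorm⟩ := hnorm.choice
  obtain ⟨Q, hnorm⟩ := hnorm.choice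
  simp only [eventually_and] at hnorm
  obtain ⟨ho, ⟨hX₀, hY₀⟩, hXℓ, hYℓ⟩ := hnorm
  have ho' : ∀ᶠ i in F, HamiltonOrbit (W i) (U i) (Y i) (Q i) (X i) (P i) :=
    ho.mono fun i hi => hi.swap
  have hV' : ∀ᶠ i in F, ∀ η ξ, δ ≤ W i η + U i ξ :=
    hV.mono fun i hi η ξ => (hi ξ η).trans_eq (add_comm _ _)
  have bU := hU.eventually_c2Bound
  have bW := hW.eventually_c2Bound
  obtain ⟨x, p, hx, hp⟩ := HamiltonOrbit.exists_tendsto_x_p ho bU bW hδ hV hX₀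
  obtain ⟨y, q, hy, hq⟩ := HamiltonOrbit.exists_tendsto_x_p ho' bW bU hδ hV' hY₀
  exact ⟨x, p, y, q, hamiltonOrbit_of_tendsto ho hU hW hδ hV hx hp hy hq,
    HamiltonOrbit.map_add_of_tendsto ho bU bW hδ hV hx hℓ hXℓ,
    HamiltonOrbit.map_add_of_tendsto ho' bW bU hδ hV' hy hℓ hYℓ⟩

end Limits

/-! ### Coincidences of lengths -/

theorem dense_compl_iUnion_of_locallyFinite {X ι : Type*} [TopologicalSpace X] {C : ι → Set X}
    (hf : LocallyFinite C) (hc : ∀ i, IsClosed (C i)) (hd : ∀ i, Dense (C i)ᶜ) :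
    Dense (⋃ i, C i)ᶜ := by
  refine fun p => mem_closure_iff_nhds.2 fun O hO => ?_
  obtain ⟨t, ht, hfin⟩ := hf p
  have hdense : Dense (⋂₀ ((fun i => (C i)ᶜ) '' {i | (C i ∩ t).Nonempty})) :=
    (hfin.image _).dense_sInter (forall_mem_image.2 fun i _ => (hc i).isOpen_compl)
      (forall_mem_image.2 fun i _ => hd i)
  obtain ⟨q, hq, hqO, hqt⟩ := hdense.inter_nhds_nonempty (inter_mem hO ht)
  refine ⟨q, hqO, fun hqC => ?_⟩
  obtain ⟨i, hi⟩ := mem_iUnion.1 hqC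
  exact hq _ (mem_image_of_mem _ ⟨q, hi, hqt⟩) hi

theorem tendstoC1_of_tendstoUniformly {ι : Type*} {l : Filter ι} {U : ι → ℝ → ℝ} {u : ℝ → ℝ}
    {K : ℝ} (hu : C2Bound u K) (hU : ∀ i, ContDiff ℝ 2 (U i))
    (h : ∀ k ≤ 2, TendstoUniformly (fun i => iteratedDeriv k (U i)) (iteratedDeriv k u) l) :
    TendstoC1 l U u (K + 1) := by
  have h₀ := h 0 (by norm_num)
  have h₁ := h 1 (by norm_num)
  have h₂ := h 2 le_rfl
  simp only [iteratedDeriv_zero] at h₀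
  simp only [iteratedDeriv_one] at h₁
  simp only [iteratedDeriv_succ, iteratedDeriv_zero] at h₂
  have habs {a b : ℝ} (ha : |a| ≤ K) (hab : dist a b < 1) : |b| ≤ K + 1 := by
    rw [dist_comm, Real.dist_eq] at hab
    linarith [abs_sub_abs_le_abs_sub b a]
  refine ⟨h₀, h₁, ?_⟩
  filter_upwards [Metric.tendstoUniformly_iff.1 h₀ 1 one_pos,
    Metric.tendstoUniformly_iff.1 h₁ 1 one_pos, Metric.tendstoUniformly_iff.1 h₂ 1 one_pos]
    with i d₀ d₁ d₂
  exact ⟨hU i, fun x => habs (hu.abs_le x) (d₀ x), fun x => habs (hu.abs_deriv_le x) (d₁ x),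
    fun x => habs (hu.abs_deriv_deriv_le x) (d₂ x)⟩

theorem TendstoC1.mono {ι : Type*} {l l' : Filter ι} {U : ι → ℝ → ℝ} {u : ℝ → ℝ} {K K' : ℝ}
    (h : TendstoC1 l U u K) (hl : l' ≤ l) (hK : K ≤ K') : TendstoC1 l' U u K' where
  tendstoUniformly V hV := (h.tendstoUniformly V hV).filter_mono hl
  tendstoUniformly_deriv V hV := (h.tendstoUniformly_deriv V hV).filter_mono hl
  eventually_c2Bound := (h.eventually_c2Bound.filter_mono hl).mono fun _ hi =>
    ⟨hi.contDiff, fun x => (hi.abs_le x).trans hK, fun x => (hi.abs_deriv_le x).trans hK,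
      fun x => (hi.abs_deriv_deriv_le x).trans hK⟩

theorem HamiltonOrbit.abs_le_of_map_add {u w x p y q : ℝ → ℝ} {K δ ℓ a : ℝ}
    (h : HamiltonOrbit u w x p y q) (hu : C2Bound u K) (hw : C2Bound w K) (hδ : 0 < δ)
    (hV : ∀ ξ η, δ ≤ u ξ + w η) (hℓ : 0 < ℓ) (hx : ∀ t, x (t + ℓ) = x t + a) :
    |a| ≤ (2 * K + 1) / δ * ℓ := by
  simpa only [hx, add_sub_cancel_left, abs_of_pos hℓ] using
    h.abs_x_sub_le hu hw hδ hV 0 (0 + ℓ)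

namespace CircleFun

variable {r : WithTop ℕ∞}

theorem tendstoUniformly (f : CircleFun r) :
    TendstoUniformly (fun g : CircleFun r => (g : ℝ → ℝ)) f (𝓝 f) := by
  simpa only [iteratedDeriv_zero] using f.tendstoUniformly_iteratedDeriv (k := 0) (by simp)

theorem exists_eventually_lt_add {f g : CircleFun r} {a : ℝ} (h : ∀ ξ η, a < f ξ + g η) :
    ∃ b > a, ∀ᶠ q in 𝓝 (f, g), ∀ ξ η, b < q.1 ξ + q.2 η := by
  obtain ⟨ξ₀, hξ₀⟩ :=
    exists_isLeast_range_of_continuous_of_periodic f.2.1.continuous f.2.2 one_ne_zero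
  obtain ⟨η₀, hη₀⟩ :=
    exists_isLeast_range_of_continuous_of_periodic g.2.1.continuous g.2.2 one_ne_zero
  obtain ⟨b, hab, hb⟩ := exists_between (h ξ₀ η₀)
  have hgap : 0 < (f ξ₀ + g η₀ - b) / 2 := by linarith
  refine ⟨b, hab, ?_⟩
  filter_upwards [(continuous_fst.tendsto (f, g)).eventually
      (Metric.tendstoUniformly_iff.1 f.tendstoUniformly _ hgap),
    (continuous_snd.tendsto (f, g)).eventually
      (Metric.tendstoUniformly_iff.1 g.tendstoUniformly _ hgap)] with q hf hg ξ η
  have hfξ := (abs_lt.1 (hf ξ)).2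
  have hgη := (abs_lt.1 (hg η)).2
  linarith [hξ₀ ξ, hη₀ η]

theorem isOpen_setOf_forall_lt_add (a : ℝ) :
    IsOpen {p : CircleFun r × CircleFun r | ∀ ξ η, a < p.1 ξ + p.2 η} := by
  refine isOpen_iff_mem_nhds.2 fun p hp => ?_
  obtain ⟨b, hab, hb⟩ := exists_eventually_lt_add hp
  exact hb.mono fun q hq ξ η => hab.trans (hq ξ η)

end CircleFun

namespace LiouvillePair

variable {r : WithTop ℕ∞}

/-- The summand `1 + f₁` of the conformal factor, so that the factor is
`p.left x₁ + p.right x₂`. -/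
def left (p : LiouvillePair r) : ℝ → ℝ := fun ξ => 1 + p.1.1 ξ

/-- The summand `f₂` of the conformal factor. -/
def right (p : LiouvillePair r) : ℝ → ℝ := p.1.2

theorem periodic_left (p : LiouvillePair r) : Function.Periodic p.left 1 := fun ξ =>
  congrArg (1 + ·) (p.1.1.2.2 ξ)

theorem periodic_right (p : LiouvillePair r) : Function.Periodic p.right 1 := p.1.2.2.2

theorem contDiff_left (hr : 2 ≤ r) (p : LiouvillePair r) : ContDiff ℝ 2 p.left :=
  contDiff_const.add (p.1.1.2.1.of_le hr)

theorem contDiff_right (hr : 2 ≤ r) (p : LiouvillePair r) : ContDiff ℝ 2 p.right :=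
  p.1.2.2.1.of_le hr

theorem left_add_right_pos (p : LiouvillePair r) (ξ η : ℝ) : 0 < p.left ξ + p.right η := by
  have hp := p.2 ξ η
  simp only [left, right]
  linarith

theorem mem_lengthSpectrum_iff (hr : 2 ≤ r) (p : LiouvillePair r) {m n : ℤ} {ℓ : ℝ} :
    ℓ ∈ (p.metric hr).lengthSpectrum m n ↔ 0 < ℓ ∧ ∃ x p' y q,
      HamiltonOrbit p.left p.right x p' y q ∧ (∀ t, x (t + ℓ) = x t + m) ∧
        ∀ t, y (t + ℓ) = y t + n :=
  mem_lengthSpectrum_liouvilleMetric_iff _ _ _ _ _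

theorem lengthSpectrum_subset (hr : 2 ≤ r) (p : LiouvillePair r) (m n : ℤ) :
    (p.metric hr).lengthSpectrum m n ⊆ separatedSpectrum p.left p.right m n := fun _ hℓ => by
  obtain ⟨hℓ₀, x, p', y, q, h, hx, hy⟩ := (p.mem_lengthSpectrum_iff hr).1 hℓ
  exact h.mem_separatedSpectrum (p.contDiff_left hr).continuous (p.contDiff_right hr).continuous
    p.left_add_right_pos p.periodic_left p.periodic_right hℓ₀ hx hy

theorem lengthSpectrum_subsingleton (hr : 2 ≤ r) (p : LiouvillePair r) {m n : ℤ}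
    (h : m * n ≠ 0) : ((p.metric hr).lengthSpectrum m n).Subsingleton :=
  (separatedSpectrum_subsingleton (p.contDiff_left hr) (p.contDiff_right hr) p.periodic_left
    p.periodic_right (left_ne_zero_of_mul h) (right_ne_zero_of_mul h)).anti
    (p.lengthSpectrum_subset hr m n)

theorem tendstoUniformly_iteratedDeriv_right (p₀ : LiouvillePair r) {k : ℕ}
    (hk : (k : WithTop ℕ∞) ≤ r) :
    TendstoUniformly (fun p : LiouvillePair r => iteratedDeriv k p.right)
      (iteratedDeriv k p₀.right) (𝓝 p₀) := fun V hV =>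
  ((continuous_snd.comp continuous_subtype_val).tendsto p₀).eventually
    (p₀.1.2.tendstoUniformly_iteratedDeriv hk V hV)

theorem dist_iteratedDeriv_left (p q : LiouvillePair r) (k : ℕ) (ξ : ℝ) :
    dist (iteratedDeriv k p.left ξ) (iteratedDeriv k q.left ξ) =
      dist (iteratedDeriv k p.1.1 ξ) (iteratedDeriv k q.1.1 ξ) := by
  rcases k.eq_zero_or_pos with rfl | hk
  · simp only [iteratedDeriv_zero, left, dist_add_left]
  · unfold left
    rw [iteratedDeriv_const_add hk, iteratedDeriv_const_add hk]

theorem tendstoUniformly_iteratedDeriv_left (p₀ : LiouvillePair r) {k : ℕ}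
    (hk : (k : WithTop ℕ∞) ≤ r) :
    TendstoUniformly (fun p : LiouvillePair r => iteratedDeriv k p.left)
      (iteratedDeriv k p₀.left) (𝓝 p₀) := by
  refine Metric.tendstoUniformly_iff.2 fun ε hε => ?_
  simp only [dist_iteratedDeriv_left]
  exact ((continuous_fst.comp continuous_subtype_val).tendsto p₀).eventually
    (Metric.tendstoUniformly_iff.1 (p₀.1.1.tendstoUniformly_iteratedDeriv hk) ε hε)

theorem exists_tendstoC1 (hr : 2 ≤ r) (p₀ : LiouvillePair r) : ∃ K,
    TendstoC1 (𝓝 p₀) left p₀.left K ∧ TendstoC1 (𝓝 p₀) right p₀.right K := by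
  obtain ⟨K, -, hK⟩ := exists_c2Bound (p₀.contDiff_left hr) p₀.periodic_left
  obtain ⟨K', -, hK'⟩ := exists_c2Bound (p₀.contDiff_right hr) p₀.periodic_right
  have hle {k : ℕ} (hk : k ≤ 2) : (k : WithTop ℕ∞) ≤ r := le_trans (by exact_mod_cast hk) hr
  have hleft := tendstoC1_of_tendstoUniformly hK (contDiff_left hr) fun k hk =>
    p₀.tendstoUniformly_iteratedDeriv_left (hle hk)
  have hright := tendstoC1_of_tendstoUniformly hK' (contDiff_right hr) fun k hk =>
    p₀.tendstoUniformly_iteratedDeriv_right (hle hk)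
  exact ⟨_, hleft.mono le_rfl (le_max_left _ _), hright.mono le_rfl (le_max_right _ _)⟩

theorem exists_eventually_le_left_add_right (p₀ : LiouvillePair r) :
    ∃ δ > 0, ∀ᶠ p in 𝓝 p₀, ∀ ξ η, δ ≤ p.left ξ + p.right η := by
  obtain ⟨b, hb, h⟩ := CircleFun.exists_eventually_lt_add p₀.2
  refine ⟨1 + b, by linarith, ?_⟩
  filter_upwards [(continuous_subtype_val.tendsto p₀).eventually h] with p hp ξ η
  have hpξη := hp ξ η
  simp only [left, right]
  linarith

theorem exists_eventually_abs_class_le (hr : 2 ≤ r) (p₀ : LiouvillePair r) :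
    ∃ S, 0 ≤ S ∧ ∀ᶠ p in 𝓝 p₀, ∀ (m n : ℤ), ∀ ℓ ∈ (p.metric hr).lengthSpectrum m n,
      |(m : ℝ)| ≤ S * ℓ ∧ |(n : ℝ)| ≤ S * ℓ := by
  obtain ⟨K, hL, hR⟩ := p₀.exists_tendstoC1 hr
  obtain ⟨δ, hδ, hV⟩ := p₀.exists_eventually_le_left_add_right
  have hK : 0 ≤ K := hL.eventually_c2Bound.self_of_nhds.nonneg
  refine ⟨(2 * K + 1) / δ, by positivity, ?_⟩
  filter_upwards [hL.eventually_c2Bound, hR.eventually_c2Bound, hV] with p bL bR hV m n ℓ hℓ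
  obtain ⟨hℓ₀, x, p', y, q, h, hx, hy⟩ := (p.mem_lengthSpectrum_iff hr).1 hℓ
  exact ⟨h.abs_le_of_map_add bL bR hδ hV hℓ₀ hx, h.swap.abs_le_of_map_add bR bL hδ
    (fun η ξ => (hV ξ η).trans_eq (add_comm _ _)) hℓ₀ hy⟩

/-- The pairs for which the homology classes `i.1` and `i.2` share a length that is at most `T`;
NCC fails up to `T` exactly on the union of these sets over `CoincidenceIndex`. -/
def coincidence (hr : 2 ≤ r) (T : ℝ) (i : (ℤ × ℤ) × ℤ × ℤ) : Set (LiouvillePair r) :=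
  {p | ∃ ℓ ≤ T, ℓ ∈ (p.metric hr).lengthSpectrum i.1.1 i.1.2 ∧
    ℓ ∈ (p.metric hr).lengthSpectrum i.2.1 i.2.2}

/-- The pairs of homology classes `((m, n), (m', n'))` whose lengths NCC compares: `m n ≠ 0` and
`m' n' = 0`. -/
abbrev CoincidenceIndex : Type :=
  {i : (ℤ × ℤ) × ℤ × ℤ // i.1.1 * i.1.2 ≠ 0 ∧ i.2.1 * i.2.2 = 0}

theorem setOf_ncc_eq (hr : 2 ≤ r) (T : ℝ) :
    {p : LiouvillePair r | (p.metric hr).NCC (Icc 0 T)} =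
      (⋃ i : CoincidenceIndex, coincidence hr T i)ᶜ := by
  ext p
  rw [mem_compl_iff, mem_iUnion, not_exists]
  refine eq_empty_iff_forall_notMem.trans ⟨?_, ?_⟩
  · rintro h ⟨⟨⟨m, n⟩, m', n'⟩, hi, hi'⟩ ⟨ℓ, hT, hℓ, hℓ'⟩
    refine h ℓ ⟨⟨⟨m, n, hi, hℓ, fun ℓ₁ hℓ₁ => ?_⟩, m', n', hi', hℓ'⟩,
      ((p.mem_lengthSpectrum_iff hr).1 hℓ).1.le, hT⟩
    exact (lengthSpectrum_subsingleton hr p hi hℓ hℓ₁).le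
  · rintro h ℓ ⟨⟨⟨m, n, hi, hℓ⟩, m', n', hi', hℓ'⟩, -, hT⟩
    exact h ⟨((m, n), m', n'), hi, hi'⟩ ⟨ℓ, hT, hℓ.1, hℓ'⟩

theorem locallyFinite_coincidence (hr : 2 ≤ r) (T : ℝ) :
    LocallyFinite (coincidence (r := r) hr T) := fun p₀ => by
  obtain ⟨S, hS, hclass⟩ := p₀.exists_eventually_abs_class_le hr
  refine ⟨_, hclass, ?_⟩
  set I := Icc (-⌊S * T⌋) ⌊S * T⌋
  have hI : I.Finite := finite_Icc _ _
  refine ((hI.prod hI).prod (hI.prod hI)).subset ?_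
  rintro ⟨⟨m, n⟩, m', n'⟩ ⟨p, ⟨ℓ, hT, hℓ, hℓ'⟩, hclass⟩
  have mem_I {k : ℤ} (hk : |(k : ℝ)| ≤ S * ℓ) : k ∈ I := by
    refine abs_le.1 (Int.le_floor.2 ?_)
    rw [Int.cast_abs]
    exact hk.trans (mul_le_mul_of_nonneg_left hT hS)
  have hmn := hclass m n ℓ hℓ
  have hmn' := hclass m' n' ℓ hℓ'
  exact ⟨⟨mem_I hmn.1, mem_I hmn.2⟩, mem_I hmn'.1, mem_I hmn'.2⟩

section Limits

variable {p₀ : LiouvillePair r} {F : Ultrafilter (LiouvillePair r)} {ℓ : LiouvillePair r → ℝ}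
  {ℓ₀ : ℝ} {m n : ℤ}

theorem pos_of_tendsto (hr : 2 ≤ r) (hF : F ≤ 𝓝 p₀) (hℓ : Tendsto ℓ F (𝓝 ℓ₀)) (hm : m ≠ 0)
    (h : ∀ᶠ p in F, ℓ p ∈ (p.metric hr).lengthSpectrum m n) : 0 < ℓ₀ := by
  obtain ⟨S, hS, hclass⟩ := p₀.exists_eventually_abs_class_le hr
  have hle : |(m : ℝ)| ≤ S * ℓ₀ := by
    refine ge_of_tendsto (hℓ.const_mul S) ?_
    filter_upwards [h, hF hclass] with p hp hclass using (hclass m n _ hp).1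
  exact pos_of_mul_pos_right ((abs_pos.2 (Int.cast_ne_zero.2 hm)).trans_le hle) hS

theorem mem_lengthSpectrum_of_tendsto (hr : 2 ≤ r) (hF : F ≤ 𝓝 p₀) (hℓ : Tendsto ℓ F (𝓝 ℓ₀))
    (hℓ₀ : 0 < ℓ₀) (h : ∀ᶠ p in F, ℓ p ∈ (p.metric hr).lengthSpectrum m n) :
    ℓ₀ ∈ (p₀.metric hr).lengthSpectrum m n := by
  obtain ⟨K, hL, hR⟩ := p₀.exists_tendstoC1 hr
  obtain ⟨δ, hδ, hV⟩ := p₀.exists_eventually_le_left_add_right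
  refine (p₀.mem_lengthSpectrum_iff hr).2 ⟨hℓ₀, exists_hamiltonOrbit_of_tendsto
    (hL.mono hF le_rfl) (hR.mono hF le_rfl) hδ (hF hV) periodic_left periodic_right hℓ ?_⟩
  exact h.mono fun p hp => ((p.mem_lengthSpectrum_iff hr).1 hp).2

end Limits

theorem isClosed_coincidence (hr : 2 ≤ r) (T : ℝ) {i : (ℤ × ℤ) × ℤ × ℤ} (hi : i.1.1 ≠ 0) :
    IsClosed (coincidence (r := r) hr T i) := by
  refine isClosed_iff_ultrafilter.2 fun p₀ F hF hmem => ?_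
  have hchoice : ∀ᶠ p in (F : Filter (LiouvillePair r)), ∃ ℓ ≤ T,
      ℓ ∈ (p.metric hr).lengthSpectrum i.1.1 i.1.2 ∧
        ℓ ∈ (p.metric hr).lengthSpectrum i.2.1 i.2.2 := hmem
  obtain ⟨ℓ, hℓ⟩ := hchoice.choice
  simp only [eventually_and] at hℓ
  obtain ⟨hT, hspec, hspec'⟩ := hℓ
  have habs : ∀ᶠ p in (F : Filter (LiouvillePair r)), |ℓ p| ≤ T := by
    filter_upwards [hT, hspec] with p hT hp
    rwa [abs_of_pos ((p.mem_lengthSpectrum_iff hr).1 hp).1]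
  obtain ⟨ℓ₀, hlim⟩ := exists_tendsto_of_eventually_abs_le F habs
  have hℓ₀ : 0 < ℓ₀ := pos_of_tendsto hr hF hlim hi hspec
  exact ⟨ℓ₀, le_of_tendsto hlim hT, mem_lengthSpectrum_of_tendsto hr hF hlim hℓ₀ hspec,
    mem_lengthSpectrum_of_tendsto hr hF hlim hℓ₀ hspec'⟩

end LiouvillePair

/-! ### Density -/

namespace CircleFun

variable {r : WithTop ℕ∞}

/-- The constant functions on the circle, which enter the directions `u - μ` of the dilations
`u + s (u - μ)`. -/
def const (r : WithTop ℕ∞) (a : ℝ) : CircleFun r :=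
  ⟨fun _ => a, contDiff_const, fun _ => rfl⟩

/-- The function `x ↦ cos (2πx)` on the circle, used to perturb a function to a nonconstant
one. -/
def cos (r : WithTop ℕ∞) : CircleFun r :=
  ⟨fun x => Real.cos (2 * Real.pi * x), Real.contDiff_cos.comp (contDiff_const.mul contDiff_id),
    fun x => by
      change Real.cos (2 * Real.pi * (x + 1)) = _
      rw [mul_add, mul_one, Real.cos_add_two_pi]⟩

theorem frequently_add_smul_cos_ne (f : CircleFun r) :
    ∃ᶠ s : ℝ in 𝓝 0, (f + s • cos r : CircleFun r) 0 ≠ (f + s • cos r : CircleFun r) (1 / 2) := by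
  have hzero (s : ℝ) : (f + s • cos r : CircleFun r) 0 = f 0 + s := by
    change f 0 + s * Real.cos (2 * Real.pi * 0) = _
    rw [mul_zero, Real.cos_zero, mul_one]
  have hhalf (s : ℝ) : (f + s • cos r : CircleFun r) (1 / 2) = f (1 / 2) - s := by
    change f (1 / 2) + s * Real.cos (2 * Real.pi * (1 / 2)) = _
    rw [mul_right_comm, mul_one_div_cancel two_ne_zero, one_mul, Real.cos_pi,
      mul_neg_one, sub_eq_add_neg]
  refine (mem_closure_iff_frequently.1
    (dense_compl_singleton ((f (1 / 2) - f 0) / 2) 0)).mono fun s hs h => hs ?_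
  rw [hzero, hhalf] at h
  rw [mem_singleton_iff]
  linarith

end CircleFun

namespace LiouvillePair

variable {r : WithTop ℕ∞} {p : LiouvillePair r} {O : Set (LiouvillePair r)}

theorem eventually_exists_perturbation (hO : O ∈ 𝓝 p) (h₁ h₂ : CircleFun r) :
    ∀ᶠ s : ℝ in 𝓝 0, ∃ q ∈ O, q.1 = (p.1.1 + s • h₁, p.1.2 + s • h₂) := by
  have himage : ∀ᶠ f in 𝓝 p.1, ∃ q ∈ O, q.1 = f :=
    (CircleFun.isOpen_setOf_forall_lt_add (-1)).isOpenEmbedding_subtypeVal.image_mem_nhds.2 hO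
  have hcont : Continuous fun s : ℝ => (p.1.1 + s • h₁, p.1.2 + s • h₂) :=
    (p.1.1.continuous_add_smul h₁).prodMk (p.1.2.continuous_add_smul h₂)
  refine (hcont.tendsto 0).eventually (p := fun f => ∃ q ∈ O, q.1 = f) ?_
  simpa only [zero_smul, add_zero] using himage

theorem dense_setOf_left_ne : Dense {p : LiouvillePair r | p.left 0 ≠ p.left (1 / 2)} := by
  refine fun p => mem_closure_iff_nhds.2 fun O hO => ?_
  obtain ⟨s, hne, q, hqO, hq⟩ := (p.1.1.frequently_add_smul_cos_ne.and_eventually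
    (eventually_exists_perturbation hO (CircleFun.cos r) 0)).exists
  refine ⟨q, hqO, fun h => hne ?_⟩
  simp only [left, hq] at h
  exact add_left_cancel h

theorem dense_setOf_right_ne : Dense {p : LiouvillePair r | p.right 0 ≠ p.right (1 / 2)} := by
  refine fun p => mem_closure_iff_nhds.2 fun O hO => ?_
  obtain ⟨s, hne, q, hqO, hq⟩ := (p.1.2.frequently_add_smul_cos_ne.and_eventually
    (eventually_exists_perturbation hO 0 (CircleFun.cos r))).exists
  refine ⟨q, hqO, fun h => hne ?_⟩
  simpa only [right, hq] using h

theorem eventually_exists_dilate_left (hO : O ∈ 𝓝 p) (μ : ℝ) :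
    ∀ᶠ s in 𝓝 0, ∃ q ∈ O, q.left = dilate p.left μ s ∧ q.right = p.right := by
  refine (eventually_exists_perturbation hO (p.1.1 - CircleFun.const r (μ - 1)) 0).mono ?_
  rintro s ⟨q, hqO, hq⟩
  refine ⟨q, hqO, funext fun ξ => ?_, ?_⟩
  · simp only [left, hq]
    change 1 + (p.1.1 ξ + s * (p.1.1 ξ - (μ - 1))) = (1 + p.1.1 ξ) + s * ((1 + p.1.1 ξ) - μ)
    ring
  · simp only [right, hq, smul_zero, add_zero]

theorem eventually_exists_dilate_right (hO : O ∈ 𝓝 p) (μ : ℝ) :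
    ∀ᶠ s in 𝓝 0, ∃ q ∈ O, q.left = p.left ∧ q.right = dilate p.right μ s := by
  refine (eventually_exists_perturbation hO 0 (p.1.2 - CircleFun.const r μ)).mono ?_
  rintro s ⟨q, hqO, hq⟩
  refine ⟨q, hqO, ?_, ?_⟩
  · unfold left
    simp only [hq, smul_zero, add_zero]
  · simp only [right, hq]
    rfl

theorem notMem_coincidence_of_disjoint (hr : 2 ≤ r) (T : ℝ) {m n m' n' : ℤ}
    (h : Disjoint (separatedSpectrum p.left p.right m n)
      (separatedSpectrum p.left p.right m' n')) : p ∉ coincidence hr T ((m, n), m', n') :=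
  fun ⟨_, _, hℓ, hℓ'⟩ =>
    disjoint_left.1 h (lengthSpectrum_subset hr p m n hℓ) (lengthSpectrum_subset hr p m' n' hℓ')

theorem mem_closure_compl_coincidence_zero_left (hr : 2 ≤ r) (T : ℝ) {m n : ℤ} (hm : m ≠ 0)
    (hn : n ≠ 0) (n' : ℤ) (hp : ∃ ξ η, p.right ξ ≠ p.right η) :
    p ∈ closure (coincidence hr T ((m, n), 0, n'))ᶜ := by
  refine mem_closure_iff_nhds.2 fun O hO => ?_
  obtain ⟨μ, hμ⟩ := exists_dilate_disjoint (p.contDiff_left hr) (p.contDiff_right hr)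
    p.periodic_left p.periodic_right p.left_add_right_pos hp hm hn n'
  obtain ⟨ε, hε, hO⟩ := Metric.eventually_nhds_iff.1 (eventually_exists_dilate_right hO μ)
  obtain ⟨s, hs, hdisj⟩ := hμ ε hε
  have hdist : dist s 0 < ε := by
    rw [Real.dist_0_eq_abs, abs_of_nonneg hs.1]
    exact hs.2
  obtain ⟨q, hqO, hleft, hright⟩ := hO hdist
  rw [← hleft, ← hright] at hdisj
  exact ⟨q, hqO, notMem_coincidence_of_disjoint hr T hdisj⟩

theorem mem_closure_compl_coincidence_zero_right (hr : 2 ≤ r) (T : ℝ) {m n : ℤ} (hm : m ≠ 0)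
    (hn : n ≠ 0) (m' : ℤ) (hp : ∃ ξ η, p.left ξ ≠ p.left η) :
    p ∈ closure (coincidence hr T ((m, n), m', 0))ᶜ := by
  refine mem_closure_iff_nhds.2 fun O hO => ?_
  obtain ⟨μ, hμ⟩ := exists_dilate_disjoint (p.contDiff_right hr) (p.contDiff_left hr)
    p.periodic_right p.periodic_left
    (fun η ξ => (p.left_add_right_pos ξ η).trans_eq (add_comm _ _)) hp hn hm m'
  obtain ⟨ε, hε, hO⟩ := Metric.eventually_nhds_iff.1 (eventually_exists_dilate_left hO μ)
  obtain ⟨s, hs, hdisj⟩ := hμ ε hε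
  have hdist : dist s 0 < ε := by
    rw [Real.dist_0_eq_abs, abs_of_nonneg hs.1]
    exact hs.2
  obtain ⟨q, hqO, hleft, hright⟩ := hO hdist
  rw [← hleft, ← hright] at hdisj
  exact ⟨q, hqO, notMem_coincidence_of_disjoint hr T <|
    hdisj.mono (fun _ => separatedSpectrum_swap) fun _ => separatedSpectrum_swap⟩

theorem dense_compl_coincidence (hr : 2 ≤ r) (T : ℝ) (i : CoincidenceIndex) :
    Dense (coincidence (r := r) hr T i)ᶜ := by
  obtain ⟨⟨⟨m, n⟩, m', n'⟩, hi, hi'⟩ := i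
  have hm : m ≠ 0 := left_ne_zero_of_mul hi
  have hn : n ≠ 0 := right_ne_zero_of_mul hi
  rcases mul_eq_zero.1 hi' with rfl | rfl
  · exact (dense_setOf_right_ne.mono fun p hp =>
      mem_closure_compl_coincidence_zero_left hr T hm hn n' ⟨_, _, hp⟩).of_closure
  · exact (dense_setOf_left_ne.mono fun p hp =>
      mem_closure_compl_coincidence_zero_right hr T hm hn m' ⟨_, _, hp⟩).of_closure

theorem isOpen_ncc (hr : 2 ≤ r) (T : ℝ) :
    IsOpen {p : LiouvillePair r | (p.metric hr).NCC (Icc 0 T)} := by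
  rw [setOf_ncc_eq, isOpen_compl_iff]
  exact ((locallyFinite_coincidence hr T).comp_injective Subtype.val_injective).isClosed_iUnion
    fun i => isClosed_coincidence hr T (left_ne_zero_of_mul i.2.1)

theorem dense_ncc (hr : 2 ≤ r) (T : ℝ) :
    Dense {p : LiouvillePair r | (p.metric hr).NCC (Icc 0 T)} := by
  rw [setOf_ncc_eq]
  exact dense_compl_iUnion_of_locallyFinite
    ((locallyFinite_coincidence hr T).comp_injective Subtype.val_injective)
    (fun i => isClosed_coincidence hr T (left_ne_zero_of_mul i.2.1)) (dense_compl_coincidence hr T)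

end LiouvillePair

end

/-- `r` ranges over the natural numbers `≥ 2`, `∞` and `ω` (analytic). -/
theorem propositionA1 (r : WithTop ℕ∞) (hr : 2 ≤ r) :
    (∀ᶠ p in residual (LiouvillePair r), (LiouvillePair.metric hr p).NCC (Set.Ici 0)) ∧
    ∀ T : ℝ, 0 ≤ T →
      IsOpen {p : LiouvillePair r | (LiouvillePair.metric hr p).NCC (Set.Icc 0 T)} ∧
      Dense {p : LiouvillePair r | (LiouvillePair.metric hr p).NCC (Set.Icc 0 T)} := by
  refine ⟨?_, fun T _ => ⟨LiouvillePair.isOpen_ncc hr T, LiouvillePair.dense_ncc hr T⟩⟩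
  have h : ∀ᶠ p in residual (LiouvillePair r), ∀ N : ℕ,
      (LiouvillePair.metric hr p).NCC (Set.Icc 0 (N : ℝ)) :=
    eventually_countable_forall.2 fun N =>
      residual_of_dense_open (LiouvillePair.isOpen_ncc hr N) (LiouvillePair.dense_ncc hr N)
  filter_upwards [h] with p hp
  refine Set.eq_empty_iff_forall_notMem.2 fun ℓ hℓ => ?_
  obtain ⟨N, hN⟩ := exists_nat_ge ℓ
  exact Set.eq_empty_iff_forall_notMem.1 (hp N) ℓ ⟨hℓ.1, hℓ.2, hN⟩
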